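/- **Proposition 5.2.** Let $\mathbb T^2=(\mathbb R/2\pi\mathbb Z)^2$, let $\mathcal D'(\mathbb T^2)$ be the topological dual of $C^\infty(\mathbb T^2)$ (complex valued), and put $e_l(x)=e^{i l\cdot x}$, $\hat f(l)=\langle f,e_{-l}\rangle$ for $f\in\mathcal D'(\mathbb T^2)$, $l\in\mathbb Z^2$, where $\langle\cdot,\cdot\rangle$ extends $\frac1{2\pi}\int_{\mathbb T^2}fg\,dx$. Let $\chi,\rho\in C_c^\infty(\mathbb R^2)$ be nonnegative with $\operatorname{supp}\chi\subset\{|x|\le4\}$, $\operatorname{supp}\rho\subset\{1\le|x|\le4\}$ and $\chi(x)+\sum_{i\ge0}\rho(2^{-i}x)=1$ for all $x$; put $\rho_{-1}=\chi$, $\rho_j=\rho(2^{-j}\cdot)$ for $j\ge0$, $\Delta_mf=\frac1{2\pi}\sum_{l\in\mathbb Z^2}\rho_m(l)\hat f(l)e_l$, and for $s\in\mathbb R$ let $B^s_{\infty,\infty}$ be the space of all $f\in\mathcal D'(\mathbb T^2)$ with $\|f\|_{B^s_{\infty,\infty}}=\sup_{m\ge-1}2^{ms}\|\Delta_mf\|_{L^\infty(\mathbb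 T^2)}<\infty$. Let $e^{t\Delta}f=\frac1{2\pi}\sum_{l}e^{-t|l|^2}\hat f(l)e_l$, and let the product of $f,g\in\mathcal D'(\mathbb T^2)$ be $fg=\lim_{N\to\infty}\big(\sum_{m<N}\Delta_mf\big)\big(\sum_{m<N}\Delta_mg\big)$ in $\mathcal D'(\mathbb T^2)$, whenever this limit exists. Let $0<\epsilon<\frac12$, $T>0$, and let $$\Xi_1\in L^{\frac2{1-\epsilon}}([0,T];B^{-\epsilon}_{\infty,\infty}),\qquad \Xi_2\in L^{\frac1{1-\epsilon}}([0,T];B^{-2\epsilon}_{\infty,\infty})$$ (Bochner spaces). Then for all $\gamma,\delta$ with $\frac2{1-\epsilon}<\gamma<\frac2\epsilon$ and $0<\delta<\frac2\gamma-\epsilon$, and every $u_0\in B^{2/\gamma-\delta}_{\infty,\infty}$, there is $T_0\in(0,T]$ (which may depend on all these data) such that for every $T'\in(0,T_0]$ there is exactly one $$v\in L^\gamma([0,T'];B^{2/\gamma-\delta}_{\infty,\infty})\cap C([0,T'];B^{-\delta}_{\infty,\infty})$$ that satisfies $$v(t)=e^{t\Delta}u_0+\int_0^te^{(t-s)\Delta}\big(v(s)^2+2v(s)\Xi_1(s)+\Xi_2(s)\big)\,ds\qquad\text{in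 }\mathcal D'(\mathbb T^2)\text{ for all }t\in[0,T'].$$ Here it is part of being a solution that the products exist for almost every $s$, and the integral is taken after testing with each $\varphi\in C^\infty(\mathbb T^2)$, the integrand being then integrable. -/

import Mathlib

noncomputable section

namespace TorusHeat

open MeasureTheory Filter Topology Set
open scoped ContDiff ENNReal

/-- The plane `ℝ²` with its Euclidean norm. Functions on the torus `𝕋² = (ℝ/2πℤ)²` are
functions on the plane that are `2π`-periodic in each coordinate. -/
abbrev Plane : Type := EuclideanSpace ℝ (Fin 2)

/-- The frequency lattice `ℤ²`. -/
abbrev Freq : Type := Fin 2 → ℤ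

/-- A lattice point as a point of the plane. -/
def latticePoint (l : Freq) : Plane := WithLp.toLp 2 (fun i => (l i : ℝ))

/-- The space `C^∞(𝕋²)` of complex valued smooth periodic functions. -/
def smoothPeriodic : Submodule ℂ (Plane → ℂ) where
  carrier := {φ | ContDiff ℝ ∞ φ ∧
    ∀ (n : Freq) (x : Plane), φ (x + (2 * Real.pi) • latticePoint n) = φ x}
  add_mem' := by
    rintro φ ψ ⟨h1, h2⟩ ⟨h3, h4⟩
    exact ⟨h1.add h3, fun n x => by simp [h2, h4]⟩
  zero_mem' := ⟨contDiff_const, fun _ _ => rfl⟩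
  smul_mem' := by
    rintro c φ ⟨h1, h2⟩
    exact ⟨h1.const_smul c, fun n x => by simp [h2]⟩

/-- Test functions on the torus. -/
abbrev TestFn : Type := smoothPeriodic

/-- The exponential `e_l(x) = exp(i l·x)` as a function. -/
def expFn (l : Freq) (x : Plane) : ℂ :=
  Complex.exp (Complex.I * ((∑ i, (l i : ℝ) * x i : ℝ) : ℂ))

theorem expFn_mem (l : Freq) : expFn l ∈ smoothPeriodic := by
  constructor
  · unfold expFn
    have h : ContDiff ℝ ∞ (fun x : Plane => (∑ i, (l i : ℝ) * x i : ℝ)) := by fun_prop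
    have h2 : ContDiff ℝ ∞ (fun x : Plane => ((∑ i, (l i : ℝ) * x i : ℝ) : ℂ)) :=
      Complex.ofRealCLM.contDiff.comp h
    exact (contDiff_const.mul h2).cexp
  · intro n x
    unfold expFn
    have h : Complex.I *
          ((∑ i, (l i : ℝ) * (x + (2 * Real.pi) • latticePoint n) i : ℝ) : ℂ)
        = Complex.I * ((∑ i, (l i : ℝ) * x i : ℝ) : ℂ)
          + ((∑ i, l i * n i : ℤ) : ℂ) * (2 * Real.pi * Complex.I) := by
      simp [latticePoint, Fin.sum_univ_two]
      ring
    rw [h, Complex.exp_periodic.int_mul]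

/-- The exponential `e_l` as a test function. -/
def expTest (l : Freq) : TestFn := ⟨expFn l, expFn_mem l⟩

/-- The space `𝓓'(𝕋²)`, the topological dual of the Fréchet space `C^∞(𝕋²)`: the linear functionals
that are bounded by a constant times finitely many of the seminorms
`φ ↦ sup_x ‖D^j φ(x)‖` defining the topology of `C^∞(𝕋²)`. -/
def distributions : Submodule ℂ (TestFn →ₗ[ℂ] ℂ) where
  carrier := {f | ∃ (C : ℝ) (N : ℕ), ∀ (φ : TestFn) (M : ℝ),
    (∀ j ≤ N, ∀ x, ‖iteratedFDeriv ℝ j (φ : Plane → ℂ) x‖ ≤ M) → ‖f φ‖ ≤ C * M}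
  add_mem' := by
    rintro f g ⟨C, N, h⟩ ⟨C', N', h'⟩
    refine ⟨C + C', max N N', fun φ M hM => ?_⟩
    have h1 := h φ M (fun j hj => hM j (hj.trans (le_max_left _ _)))
    have h2 := h' φ M (fun j hj => hM j (hj.trans (le_max_right _ _)))
    calc ‖(f + g) φ‖ ≤ ‖f φ‖ + ‖g φ‖ := norm_add_le _ _
      _ ≤ (C + C') * M := by linarith
  zero_mem' := ⟨0, 0, fun φ M _ => by simp⟩
  smul_mem' := by
    rintro c f ⟨C, N, h⟩
    refine ⟨‖c‖ * C, N, fun φ M hM => ?_⟩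
    have h1 := h φ M hM
    calc ‖(c • f) φ‖ = ‖c‖ * ‖f φ‖ := by simp
      _ ≤ ‖c‖ * (C * M) := by gcongr
      _ = _ := by ring

/-- Distributions on the torus. -/
abbrev Dist : Type := distributions

/-- The value `⟨f, φ⟩` of a distribution at a test function. -/
def pair (f : Dist) (φ : TestFn) : ℂ := (f : TestFn →ₗ[ℂ] ℂ) φ

/-- The Fourier coefficient `⟨f, e_{-l}⟩`. -/
def fourierCoef (f : Dist) (l : Freq) : ℂ := pair f (expTest (-l))

/-- The fundamental cell `[0, 2π)²` of the torus. -/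
def cell : Set Plane := {x | ∀ i, x i ∈ Ico (0 : ℝ) (2 * Real.pi)}

/-- The pairing `(2π)⁻¹ ∫_{𝕋²} g φ dx` of two functions on the torus. It is by this normalized
pairing that a function is regarded as a distribution, so that
`f = (2π)⁻¹ ∑_l ⟨f, e_{-l}⟩ e_l`. -/
def fnPair (g φ : Plane → ℂ) : ℂ := (2 * Real.pi : ℂ)⁻¹ * ∫ x in cell, g x * φ x

/-- A smooth dyadic partition of unity `(χ, ρ)` on the plane. -/
structure DyadicPartition where
  χ : Plane → ℝ
  ρ : Plane → ℝ
  χ_smooth : ContDiff ℝ ∞ χ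
  ρ_smooth : ContDiff ℝ ∞ ρ
  χ_nonneg : ∀ x, 0 ≤ χ x
  ρ_nonneg : ∀ x, 0 ≤ ρ x
  χ_supp : tsupport χ ⊆ Metric.closedBall 0 4
  ρ_supp : tsupport ρ ⊆ Metric.closedBall 0 4 \ Metric.ball 0 1
  sum_eq_one : ∀ x, HasSum (fun i : ℕ => ρ (((2 : ℝ) ^ i)⁻¹ • x)) (1 - χ x)

variable (P : DyadicPartition)

/-- The symbol of the `m`-th Littlewood-Paley block, with indices shifted by one:
`symbol 0 = ρ_{-1} = χ` and `symbol (j + 1) = ρ_j = ρ(2^{-j} ·)`. -/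
def symbol : ℕ → Plane → ℝ
  | 0 => P.χ
  | j + 1 => fun x => P.ρ (((2 : ℝ) ^ j)⁻¹ • x)

/-- The Littlewood-Paley block `Δ_{m-1} f = (2π)⁻¹ ∑_l ρ_{m-1}(l) ⟨f, e_{-l}⟩ e_l`, which is a
trigonometric polynomial: only finitely many terms are nonzero. -/
def block (m : ℕ) (f : Dist) (x : Plane) : ℂ :=
  (2 * Real.pi : ℂ)⁻¹ *
    ∑' l : Freq, (symbol P m (latticePoint l) : ℂ) * fourierCoef f l * expFn l x

/-- The norm of `B^s_{∞,∞}(𝕋²)`, namely `sup_{m ≥ -1} 2^{ms} ‖Δ_m f‖_{L^∞}`, with values in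
`[0, ∞]`. Blocks are continuous, so their `L^∞` norm is the supremum. -/
def besovENorm (s : ℝ) (f : Dist) : ℝ≥0∞ :=
  ⨆ m : ℕ, ENNReal.ofReal ((2 : ℝ) ^ (((m : ℝ) - 1) * s)) * ⨆ x : Plane, ‖block P m f x‖ₑ

theorem symbol_finite (m : ℕ) : {l : Freq | symbol P m (latticePoint l) ≠ 0}.Finite := by
  have key : ∀ x, symbol P m x ≠ 0 → ‖x‖ ≤ 4 * 2 ^ m := by
    intro x hx
    cases m with
    | zero =>
      have := P.χ_supp (subset_tsupport _ hx)
      simpa using this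
    | succ j =>
      have h1 := (P.ρ_supp (subset_tsupport P.ρ (a := ((2 : ℝ) ^ j)⁻¹ • x) hx)).1
      rw [mem_closedBall_zero_iff, norm_smul, norm_inv, norm_pow, Real.norm_ofNat] at h1
      have h2 : (0 : ℝ) < 2 ^ j := by positivity
      rw [inv_mul_le_iff₀ h2] at h1
      rw [pow_succ]
      nlinarith
  refine (Set.Finite.pi' (fun _ : Fin 2 => Set.finite_Icc (-(4 * 2 ^ m) : ℤ) (4 * 2 ^ m))).subset ?_
  intro l hl i
  have h1 := key _ hl
  have h2 : ‖(latticePoint l) i‖ ≤ ‖latticePoint l‖ := PiLp.norm_apply_le _ i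
  have h3 : |(l i : ℝ)| ≤ 4 * 2 ^ m := by
    have : (latticePoint l) i = (l i : ℝ) := rfl
    rw [this, Real.norm_eq_abs] at h2
    exact h2.trans h1
  have h4 := abs_le.1 h3
  constructor
  · have : ((-(4 * 2 ^ m) : ℤ) : ℝ) ≤ (l i : ℝ) := by push_cast; exact h4.1
    exact_mod_cast this
  · have : (l i : ℝ) ≤ ((4 * 2 ^ m : ℤ) : ℝ) := by push_cast; exact h4.2
    exact_mod_cast this

theorem block_summable (m : ℕ) (f : Dist) (x : Plane) :
    Summable fun l : Freq =>
      (symbol P m (latticePoint l) : ℂ) * fourierCoef f l * expFn l x := by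
  refine summable_of_hasFiniteSupport ((symbol_finite P m).subset ?_)
  intro l hl h
  apply hl
  simp [h]

theorem block_add (m : ℕ) (f g : Dist) (x : Plane) :
    block P m (f + g) x = block P m f x + block P m g x := by
  unfold block
  rw [← mul_add, ← (block_summable P m f x).tsum_add (block_summable P m g x)]
  congr 1
  refine tsum_congr fun l => ?_
  have : fourierCoef (f + g) l = fourierCoef f l + fourierCoef g l := rfl
  rw [this]
  ring

theorem block_smul (m : ℕ) (c : ℂ) (f : Dist) (x : Plane) :
    block P m (c • f) x = c * block P m f x := by
  unfold block
  rw [mul_left_comm, ← tsum_mul_left (a := c)]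
  congr 1
  refine tsum_congr fun l => ?_
  have : fourierCoef (c • f) l = c * fourierCoef f l := rfl
  rw [this]
  ring

theorem besovENorm_smul_le (s : ℝ) (c : ℂ) (f : Dist) :
    besovENorm P s (c • f) ≤ ‖c‖ₑ * besovENorm P s f := by
  refine iSup_le fun m => ?_
  calc _ = ENNReal.ofReal ((2 : ℝ) ^ (((m : ℝ) - 1) * s)) *
        ⨆ x : Plane, ‖c‖ₑ * ‖block P m f x‖ₑ := by simp_rw [block_smul, enorm_mul]
    _ = ‖c‖ₑ * (ENNReal.ofReal ((2 : ℝ) ^ (((m : ℝ) - 1) * s)) *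
        ⨆ x : Plane, ‖block P m f x‖ₑ) := by rw [← ENNReal.mul_iSup]; ring
    _ ≤ _ := by
      gcongr
      exact le_iSup (fun m : ℕ => ENNReal.ofReal ((2 : ℝ) ^ (((m : ℝ) - 1) * s)) *
        ⨆ x : Plane, ‖block P m f x‖ₑ) m

theorem besovENorm_add_le (s : ℝ) (f g : Dist) :
    besovENorm P s (f + g) ≤ besovENorm P s f + besovENorm P s g := by
  refine iSup_le fun m => ?_
  have h : (⨆ x : Plane, ‖block P m (f + g) x‖ₑ) ≤
      (⨆ x : Plane, ‖block P m f x‖ₑ) + ⨆ x : Plane, ‖block P m g x‖ₑ := by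
    refine iSup_le fun x => ?_
    rw [block_add]
    refine (enorm_add_le _ _).trans (add_le_add ?_ ?_)
    · exact le_iSup (fun x => ‖block P m f x‖ₑ) x
    · exact le_iSup (fun x => ‖block P m g x‖ₑ) x
  calc _ ≤ ENNReal.ofReal ((2 : ℝ) ^ (((m : ℝ) - 1) * s)) *
        ((⨆ x : Plane, ‖block P m f x‖ₑ) + ⨆ x : Plane, ‖block P m g x‖ₑ) := by gcongr
    _ ≤ _ := by
      rw [mul_add]
      exact add_le_add
        (le_iSup (fun m : ℕ => ENNReal.ofReal ((2 : ℝ) ^ (((m : ℝ) - 1) * s)) *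
          ⨆ x : Plane, ‖block P m f x‖ₑ) m)
        (le_iSup (fun m : ℕ => ENNReal.ofReal ((2 : ℝ) ^ (((m : ℝ) - 1) * s)) *
          ⨆ x : Plane, ‖block P m g x‖ₑ) m)

theorem besovENorm_zero (s : ℝ) : besovENorm P s 0 = 0 := by
  have h := besovENorm_smul_le P s 0 0
  simpa using h

/-- The distributions with finite `B^s_{∞,∞}` norm. -/
def besovSpace (s : ℝ) : Submodule ℂ Dist where
  carrier := {f | besovENorm P s f < ⊤}
  add_mem' := fun {f g} hf hg =>
    (besovENorm_add_le P s f g).trans_lt (ENNReal.add_lt_top.2 ⟨hf, hg⟩)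
  zero_mem' := by simp [besovENorm_zero]
  smul_mem' := fun c f hf =>
    (besovENorm_smul_le P s c f).trans_lt (ENNReal.mul_lt_top (by simp) hf)

/-- The Besov space `B^s_{∞,∞}(𝕋²)` as a type, with the topology of its norm. -/
def Besov (s : ℝ) : Type := besovSpace P s

instance (s : ℝ) : AddCommGroup (Besov P s) := inferInstanceAs (AddCommGroup (besovSpace P s))

/-- The distribution underlying an element of the Besov space. -/
def Besov.toDist {P : DyadicPartition} {s : ℝ} (f : Besov P s) : Dist :=
  Subtype.val (p := fun g : Dist => g ∈ besovSpace P s) f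

/-- The norm of the Besov space. -/
def besovNorm (s : ℝ) : AddGroupSeminorm (Besov P s) where
  toFun f := (besovENorm P s f.toDist).toReal
  map_zero' := by
    change (besovENorm P s 0).toReal = 0
    simp [besovENorm_zero]
  add_le' f g := by
    have hf : besovENorm P s f.toDist < ⊤ := f.2
    have hg : besovENorm P s g.toDist < ⊤ := g.2
    change (besovENorm P s (f.toDist + g.toDist)).toReal ≤ _
    rw [← ENNReal.toReal_add hf.ne hg.ne]
    exact ENNReal.toReal_mono (ENNReal.add_lt_top.2 ⟨hf, hg⟩).ne (besovENorm_add_le P s _ _)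
  neg' f := by
    have h : ∀ g : Dist, besovENorm P s (-g) ≤ besovENorm P s g := fun g => by
      have h1 := besovENorm_smul_le P s (-1) g
      rwa [neg_one_smul ℂ g, enorm_neg, enorm_one, one_mul] at h1
    change (besovENorm P s (-f.toDist)).toReal = _
    congr 1
    refine le_antisymm (h _) ?_
    simpa using h (-f.toDist)

instance (s : ℝ) : SeminormedAddCommGroup (Besov P s) :=
  (besovNorm P s).toSeminormedAddCommGroup

/-- `v ∈ L^p([0,T]; B^s_{∞,∞}(𝕋²))` (Bochner space: strongly measurable in the Besov norm), where
`v` is a representative, which need take values in the Besov space only almost everywhere. -/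
def MemLpBesov (s : ℝ) (p : ℝ≥0∞) (T : ℝ) (v : ℝ → Dist) : Prop :=
  ∃ w : ℝ → Besov P s, MemLp w p (volume.restrict (Icc 0 T)) ∧
    ∀ᵐ t ∂(volume.restrict (Icc 0 T)), v t = (w t).toDist

/-- `v ∈ C([0,T]; B^s_{∞,∞}(𝕋²))`. -/
def ContinuousBesov (s : ℝ) (T : ℝ) (v : ℝ → Dist) : Prop :=
  ∃ w : ℝ → Besov P s, ContinuousOn w (Icc 0 T) ∧ ∀ t ∈ Icc 0 T, v t = (w t).toDist

/-- The truncation `∑_{-1 ≤ m < N - 1} Δ_m f`, a trigonometric polynomial. -/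
def lowPass (N : ℕ) (f : Dist) (x : Plane) : ℂ := ∑ m ∈ Finset.range N, block P m f x

/-- `h` is the product of the distributions `f` and `g`: the limit in `𝓓'(𝕋²)`, as `N → ∞`, of
the pointwise products of the truncations of `f` and `g`, that is, the sum of all `Δ_m f Δ_n g`. -/
def IsProduct (f g h : Dist) : Prop :=
  ∀ φ : TestFn, Tendsto
    (fun N => fnPair (fun x => lowPass P N f x * lowPass P N g x) (φ : Plane → ℂ)) atTop
    (𝓝 (pair h φ))

/-- `⟨e^{tΔ} f, φ⟩` for `t ≥ 0`, where
`e^{tΔ} f = (2π)⁻¹ ∑_l e^{-t|l|²} ⟨f, e_{-l}⟩ e_l`. The series converges absolutely. -/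
def heatPair (t : ℝ) (f : Dist) (φ : TestFn) : ℂ :=
  (2 * Real.pi : ℂ)⁻¹ * ∑' l : Freq,
    (Real.exp (-t * ‖latticePoint l‖ ^ 2) : ℂ) * fourierCoef f l *
      fnPair (expFn l) (φ : Plane → ℂ)

/-- `v` satisfies on `[0,T]` the mild equation
`v(t) = e^{tΔ} u₀ + ∫₀ᵗ e^{(t-s)Δ} (v(s)² + 2 v(s) Ξ₁(s) + Ξ₂(s)) ds`, as an identity in `𝓓'(𝕋²)`
for every `t`; the integral of distributions is taken against each test function. -/
def IsMildSolution (T : ℝ) (Ξ₁ Ξ₂ : ℝ → Dist) (u₀ : Dist) (v : ℝ → Dist) : Prop :=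
  ∃ F : ℝ → Dist,
    (∀ᵐ s ∂(volume.restrict (Icc 0 T)), ∃ q r : Dist,
      IsProduct P (v s) (v s) q ∧ IsProduct P (v s) (Ξ₁ s) r ∧
        F s = q + (2 : ℂ) • r + Ξ₂ s) ∧
    ∀ t ∈ Icc 0 T, ∀ φ : TestFn,
      IntervalIntegrable (fun s => heatPair (t - s) (F s) φ) volume 0 t ∧
      pair (v t) φ = heatPair t u₀ φ + ∫ s in (0 : ℝ)..t, heatPair (t - s) (F s) φ

/-- `v` is a solution of the mild equation on `[0,T]` in the space
`L^γ([0,T]; B^{2/γ-δ}_{∞,∞}(𝕋²)) ∩ C([0,T]; B^{-δ}_{∞,∞}(𝕋²))`. -/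
def IsSolutionIn (γ δ T : ℝ) (Ξ₁ Ξ₂ : ℝ → Dist) (u₀ : Dist) (v : ℝ → Dist) : Prop :=
  MemLpBesov P (2 / γ - δ) (ENNReal.ofReal γ) T v ∧ ContinuousBesov P (-δ) T v ∧
    IsMildSolution P T Ξ₁ Ξ₂ u₀ v

end TorusHeat

end

/-!
# Local well-posedness of a quadratic heat equation with rough coefficients on the torus

The equation is `v = e^{tΔ} u₀ + ∫₀ᵗ e^{(t-s)Δ} (v² + 2 v Ξ₁ + Ξ₂) ds`. Put `β = 2/γ - δ`, so that
`ε < β < 1`, and `p = 2/(1-ε)`, so that `p < γ`. Everything rests on two estimates.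

* Smoothing (`exists_bnorm_heatC_smoothing`): for `t ≤ 1` the operator `e^{tΔ}` maps `B^s` to
  `B^{s+σ}` with norm at most a constant times `t^{-σ/2}`.
* Product (`exists_bnorm_prodC_le`): multiplication maps `B^β × B^{-ε}` to `B^{-ε}`, because `ε < β`.

Written as `v (v + 2 Ξ₁) + Ξ₂`, the nonlinearity needs no other product estimate: `v` is in
`L^γ(B^β)`, and since `p < γ` the factor `v + 2 Ξ₁` is in `L^p(B^{-ε})`. The Duhamel integral of the
product has a `B^β` norm bounded by a convolution with the kernel `τ^{-(β+ε)/2}`. This kernel is in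
`L^q(0, 1)` for `q = 2/(1+ε)`, as `β < 1`. Since `q` is the conjugate exponent of `p`, a convolution
inequality (`lintegral_conv_mul_rpow_le`) bounds the bilinear operator on `L^γ(B^β) × L^p(B^{-ε})`
by the `L^q` norm of the kernel, which tends to zero with the length of the time interval. Picard
iteration then gives existence for short times (`exists_fixed_point`). Uniqueness needs no
smallness: for two solutions `v`, `w` the difference solves the linear inequality with kernel
`τ^{-(β+ε)/2}` and coefficient `‖v + w + 2 Ξ₁‖_{B^{-ε}}`, and a Gronwall argument with the weight
`e^{-λt}` applies (`ae_eq_zero_of_le_conv`).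

The argument is carried out on Fourier coefficients. A distribution is the same as a polynomially
bounded sequence of coefficients (`hasSum_pair`, `fourierCoef_toDist`), the limit defining a product
of distributions has the coefficients `prodC` (`isProduct_iff`), and the mild equation holds exactly
if it holds coefficientwise (`isMildSolution_iff`). Functions on the torus enter through the
supremum norms of Littlewood-Paley blocks alone, which are trigonometric polynomials; Fourier
multipliers act on these by convolution with integrable kernels on the plane
(`HasKernel.exists_bound`).

The spaces `B^s` are not separable, so strong measurability and continuity in time do not follow
from finiteness of norms. They are obtained by solving in the smaller space `L^γ(B^{2/γ-δ/2})`,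
which is possible since the equation smooths `u₀`: low frequency truncations of the solution
converge in `B^{2/γ-δ}` (`memLpBesov_of_curve`), and a bound in `B^s` with `-δ < s`, together with
continuity of every Fourier coefficient, gives continuity in `B^{-δ}` (`continuousBesov_of_bounded`).
-/

noncomputable section

namespace TorusHeat

open MeasureTheory Filter Topology Set
open scoped ContDiff ENNReal Pointwise FourierTransform SchwartzMap

/-! ### Exponentials and integration over the torus -/

theorem expFn_add (l m : Freq) (x : Plane) : expFn (l + m) x = expFn l x * expFn m x := by
  unfold expFn
  rw [← Complex.exp_add, ← mul_add, ← Complex.ofReal_add, ← Finset.sum_add_distrib]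
  congr 3
  simp [add_mul]

theorem expFn_add_right (l : Freq) (x y : Plane) :
    expFn l (x + y) = expFn l x * expFn l y := by
  unfold expFn
  rw [← Complex.exp_add, ← mul_add, ← Complex.ofReal_add, ← Finset.sum_add_distrib]
  congr 3
  simp [mul_add]

@[simp] theorem expFn_zero (x : Plane) : expFn 0 x = 1 := by simp [expFn]

theorem norm_expFn (l : Freq) (x : Plane) : ‖expFn l x‖ = 1 := by
  unfold expFn
  rw [mul_comm, Complex.norm_exp_ofReal_mul_I]

theorem contDiff_expFn (l : Freq) : ContDiff ℝ ∞ (expFn l) := (expFn_mem l).1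

theorem continuous_expFn (l : Freq) : Continuous (expFn l) := (contDiff_expFn l).continuous

theorem hasFDerivAt_expFn (l : Freq) (x : Plane) :
    HasFDerivAt (expFn l)
      ((ContinuousLinearMap.smulRight (innerSL ℝ (latticePoint l)) (Complex.I * expFn l x))) x := by
  have h1 : HasFDerivAt (fun x : Plane => (∑ i, (l i : ℝ) * x i : ℝ)) (innerSL ℝ (latticePoint l)) x := by
    have : (fun x : Plane => (∑ i, (l i : ℝ) * x i : ℝ)) = innerSL ℝ (latticePoint l) := by
      ext x
      simp [latticePoint, PiLp.inner_apply, mul_comm]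
    rw [this]
    exact ContinuousLinearMap.hasFDerivAt _
  have h2 := (Complex.ofRealCLM.hasFDerivAt.comp x h1).const_mul Complex.I |>.cexp
  refine h2.congr_fderiv ?_
  ext v
  simp [expFn]
  ring

/-- A continuous periodic function descends to the torus `(ℝ/ℤ)²` after rescaling. -/
theorem exists_torusLift {g : Plane → ℂ} (hg : Continuous g)
    (hp : ∀ (n : Freq) (x : Plane), g (x + (2 * Real.pi) • latticePoint n) = g x) :
    ∃ f : C(UnitAddTorus (Fin 2), ℂ), ∀ y : Fin 2 → ℝ,
      f (fun i => (y i : UnitAddCircle)) = g (WithLp.toLp 2 ((2 * Real.pi) • y)) := by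
  have hq : IsOpenQuotientMap (Pi.map (fun (_ : Fin 2) (y : ℝ) => (y : UnitAddCircle))) :=
    IsOpenQuotientMap.piMap fun _ => QuotientAddGroup.isOpenQuotientMap_mk
  let q : C(Fin 2 → ℝ, UnitAddTorus (Fin 2)) := ⟨_, hq.continuous⟩
  have hq' : IsQuotientMap q := hq.isQuotientMap
  let G : C(Fin 2 → ℝ, ℂ) := ⟨fun y => g (WithLp.toLp 2 ((2 * Real.pi) • y)), by fun_prop⟩
  have hfac : Function.FactorsThrough G q := by
    intro y y' h
    have h1 : ∀ i, ∃ n : ℤ, y i = y' i + n := by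
      intro i
      have h2 : (y i : UnitAddCircle) = (y' i : UnitAddCircle) := congrFun h i
      rw [eq_comm, QuotientAddGroup.eq, AddSubgroup.mem_zmultiples_iff] at h2
      obtain ⟨n, hn⟩ := h2
      exact ⟨n, by simp at hn; linarith⟩
    choose n hn using h1
    change g _ = g _
    rw [← hp n (WithLp.toLp 2 ((2 * Real.pi) • y'))]
    congr 1
    ext i
    simp [latticePoint, hn]
    ring
  refine ⟨hq'.lift G hfac, fun y => ?_⟩
  exact congrArg (fun F : C(Fin 2 → ℝ, ℂ) => F y) (hq'.lift_comp G hfac)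

/-- The integral over the period cell as an integral over the unit torus `(ℝ/ℤ)²`, where invariance
under translations and Fourier series are available. -/
theorem setIntegral_cell (g : Plane → ℂ) :
    ∫ x in cell, g x = (2 * Real.pi : ℂ) ^ 2 *
      ∫ y in {y : Fin 2 → ℝ | ∀ i, y i ∈ Ioc ((0 : Fin 2 → ℝ) i) ((0 : Fin 2 → ℝ) i + 1)},
        g (WithLp.toLp 2 ((2 * Real.pi) • y)) := by
  have hpi : (0 : ℝ) < 2 * Real.pi := by positivity
  have e1 : ∫ x in cell, g x
      = ∫ y in (univ.pi fun _ : Fin 2 => Ico (0 : ℝ) (2 * Real.pi)), g (WithLp.toLp 2 y) := by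
    rw [← (PiLp.volume_preserving_toLp (Fin 2)).setIntegral_preimage_emb
      (MeasurableEquiv.toLp 2 (Fin 2 → ℝ)).measurableEmbedding]
    congr 2
    ext y
    simp [cell]
  have e2 : (univ.pi fun _ : Fin 2 => Ico (0 : ℝ) (2 * Real.pi)) =ᵐ[volume]
      (univ.pi fun _ : Fin 2 => Ioc (0 : ℝ) (2 * Real.pi)) :=
    Measure.univ_pi_Ico_ae_eq_Icc.trans Measure.univ_pi_Ioc_ae_eq_Icc.symm
  have e3 : (2 * Real.pi) • {y : Fin 2 → ℝ | ∀ i, y i ∈ Ioc ((0 : Fin 2 → ℝ) i) ((0 : Fin 2 → ℝ) i + 1)}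
      = univ.pi fun _ : Fin 2 => Ioc (0 : ℝ) (2 * Real.pi) := by
    ext y
    rw [mem_smul_set_iff_inv_smul_mem₀ hpi.ne']
    simp only [mem_ofPred_eq, mem_Ioc, Pi.zero_apply, zero_add, Pi.smul_apply, smul_eq_mul, Set.mem_pi,
      mem_univ, forall_const]
    refine forall_congr' fun i => ?_
    rw [inv_mul_le_iff₀ hpi, mul_one]
    refine and_congr_left fun _ => ?_
    constructor
    · intro h; have := mul_pos hpi h; rwa [mul_inv_cancel_left₀ hpi.ne'] at this
    · intro h; positivity
  rw [Measure.setIntegral_comp_smul_of_pos volume (fun y => g (WithLp.toLp 2 y)) _ hpi, e3, e1,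
    setIntegral_congr_set e2]
  simp only [Module.finrank_fin_fun, Complex.real_smul]
  rw [← mul_assoc]
  push_cast
  rw [mul_inv_cancel₀, one_mul]
  exact pow_ne_zero _ (by exact_mod_cast hpi.ne')

/-- Integrals of continuous periodic functions over the cell are translation invariant. -/
theorem setIntegral_cell_add {g : Plane → ℂ} (hg : Continuous g)
    (hp : ∀ (n : Freq) (x : Plane), g (x + (2 * Real.pi) • latticePoint n) = g x) (w : Plane) :
    ∫ x in cell, g (x + w) = ∫ x in cell, g x := by
  obtain ⟨f, hf⟩ := exists_torusLift hg hp
  have hpi : (0 : ℝ) < 2 * Real.pi := by positivity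
  let b : Fin 2 → ℝ := fun i => (2 * Real.pi)⁻¹ * w i
  rw [setIntegral_cell, setIntegral_cell]
  congr 1
  have h0 := UnitAddTorus.integral_preimage f 0
  have h1 := UnitAddTorus.integral_preimage f b
  simp_rw [hf] at h0 h1
  rw [← h0, h1]
  have h2 := (measurePreserving_add_right (volume : Measure (Fin 2 → ℝ)) b).setIntegral_preimage_emb
      (measurableEmbedding_addRight b) (fun y => g (WithLp.toLp 2 ((2 * Real.pi) • y)))
      {x | ∀ (i : Fin 2), x i ∈ Ioc (b i) (b i + 1)}
  rw [← h2]
  have h3 : (fun x => x + b) ⁻¹' {x | ∀ (i : Fin 2), x i ∈ Ioc (b i) (b i + 1)} =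
      {y : Fin 2 → ℝ | ∀ i, y i ∈ Ioc ((0 : Fin 2 → ℝ) i) ((0 : Fin 2 → ℝ) i + 1)} := by
    ext y
    simp only [mem_preimage, mem_ofPred_eq, mem_Ioc, Pi.add_apply, Pi.zero_apply, zero_add]
    refine forall_congr' fun i => ?_
    constructor <;> rintro ⟨h, h'⟩ <;> constructor <;> linarith
  rw [h3]
  congr 1
  ext y
  congr 1
  ext i
  have := Real.pi_ne_zero
  simp [b, mul_add]
  field_simp

theorem measurableSet_cell : MeasurableSet cell := by
  have : cell = ⋂ i : Fin 2, (fun x : Plane => x i) ⁻¹' Ico (0 : ℝ) (2 * Real.pi) := by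
    ext x; simp [cell]
  rw [this]
  exact MeasurableSet.iInter fun i =>
    (by fun_prop : Continuous fun x : Plane => x i).measurable measurableSet_Ico

theorem isBounded_cell : Bornology.IsBounded cell := by
  rw [isBounded_iff_forall_norm_le]
  refine ⟨2 * (2 * Real.pi), fun x hx => ?_⟩
  rw [EuclideanSpace.norm_eq]
  refine Real.sqrt_le_iff.2 ⟨by positivity, ?_⟩
  have h : ∀ i, ‖x i‖ ^ 2 ≤ (2 * Real.pi) ^ 2 := fun i => by
    have := hx i
    rw [Real.norm_eq_abs, sq_abs]
    exact pow_le_pow_left₀ this.1 this.2.le 2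
  rw [Fin.sum_univ_two]
  nlinarith [h 0, h 1]

theorem volume_cell_lt_top : volume cell < ⊤ := isBounded_cell.measure_lt_top

instance : IsFiniteMeasure ((volume : Measure Plane).restrict cell) :=
  ⟨by simpa using volume_cell_lt_top⟩

theorem integrable_cell {g : Plane → ℂ} (hg : Continuous g) :
    Integrable g (volume.restrict cell) :=
  (hg.continuousOn.integrableOn_compact isBounded_cell.isCompact_closure).mono_set subset_closure

theorem volume_real_cell : volume.real cell = (2 * Real.pi) ^ 2 := by
  have h := setIntegral_cell (fun _ => (1 : ℂ))
  have h2 := UnitAddTorus.integral_preimage (d := Fin 2) (fun _ => (1 : ℂ)) 0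
  have h3 : (volume : Measure (Fin 2 → ℝ)).real
      {y : Fin 2 → ℝ | ∀ i, y i ∈ Ioc ((0 : Fin 2 → ℝ) i) ((0 : Fin 2 → ℝ) i + 1)} = 1 := by
    have : {y : Fin 2 → ℝ | ∀ i, y i ∈ Ioc ((0 : Fin 2 → ℝ) i) ((0 : Fin 2 → ℝ) i + 1)} =
      univ.pi fun i => Ioc ((0 : Fin 2 → ℝ) i) ((0 : Fin 2 → ℝ) i + 1) := by ext; simp
    rw [this, measureReal_def, Real.volume_pi_Ioc]
    simp
  simp only [integral_const, measureReal_restrict_apply_univ, Complex.real_smul, mul_one, h3] at h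
  rw [Complex.ofReal_one, mul_one] at h
  exact_mod_cast h

/-- The normalized pairing of two bounded functions is bounded. -/
theorem norm_fnPair_le {g φ : Plane → ℂ} {A B : ℝ} (hA : ∀ x, ‖g x‖ ≤ A) (hB : ∀ x, ‖φ x‖ ≤ B) :
    ‖fnPair g φ‖ ≤ 2 * Real.pi * (A * B) := by
  unfold fnPair
  have hA0 : 0 ≤ A := (norm_nonneg _).trans (hA 0)
  have h := norm_setIntegral_le_of_norm_le_const (μ := volume) (s := cell)
    (f := fun x => g x * φ x) volume_cell_lt_top (C := A * B)
    (fun x _ => by rw [norm_mul]; exact mul_le_mul (hA x) (hB x) (norm_nonneg _) hA0)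
  rw [volume_real_cell] at h
  rw [norm_mul, norm_inv]
  have h2 : ‖(2 * Real.pi : ℂ)‖ = 2 * Real.pi := by
    simp [abs_of_pos Real.pi_pos]
  rw [h2, inv_mul_le_iff₀ (by positivity)]
  linarith

/-- The integral of a derivative of a smooth periodic function vanishes. -/
theorem setIntegral_cell_fderiv {g : Plane → ℂ} (hg : g ∈ smoothPeriodic) (v : Plane) :
    ∫ x in cell, fderiv ℝ g x v = 0 := by
  obtain ⟨hs, hp⟩ := hg
  have hc : Continuous (fderiv ℝ g) := hs.continuous_fderiv (by simp)
  obtain ⟨C, hC⟩ : ∃ C, ∀ x ∈ Metric.cthickening ‖v‖ (closure cell), ‖fderiv ℝ g x v‖ ≤ C := by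
    have hcomp : IsCompact (Metric.cthickening ‖v‖ (closure cell)) :=
      (isBounded_cell.isCompact_closure).cthickening
    exact hcomp.exists_bound_of_continuousOn (by fun_prop)
  have key := hasDerivAt_integral_of_dominated_loc_of_deriv_le (𝕜 := ℝ) (E := ℂ)
    (μ := volume.restrict cell) (F := fun h x => g (x + h • v)) (x₀ := (0 : ℝ))
    (F' := fun h x => fderiv ℝ g (x + h • v) v) (bound := fun _ => C) (s := Metric.ball 0 1)
    (Metric.ball_mem_nhds _ one_pos)
    (Eventually.of_forall fun h => by
      have : Continuous fun x => g (x + h • v) := hs.continuous.comp (by fun_prop)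
      exact this.aestronglyMeasurable)
    (integrable_cell (hs.continuous.comp (by fun_prop)))
    (by
      have : Continuous fun x => fderiv ℝ g (x + (0 : ℝ) • v) v := by fun_prop
      exact this.aestronglyMeasurable)
    (by
      refine (ae_restrict_iff' measurableSet_cell).2 (Eventually.of_forall fun x hx h hh => ?_)
      refine hC _ ?_
      refine Metric.mem_cthickening_of_dist_le _ x _ _ (subset_closure hx) ?_
      rw [dist_eq_norm, add_sub_cancel_left, norm_smul]
      rw [mem_ball_zero_iff] at hh
      exact mul_le_of_le_one_left (norm_nonneg _) hh.le)
    (integrable_const _)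
    (Eventually.of_forall fun x h _ => by
      have h1 : HasDerivAt (fun h : ℝ => x + h • v) v h := by
        simpa using ((hasDerivAt_id h).smul_const v).const_add x
      have h2 := (hs.differentiable (by simp) (x + h • v)).hasFDerivAt
      exact h2.comp_hasDerivAt h h1)
  have hconst : (fun h : ℝ => ∫ x in cell, g (x + h • v)) = fun _ => ∫ x in cell, g x := by
    ext h
    exact setIntegral_cell_add hs.continuous hp _
  have h2 := key.2
  rw [hconst] at h2
  simpa using h2.unique (hasDerivAt_const _ _)

/-! ### Fourier series of test functions -/

/-- Orthogonality of the exponentials: the integral of a nonconstant one vanishes, since it is a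
multiple of its own derivative. -/
theorem fnPair_expFn_expFn (l m : Freq) :
    fnPair (expFn l) (expFn (-m)) = if l = m then (2 * Real.pi : ℂ) else 0 := by
  have hpi : (Real.pi : ℂ) ≠ 0 := by exact_mod_cast Real.pi_ne_zero
  unfold fnPair
  simp_rw [← expFn_add]
  split_ifs with h
  · have : l + -m = 0 := by rw [h]; simp
    simp only [this, expFn_zero, integral_const, measureReal_restrict_apply_univ, volume_real_cell,
      Complex.real_smul, mul_one]
    push_cast
    field_simp
  · set k := l + -m with hk
    have hk0 : k ≠ 0 := fun h' => h (by rw [hk] at h'; exact add_neg_eq_zero.1 h')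
    have h1 := setIntegral_cell_fderiv (expFn_mem k) (latticePoint k)
    simp_rw [(hasFDerivAt_expFn k _).fderiv] at h1
    simp only [ContinuousLinearMap.smulRight_apply, innerSL_apply_apply, real_inner_self_eq_norm_sq,
      Complex.real_smul] at h1
    simp_rw [← mul_assoc] at h1
    rw [integral_const_mul] at h1
    rw [mul_eq_zero] at h1
    rcases h1 with h1 | h1
    · exfalso
      apply hk0
      have : latticePoint k = 0 := by simpa using h1
      ext i
      have h2 := congrFun (congrArg WithLp.ofLp this) i
      simpa [latticePoint] using h2
    · rw [h1, mul_zero]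

theorem abs_le_norm_latticePoint (l : Freq) (i : Fin 2) : |(l i : ℝ)| ≤ ‖latticePoint l‖ := by
  simpa [latticePoint] using PiLp.norm_apply_le (latticePoint l) i

theorem norm_latticePoint_le (l : Freq) : ‖latticePoint l‖ ≤ |(l 0 : ℝ)| + |(l 1 : ℝ)| := by
  rw [EuclideanSpace.norm_eq, Fin.sum_univ_two]
  refine Real.sqrt_le_iff.2 ⟨by positivity, ?_⟩
  simp only [latticePoint, Real.norm_eq_abs]
  nlinarith [abs_nonneg (l 0 : ℝ), abs_nonneg (l 1 : ℝ)]

theorem latticePoint_sub (l m : Freq) : latticePoint (l - m) = latticePoint l - latticePoint m := by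
  ext i; simp [latticePoint]

@[simp] theorem norm_latticePoint_neg (l : Freq) : ‖latticePoint (-l)‖ = ‖latticePoint l‖ := by
  rw [← zero_sub, latticePoint_sub]
  have : latticePoint 0 = 0 := by ext i; simp [latticePoint]
  rw [this, zero_sub, norm_neg]

/-- The partial derivative of a test function in the `i`-th coordinate direction. -/
def partialDeriv (i : Fin 2) (φ : TestFn) : TestFn :=
  ⟨fun x => fderiv ℝ φ x (EuclideanSpace.single i 1), by
    obtain ⟨hs, hp⟩ := φ.2
    refine ⟨(hs.fderiv_right (m := ∞) (by simp)).clm_apply contDiff_const, fun n x => ?_⟩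
    have h : (fun y => (φ : Plane → ℂ) (y + (2 * Real.pi) • latticePoint n)) = φ := funext (hp n)
    have h2 := fderiv_comp_add_right (𝕜 := ℝ) (f := (φ : Plane → ℂ)) (x := x)
      ((2 * Real.pi) • latticePoint n)
    rw [h] at h2
    exact congrArg (fun L => L (EuclideanSpace.single i 1)) h2.symm⟩

theorem norm_iteratedFDeriv_partialDeriv_le (i : Fin 2) (φ : TestFn) (j : ℕ) (x : Plane) :
    ‖iteratedFDeriv ℝ j (partialDeriv i φ : Plane → ℂ) x‖ ≤
      ‖iteratedFDeriv ℝ (j + 1) (φ : Plane → ℂ) x‖ := by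
  have hs := φ.2.1
  have h1 : (partialDeriv i φ : Plane → ℂ) =
      ContinuousLinearMap.apply ℝ ℂ (EuclideanSpace.single i 1 : Plane) ∘ fderiv ℝ φ := rfl
  rw [h1, ← norm_iteratedFDeriv_fderiv]
  have h2 := ContinuousLinearMap.norm_iteratedFDeriv_comp_left
    (ContinuousLinearMap.apply ℝ ℂ (EuclideanSpace.single i 1 : Plane)) (f := fderiv ℝ φ) (x := x)
    (N := ∞) (n := j) (hs.fderiv_right (m := ∞) (by simp)).contDiffAt (by exact_mod_cast le_top)
  refine h2.trans (mul_le_of_le_one_left (norm_nonneg _) ?_)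
  refine ContinuousLinearMap.opNorm_le_bound _ zero_le_one fun L => ?_
  simpa using L.le_opNorm (EuclideanSpace.single i 1)

theorem mul_mem_smoothPeriodic {f g : Plane → ℂ} (hf : f ∈ smoothPeriodic)
    (hg : g ∈ smoothPeriodic) : (fun x => f x * g x) ∈ smoothPeriodic :=
  ⟨hf.1.mul hg.1, fun n x => by
    change f _ * g _ = f x * g x
    rw [hf.2, hg.2]⟩

theorem fnPair_partialDeriv (l : Freq) (i : Fin 2) (φ : TestFn) :
    fnPair (expFn l) (partialDeriv i φ : Plane → ℂ) =
      -(Complex.I * l i) * fnPair (expFn l) (φ : Plane → ℂ) := by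
  have h := setIntegral_cell_fderiv (mul_mem_smoothPeriodic (expFn_mem l) φ.2)
    (EuclideanSpace.single i 1)
  have h2 : ∀ x, fderiv ℝ (fun x => expFn l x * (φ : Plane → ℂ) x) x (EuclideanSpace.single i 1) =
      expFn l x * (partialDeriv i φ : Plane → ℂ) x + Complex.I * l i * (expFn l x * (φ : Plane → ℂ) x) := by
    intro x
    have hd : DifferentiableAt ℝ (φ : Plane → ℂ) x := φ.2.1.differentiable (by simp) x
    have h3 : HasFDerivAt (fun x => expFn l x * (φ : Plane → ℂ) x) _ x :=
      (hasFDerivAt_expFn l x).mul hd.hasFDerivAt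
    rw [h3.fderiv]
    simp [partialDeriv, latticePoint, EuclideanSpace.inner_single_right]
    ring
  simp_rw [h2] at h
  rw [integral_add, integral_const_mul] at h
  · unfold fnPair
    linear_combination (2 * Real.pi : ℂ)⁻¹ * h
  · exact integrable_cell ((continuous_expFn l).mul (partialDeriv i φ).2.1.continuous)
  · exact integrable_cell (continuous_const.mul ((continuous_expFn l).mul φ.2.1.continuous))

/-- The seminorm bound `sup_x ‖D^j φ(x)‖ ≤ M` for all `j ≤ N`. -/
def SeminormLE (N : ℕ) (φ : TestFn) (M : ℝ) : Prop :=
  ∀ j ≤ N, ∀ x, ‖iteratedFDeriv ℝ j (φ : Plane → ℂ) x‖ ≤ M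

/-- Integration by parts, `K` times in the `i`-th coordinate direction. -/
theorem norm_pow_mul_fnPair_le (l : Freq) (i : Fin 2) (K : ℕ) (φ : TestFn) (M : ℝ)
    (h : ∀ x, ‖iteratedFDeriv ℝ K (φ : Plane → ℂ) x‖ ≤ M) :
    |(l i : ℝ)| ^ K * ‖fnPair (expFn l) (φ : Plane → ℂ)‖ ≤ 2 * Real.pi * M := by
  induction K generalizing φ with
  | zero =>
    have := norm_fnPair_le (g := expFn l) (φ := (φ : Plane → ℂ)) (A := 1) (B := M)
      (fun x => (norm_expFn l x).le) (fun x => by simpa using h x)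
    simpa using this
  | succ K ih =>
    have h1 := ih (partialDeriv i φ)
      (fun x => (norm_iteratedFDeriv_partialDeriv_le i φ K x).trans (h x))
    rw [fnPair_partialDeriv, norm_mul] at h1
    have h2 : ‖-(Complex.I * l i)‖ = |(l i : ℝ)| := by
      rw [norm_neg, norm_mul, Complex.norm_I, one_mul, Complex.norm_intCast]
    rw [h2] at h1
    rw [pow_succ, mul_assoc]
    exact h1

/-- The Fourier coefficients of a test function decay faster than any power. -/
theorem fnPair_decay (K : ℕ) : ∃ C : ℝ, 0 ≤ C ∧ ∀ (φ : TestFn) (M : ℝ), SeminormLE K φ M → ∀ l : Freq,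
    (1 + ‖latticePoint l‖) ^ K * ‖fnPair (expFn l) (φ : Plane → ℂ)‖ ≤ C * M := by
  refine ⟨3 ^ K * (3 * (2 * Real.pi)), by positivity, fun φ M hM l => ?_⟩
  have h0 := norm_pow_mul_fnPair_le l 0 0 φ M (hM 0 (Nat.zero_le _))
  have h1 := norm_pow_mul_fnPair_le l 0 K φ M (hM K le_rfl)
  have h2 := norm_pow_mul_fnPair_le l 1 K φ M (hM K le_rfl)
  have h3 : (1 + ‖latticePoint l‖) ^ K ≤ 3 ^ K * (1 + |(l 0 : ℝ)| ^ K + |(l 1 : ℝ)| ^ K) := by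
    have ha : 1 + ‖latticePoint l‖ ≤ 3 * max 1 (max |(l 0 : ℝ)| |(l 1 : ℝ)|) := by
      have := norm_latticePoint_le l
      have e1 := le_max_left 1 (max |(l 0 : ℝ)| |(l 1 : ℝ)|)
      have e2 := le_max_right 1 (max |(l 0 : ℝ)| |(l 1 : ℝ)|)
      have e3 := le_max_left |(l 0 : ℝ)| |(l 1 : ℝ)|
      have e4 := le_max_right |(l 0 : ℝ)| |(l 1 : ℝ)|
      linarith
    refine (pow_le_pow_left₀ (by positivity) ha K).trans ?_
    rw [mul_pow]
    gcongr
    have p0 : 0 ≤ |(l 0 : ℝ)| ^ K := by positivity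
    have p1 : 0 ≤ |(l 1 : ℝ)| ^ K := by positivity
    rcases max_choice 1 (max |(l 0 : ℝ)| |(l 1 : ℝ)|) with e | e
    · rw [e, one_pow]; linarith
    · rw [e]
      rcases max_choice |(l 0 : ℝ)| |(l 1 : ℝ)| with e' | e' <;> rw [e'] <;> linarith
  calc (1 + ‖latticePoint l‖) ^ K * ‖fnPair (expFn l) (φ : Plane → ℂ)‖
      ≤ 3 ^ K * (1 + |(l 0 : ℝ)| ^ K + |(l 1 : ℝ)| ^ K) * ‖fnPair (expFn l) (φ : Plane → ℂ)‖ := by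
        gcongr
    _ = 3 ^ K * (|(l 0 : ℝ)| ^ 0 * ‖fnPair (expFn l) (φ : Plane → ℂ)‖ +
        |(l 0 : ℝ)| ^ K * ‖fnPair (expFn l) (φ : Plane → ℂ)‖ +
        |(l 1 : ℝ)| ^ K * ‖fnPair (expFn l) (φ : Plane → ℂ)‖) := by ring
    _ ≤ 3 ^ K * (2 * Real.pi * M + 2 * Real.pi * M + 2 * Real.pi * M) := by gcongr
    _ = _ := by ring

theorem summable_weight : Summable fun l : Freq => ((1 + ‖latticePoint l‖) ^ 3)⁻¹ := by
  have h := EisensteinSeries.summable_one_div_norm_rpow (k := 3) (by norm_num)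
  refine Summable.of_norm_bounded_eventually h ?_
  refine (Set.finite_singleton (0 : Freq)).subset ?_
  intro l hl
  by_contra h0
  apply hl
  have hpos : 0 < ‖l‖ := norm_pos_iff.2 h0
  have hle : ‖l‖ ≤ 1 + ‖latticePoint l‖ := by
    refine (pi_norm_le_iff_of_nonneg (by positivity)).2 fun i => ?_
    have := abs_le_norm_latticePoint l i
    rw [Int.norm_eq_abs]
    linarith
  change ‖((1 + ‖latticePoint l‖) ^ 3)⁻¹‖ ≤ ‖l‖ ^ (-3 : ℝ)
  rw [Real.norm_of_nonneg (by positivity), Real.rpow_neg hpos.le]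
  have : ‖l‖ ^ (3 : ℝ) = ‖l‖ ^ 3 := by exact_mod_cast Real.rpow_natCast ‖l‖ 3
  rw [this]
  gcongr

/-- Every test function satisfies a bound on each finite set of seminorms. -/
theorem exists_seminormLE (N : ℕ) (φ : TestFn) : ∃ M, SeminormLE N φ M := by
  obtain ⟨hs, hp⟩ := φ.2
  have h1 : ∀ j : ℕ, ∃ M, ∀ x, ‖iteratedFDeriv ℝ j (φ : Plane → ℂ) x‖ ≤ M := by
    intro j
    obtain ⟨C, hC⟩ := (isBounded_cell.isCompact_closure).exists_bound_of_continuousOn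
      (f := iteratedFDeriv ℝ j (φ : Plane → ℂ))
      (hs.continuous_iteratedFDeriv (by exact_mod_cast le_top)).continuousOn
    refine ⟨C, fun x => ?_⟩
    have hpi : (0 : ℝ) < 2 * Real.pi := by positivity
    let n : Freq := fun i => -⌊x i / (2 * Real.pi)⌋
    have hx : x + (2 * Real.pi) • latticePoint n ∈ cell := by
      intro i
      have e1 := Int.floor_le (x i / (2 * Real.pi))
      have e2 := Int.lt_floor_add_one (x i / (2 * Real.pi))
      rw [le_div_iff₀ hpi] at e1
      rw [div_lt_iff₀ hpi] at e2
      simp only [latticePoint, n, PiLp.add_apply, PiLp.smul_apply, smul_eq_mul, Int.cast_neg, mem_Ico]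
      constructor <;> nlinarith
    have h := hC _ (subset_closure hx)
    have h2 := iteratedFDeriv_comp_add_right (𝕜 := ℝ) (f := (φ : Plane → ℂ)) j
      ((2 * Real.pi) • latticePoint n) x
    have h3 : (fun y => (φ : Plane → ℂ) (y + (2 * Real.pi) • latticePoint n)) = φ := funext (hp n)
    rw [h3] at h2
    rw [h2]
    exact h
  choose M hM using h1
  refine ⟨∑ j ∈ Finset.range (N + 1), |M j|, fun j hj x => (hM j x).trans ((le_abs_self _).trans ?_)⟩
  exact Finset.single_le_sum (f := fun j => |M j|) (fun _ _ => abs_nonneg _)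
    (Finset.mem_range.2 (Nat.lt_succ_of_le hj))

theorem summable_pow_mul_fnPair (K : ℕ) (φ : TestFn) :
    Summable fun l : Freq => (1 + ‖latticePoint l‖) ^ K * ‖fnPair (expFn l) (φ : Plane → ℂ)‖ := by
  obtain ⟨C, hC0, hC⟩ := fnPair_decay (K + 3)
  obtain ⟨M, hM⟩ := exists_seminormLE (K + 3) φ
  refine Summable.of_nonneg_of_le (fun l => by positivity) (fun l => ?_)
    (summable_weight.mul_left (C * M))
  have h := hC φ M hM l
  rw [pow_add] at h
  rw [← div_eq_mul_inv, le_div_iff₀ (by positivity)]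
  linarith

/-! ### Distributions and their Fourier coefficients -/

/-- The Fourier series of a test function converges to it at every point. -/
theorem hasSum_fourier (φ : TestFn) (x : Plane) :
    HasSum (fun l : Freq => (2 * Real.pi : ℂ)⁻¹ * fnPair (expFn l) (φ : Plane → ℂ) * expFn (-l) x)
      ((φ : Plane → ℂ) x) := by
  have hpi : (Real.pi : ℂ) ≠ 0 := by exact_mod_cast Real.pi_ne_zero
  obtain ⟨f, hf⟩ := exists_torusLift φ.2.1.continuous φ.2.2
  have hm : ∀ (n : Freq) (y : Fin 2 → ℝ), UnitAddTorus.mFourier n (fun i => (y i : UnitAddCircle)) =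
      expFn n (WithLp.toLp 2 ((2 * Real.pi) • y)) := by
    intro n y
    simp only [UnitAddTorus.mFourier, ContinuousMap.coe_mk, fourier_coe_apply, expFn,
      ← Complex.exp_sum]
    congr 1
    simp only [Fin.sum_univ_two, Pi.smul_apply, smul_eq_mul]
    push_cast
    ring
  have hco : ∀ n : Freq, UnitAddTorus.mFourierCoeff f n =
      (2 * Real.pi : ℂ)⁻¹ * fnPair (expFn (-n)) (φ : Plane → ℂ) := by
    intro n
    rw [UnitAddTorus.mFourierCoeff_eq_integral f n 0]
    simp_rw [hm, hf, smul_eq_mul]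
    unfold fnPair
    rw [setIntegral_cell]
    field_simp
  have hsum : Summable (UnitAddTorus.mFourierCoeff f) := by
    refine Summable.of_norm ?_
    simp_rw [hco]
    have h1 := (summable_pow_mul_fnPair 0 φ).mul_left ‖(2 * Real.pi : ℂ)⁻¹‖
    simp_rw [pow_zero, one_mul, ← norm_mul] at h1
    exact (Equiv.neg Freq).summable_iff.2 h1
  have h := UnitAddTorus.hasSum_mFourier_series_apply_of_summable hsum
    (fun i => (((2 * Real.pi)⁻¹ * x i : ℝ) : UnitAddCircle))
  rw [hf (fun i => (2 * Real.pi)⁻¹ * x i)] at h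
  simp_rw [hm _ (fun i => (2 * Real.pi)⁻¹ * x i), hco, smul_eq_mul] at h
  have hx : WithLp.toLp 2 ((2 * Real.pi) • fun i => (2 * Real.pi)⁻¹ * x i) = x := by
    ext i
    have := Real.pi_ne_zero
    simp
    field_simp
  rw [hx] at h
  have h2 := (Equiv.neg Freq).hasSum_iff.2 h
  refine h2.congr_fun fun l => ?_
  simp

theorem norm_iteratedFDeriv_expFn_le (l : Freq) (j : ℕ) (x : Plane) :
    ‖iteratedFDeriv ℝ j (expFn l) x‖ ≤ ‖latticePoint l‖ ^ j := by
  induction j generalizing x with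
  | zero => simp [norm_expFn]
  | succ j ih =>
    rw [← norm_iteratedFDeriv_fderiv]
    let L : ℂ →L[ℝ] (Plane →L[ℝ] ℂ) :=
      (ContinuousLinearMap.smulRightL ℝ Plane ℂ (innerSL ℝ (latticePoint l))).comp
        (ContinuousLinearMap.mul ℝ ℂ Complex.I)
    have hL : fderiv ℝ (expFn l) = L ∘ expFn l := by
      ext1 x
      rw [(hasFDerivAt_expFn l x).fderiv]
      rfl
    have hn : ‖L‖ ≤ ‖latticePoint l‖ := by
      refine ContinuousLinearMap.opNorm_le_bound _ (norm_nonneg _) fun z => ?_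
      change ‖ContinuousLinearMap.smulRight (innerSL ℝ (latticePoint l)) (Complex.I * z)‖ ≤ _
      rw [ContinuousLinearMap.norm_smulRight_apply, innerSL_apply_norm, norm_mul, Complex.norm_I,
        one_mul]
    rw [hL]
    refine (L.norm_iteratedFDeriv_comp_left (N := ∞) (contDiff_expFn l).contDiffAt
      (by exact_mod_cast le_top)).trans ?_
    rw [pow_succ']
    exact mul_le_mul hn (ih x) (norm_nonneg _) (norm_nonneg _)

/-- A distribution is determined by its Fourier coefficients, through an absolutely convergent
series. -/
theorem hasSum_pair (f : Dist) (φ : TestFn) :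
    HasSum (fun l : Freq => (2 * Real.pi : ℂ)⁻¹ *
      (fourierCoef f l * fnPair (expFn l) (φ : Plane → ℂ))) (pair f φ) := by
  set c : Freq → ℂ := fun l => (2 * Real.pi : ℂ)⁻¹ * fnPair (expFn l) (φ : Plane → ℂ) with hc
  obtain ⟨C, N, hf⟩ := f.2
  let g : Freq → Plane → ℂ := fun l x => c l * expFn (-l) x
  have hg : ∀ l, ContDiff ℝ ∞ (g l) := fun l => contDiff_const.mul (contDiff_expFn _)
  let u : ℕ → Freq → ℝ := fun k l => ‖(2 * Real.pi : ℂ)⁻¹‖ *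
    ((1 + ‖latticePoint l‖) ^ k * ‖fnPair (expFn l) (φ : Plane → ℂ)‖)
  have hu : ∀ k, Summable (u k) := fun k => (summable_pow_mul_fnPair k φ).mul_left _
  have hgu : ∀ (k : ℕ) (l : Freq) (x : Plane), ‖iteratedFDeriv ℝ k (g l) x‖ ≤ u k l := by
    intro k l x
    have h1 : g l = c l • expFn (-l) := rfl
    rw [h1, iteratedFDeriv_const_smul_apply (((contDiff_expFn _).of_le (by exact_mod_cast le_top)).contDiffAt), norm_smul]
    have h2 := norm_iteratedFDeriv_expFn_le (-l) k x
    rw [norm_latticePoint_neg] at h2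
    have h3 : ‖latticePoint l‖ ^ k ≤ (1 + ‖latticePoint l‖) ^ k :=
      pow_le_pow_left₀ (norm_nonneg _) (by linarith) k
    simp only [hc, u, norm_mul]
    calc _ ≤ ‖(2 * Real.pi : ℂ)⁻¹‖ * ‖fnPair (expFn l) (φ : Plane → ℂ)‖ * (1 + ‖latticePoint l‖) ^ k := by
          simp only [norm_mul, norm_inv] at *
          gcongr
          exact h2.trans h3
      _ = _ := by simp only [norm_mul, norm_inv]; ring
  have hφ : (φ : Plane → ℂ) = fun x => ∑' l, g l x := by
    ext x
    exact (hasSum_fourier φ x).tsum_eq.symm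
  have hd : ∀ (k : ℕ) (x : Plane),
      iteratedFDeriv ℝ k (φ : Plane → ℂ) x = ∑' l, iteratedFDeriv ℝ k (g l) x := by
    intro k x
    rw [hφ]
    exact iteratedFDeriv_tsum_apply (N := ⊤) hg (fun k _ => hu k) (fun k l x _ => hgu k l x) le_top x
  have key : ∀ ε > 0, ∀ᶠ F : Finset Freq in atTop,
      SeminormLE N (φ - ∑ l ∈ F, c l • expTest (-l)) ε := by
    intro ε hε
    have h1 : ∀ j ∈ Finset.range (N + 1), ∀ᶠ F : Finset Freq in atTop, ∀ x,
        dist (∑' l, iteratedFDeriv ℝ j (g l) x) (∑ l ∈ F, iteratedFDeriv ℝ j (g l) x) < ε :=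
      fun j _ => Metric.tendstoUniformly_iff.1 (tendstoUniformly_tsum (hu j) (hgu j)) ε hε
    filter_upwards [(Finset.eventually_all _).2 h1] with F hF j hj x
    have h2 := hF j (Finset.mem_range.2 (Nat.lt_succ_of_le hj)) x
    rw [← hd, dist_eq_norm] at h2
    have h3 : ((φ - ∑ l ∈ F, c l • expTest (-l) : TestFn) : Plane → ℂ) =
        (φ : Plane → ℂ) - fun x => ∑ l ∈ F, g l x := by
      ext x
      simp [g, expTest]
    rw [h3, iteratedFDeriv_sub_apply, iteratedFDeriv_fun_sum_apply]
    · exact h2.le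
    · exact fun l _ => ((hg l).of_le (by exact_mod_cast le_top)).contDiffAt
    · exact (φ.2.1.of_le (by exact_mod_cast le_top)).contDiffAt
    · exact ((ContDiff.sum fun l _ => hg l).of_le (by exact_mod_cast le_top)).contDiffAt
  have hlim : HasSum (fun l => c l * fourierCoef f l) (pair f φ) := by
    rw [HasSum, SummationFilter.unconditional_filter, Metric.tendsto_nhds]
    intro ε hε
    have hε' : 0 < ε / (|C| + 1) := by positivity
    filter_upwards [key _ hε'] with F hF
    have h1 := hf _ _ hF
    have h2 : (f : TestFn →ₗ[ℂ] ℂ) (φ - ∑ l ∈ F, c l • expTest (-l)) =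
        pair f φ - ∑ l ∈ F, c l * fourierCoef f l := by
      simp [pair, fourierCoef]
    rw [h2] at h1
    rw [dist_comm, dist_eq_norm]
    refine h1.trans_lt ?_
    have h3 : C * (ε / (|C| + 1)) ≤ |C| * (ε / (|C| + 1)) := by gcongr; exact le_abs_self C
    refine h3.trans_lt ?_
    rw [mul_div_assoc', div_lt_iff₀ (by positivity)]
    nlinarith [abs_nonneg C]
  refine hlim.congr_fun fun l => ?_
  simp only [hc]
  ring

theorem dist_ext {f g : Dist} (h : ∀ l, fourierCoef f l = fourierCoef g l) : f = g := by
  apply Subtype.ext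
  apply LinearMap.ext
  intro φ
  have h1 := hasSum_pair f φ
  simp_rw [h] at h1
  exact h1.unique (hasSum_pair g φ)

/-- Polynomially bounded sequences of Fourier coefficients. -/
def PolyBdd (a : Freq → ℂ) : Prop :=
  ∃ (C : ℝ) (K : ℕ), ∀ l, ‖a l‖ ≤ C * (1 + ‖latticePoint l‖) ^ K

theorem polyBdd_fourierCoef (f : Dist) : PolyBdd (fourierCoef f) := by
  obtain ⟨C, N, hf⟩ := f.2
  refine ⟨C, N, fun l => ?_⟩
  refine hf (expTest (-l)) _ fun j hj x => ?_
  refine (norm_iteratedFDeriv_expFn_le (-l) j x).trans ?_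
  rw [norm_latticePoint_neg]
  calc ‖latticePoint l‖ ^ j ≤ (1 + ‖latticePoint l‖) ^ j :=
        pow_le_pow_left₀ (norm_nonneg _) (by linarith) j
    _ ≤ _ := pow_le_pow_right₀ (by linarith [norm_nonneg (latticePoint l)]) hj

theorem PolyBdd.summable {a : Freq → ℂ} (h : PolyBdd a) (φ : TestFn) :
    Summable fun l => a l * fnPair (expFn l) (φ : Plane → ℂ) := by
  obtain ⟨C, K, h⟩ := h
  refine Summable.of_norm_bounded ((summable_pow_mul_fnPair K φ).mul_left C) fun l => ?_
  rw [norm_mul, ← mul_assoc]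
  exact mul_le_mul_of_nonneg_right (h l) (norm_nonneg _)

theorem fnPair_add_right (l : Freq) (φ ψ : TestFn) :
    fnPair (expFn l) ((φ + ψ : TestFn) : Plane → ℂ) =
      fnPair (expFn l) (φ : Plane → ℂ) + fnPair (expFn l) (ψ : Plane → ℂ) := by
  unfold fnPair
  rw [← mul_add, ← integral_add]
  · simp [mul_add]
  · exact integrable_cell ((continuous_expFn l).mul φ.2.1.continuous)
  · exact integrable_cell ((continuous_expFn l).mul ψ.2.1.continuous)

theorem fnPair_smul_right (l : Freq) (c : ℂ) (φ : TestFn) :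
    fnPair (expFn l) ((c • φ : TestFn) : Plane → ℂ) = c * fnPair (expFn l) (φ : Plane → ℂ) := by
  unfold fnPair
  have h : ∀ x, expFn l x * ((c • φ : TestFn) : Plane → ℂ) x = c * (expFn l x * (φ : Plane → ℂ) x) :=
    fun x => mul_left_comm _ _ _
  simp_rw [h]
  rw [integral_const_mul, mul_left_comm]

/-- The distribution with given polynomially bounded Fourier coefficients. -/
def PolyBdd.toDist {a : Freq → ℂ} (h : PolyBdd a) : Dist :=
  ⟨{ toFun := fun φ => (2 * Real.pi : ℂ)⁻¹ * ∑' l, a l * fnPair (expFn l) (φ : Plane → ℂ)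
     map_add' := fun φ ψ => by
      simp_rw [fnPair_add_right, mul_add]
      rw [(h.summable φ).tsum_add (h.summable ψ), mul_add]
     map_smul' := fun c φ => by
      simp_rw [fnPair_smul_right, mul_left_comm _ c]
      rw [tsum_mul_left, RingHom.id_apply, smul_eq_mul]
      ring }, by
    obtain ⟨C, K, hC⟩ := h
    obtain ⟨C', hC0', hC'⟩ := fnPair_decay (K + 3)
    refine ⟨‖(2 * Real.pi : ℂ)⁻¹‖ * ∑' l : Freq, |C| * C' * ((1 + ‖latticePoint l‖) ^ 3)⁻¹, K + 3,
      fun φ M hM => ?_⟩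
    simp only [LinearMap.coe_mk, AddHom.coe_mk]
    rw [norm_mul, mul_assoc, ← tsum_mul_right]
    refine mul_le_mul_of_nonneg_left ?_ (norm_nonneg _)
    refine tsum_of_norm_bounded ((summable_weight.mul_left _).mul_right _).hasSum fun l => ?_
    have h1 := hC' φ M hM l
    rw [norm_mul]
    have h2 : ‖fnPair (expFn l) (φ : Plane → ℂ)‖ ≤ ((1 + ‖latticePoint l‖) ^ (K + 3))⁻¹ * (C' * M) := by
      rw [le_inv_mul_iff₀ (by positivity)]; exact h1
    have h3 : ‖a l‖ ≤ |C| * (1 + ‖latticePoint l‖) ^ K :=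
      (hC l).trans (mul_le_mul_of_nonneg_right (le_abs_self C) (by positivity))
    calc _ ≤ |C| * (1 + ‖latticePoint l‖) ^ K * (((1 + ‖latticePoint l‖) ^ (K + 3))⁻¹ * (C' * M)) :=
          mul_le_mul h3 h2 (norm_nonneg _) (by positivity)
      _ = _ := by
          have : (1 + ‖latticePoint l‖) ≠ 0 := by positivity
          rw [pow_add]
          field_simp⟩

theorem fourierCoef_toDist {a : Freq → ℂ} (h : PolyBdd a) : fourierCoef h.toDist = a := by
  ext l
  have hpi : (Real.pi : ℂ) ≠ 0 := by exact_mod_cast Real.pi_ne_zero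
  change (2 * Real.pi : ℂ)⁻¹ * ∑' k, a k * fnPair (expFn k) (expFn (-l)) = a l
  simp_rw [fnPair_expFn_expFn]
  rw [tsum_eq_single l]
  · simp
    field_simp
  · intro k hk
    simp [hk]

theorem pair_eq_tsum (f : Dist) (φ : TestFn) :
    pair f φ = (2 * Real.pi : ℂ)⁻¹ * ∑' l, fourierCoef f l * fnPair (expFn l) (φ : Plane → ℂ) := by
  rw [← tsum_mul_left]
  exact (hasSum_pair f φ).tsum_eq.symm

/-! ### Trigonometric polynomials and Fourier multipliers -/

/-- The trigonometric polynomial `∑_l c_l e_l`, for finitely supported `c`. -/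
def synth (c : Freq → ℂ) (x : Plane) : ℂ := ∑' l, c l * expFn l x

/-- The supremum norm of the trigonometric polynomial with coefficients `c`. -/
def trigNorm (c : Freq → ℂ) : ℝ≥0∞ := ⨆ x, ‖synth c x‖ₑ

theorem synth_eq_sum {c : Freq → ℂ} {s : Finset Freq} (h : ∀ l ∉ s, c l = 0) (x : Plane) :
    synth c x = ∑ l ∈ s, c l * expFn l x :=
  tsum_eq_sum fun l hl => by rw [h l hl, zero_mul]

theorem synth_eq_sum_toFinset {c : Freq → ℂ} (h : c.support.Finite) (x : Plane) :
    synth c x = ∑ l ∈ h.toFinset, c l * expFn l x :=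
  synth_eq_sum (fun l hl => by simpa using hl) x

theorem enorm_synth_le (c : Freq → ℂ) (x : Plane) : ‖synth c x‖ₑ ≤ trigNorm c :=
  le_iSup (fun x => ‖synth c x‖ₑ) x

theorem trigNorm_lt_top {c : Freq → ℂ} (h : c.support.Finite) : trigNorm c < ⊤ := by
  refine (iSup_le fun x => ?_ : trigNorm c ≤ ∑ l ∈ h.toFinset, ‖c l‖ₑ).trans_lt
    (ENNReal.sum_lt_top.2 fun l _ => enorm_lt_top)
  rw [synth_eq_sum_toFinset h]
  refine (enorm_sum_le _ _).trans (Finset.sum_le_sum fun l _ => ?_)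
  rw [enorm_mul]
  have : ‖expFn l x‖ₑ = 1 := by rw [← ofReal_norm, norm_expFn, ENNReal.ofReal_one]
  rw [this, mul_one]

/-- Each coefficient of a trigonometric polynomial is bounded by the supremum norm. -/
theorem enorm_coef_le {c : Freq → ℂ} (h : c.support.Finite) (l : Freq) : ‖c l‖ₑ ≤ trigNorm c := by
  have hpi : (Real.pi : ℂ) ≠ 0 := by exact_mod_cast Real.pi_ne_zero
  have hlt := trigNorm_lt_top h
  have hb : ∀ x, ‖synth c x‖ ≤ (trigNorm c).toReal := fun x => by
    rw [← toReal_enorm]; exact ENNReal.toReal_mono hlt.ne (enorm_synth_le c x)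
  have h1 := norm_fnPair_le hb (fun x => (norm_expFn (-l) x).le)
  have h2 : fnPair (synth c) (expFn (-l)) = 2 * Real.pi * c l := by
    have h3 : fnPair (synth c) (expFn (-l)) =
        ∑ k ∈ h.toFinset, c k * fnPair (expFn k) (expFn (-l)) := by
      unfold fnPair
      simp_rw [synth_eq_sum_toFinset h, Finset.sum_mul, mul_assoc]
      rw [integral_finsetSum, Finset.mul_sum]
      · refine Finset.sum_congr rfl fun k _ => ?_
        rw [integral_const_mul, mul_left_comm]
      · intro k _
        exact integrable_cell (continuous_const.mul ((continuous_expFn _).mul (continuous_expFn _)))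
    rw [h3]
    simp_rw [fnPair_expFn_expFn]
    by_cases hl : c l = 0
    · rw [hl, mul_zero]
      refine Finset.sum_eq_zero fun k _ => ?_
      split_ifs with hk
      · rw [hk, hl, zero_mul]
      · rw [mul_zero]
    · rw [Finset.sum_eq_single l]
      · simp [mul_comm]
      · intro k _ hk; simp [hk]
      · intro h4; simp [hl] at h4
  rw [h2, norm_mul] at h1
  have h4 : ‖(2 * Real.pi : ℂ)‖ = 2 * Real.pi := by simp [abs_of_pos Real.pi_pos]
  rw [h4, mul_one] at h1
  have h5 : ‖c l‖ ≤ (trigNorm c).toReal := le_of_mul_le_mul_left h1 (by positivity)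
  rw [← ofReal_norm]
  exact ENNReal.ofReal_le_of_le_toReal h5

/-- `ψ` is the Fourier transform of an integrable function. -/
def HasKernel (ψ : Plane → ℂ) : Prop := ∃ K : Plane → ℂ, Integrable K ∧ ψ = 𝓕 K

theorem fourierChar_smul_expFn (v : Plane) (r : ℝ) (l : Freq) (x : Plane) :
    expFn l (x - (2 * Real.pi * r) • v) =
      (Real.fourierChar (-inner ℝ v (r • latticePoint l)) : ℂ) * expFn l x := by
  rw [Real.fourierChar_apply, sub_eq_add_neg, expFn_add_right, mul_comm]
  congr 1
  unfold expFn
  congr 1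
  simp [latticePoint, PiLp.inner_apply, Fin.sum_univ_two]
  ring

/-- Multipliers `ψ(rD)` are bounded on trigonometric polynomials in the supremum norm, uniformly in
the dilation `r`: they are convolutions on the plane with dilates of one integrable kernel. -/
theorem HasKernel.exists_bound {ψ : Plane → ℂ} (h : HasKernel ψ) :
    ∃ C : ℝ≥0∞, C ≠ ⊤ ∧ ∀ (r : ℝ) (c : Freq → ℂ), c.support.Finite →
      trigNorm (fun l => ψ (r • latticePoint l) * c l) ≤ C * trigNorm c := by
  obtain ⟨K, hK, rfl⟩ := h
  refine ⟨∫⁻ v, ‖K v‖ₑ, hK.2.ne, fun r c hc => iSup_le fun x => ?_⟩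
  have h1 : synth (fun l => 𝓕 K (r • latticePoint l) * c l) x =
      ∫ v, K v * synth c (x - (2 * Real.pi * r) • v) := by
    rw [synth_eq_sum (s := hc.toFinset) (fun l hl => by
      have : c l = 0 := by simpa using hl
      rw [this, mul_zero])]
    simp_rw [synth_eq_sum_toFinset hc, Finset.mul_sum, fourierChar_smul_expFn]
    rw [integral_finsetSum]
    · refine Finset.sum_congr rfl fun l _ => ?_
      rw [Real.fourier_eq, mul_assoc, ← integral_mul_const]
      congr 1
      ext v
      rw [Circle.smul_def, smul_eq_mul]
      ring
    · intro l _
      have h2 := (Real.fourierIntegral_convergent_iff (μ := volume) (r • latticePoint l)).2 hK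
      refine (h2.mul_const (c l * expFn l x)).congr (Eventually.of_forall fun v => ?_)
      simp only [Circle.smul_def, smul_eq_mul]
      ring
  rw [h1]
  refine (enorm_integral_le_lintegral_enorm _).trans ?_
  rw [← lintegral_mul_const'' _ hK.1.enorm]
  refine lintegral_mono fun v => ?_
  rw [enorm_mul]
  gcongr
  exact enorm_synth_le _ _

theorem hasKernel_of_hasCompactSupport {ψ : Plane → ℂ} (hc : HasCompactSupport ψ)
    (hs : ContDiff ℝ ∞ ψ) : HasKernel ψ := by
  let Ψ : 𝓢(Plane, ℂ) := hc.toSchwartzMap hs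
  let K : 𝓢(Plane, ℂ) := 𝓕⁻ Ψ
  refine ⟨K, K.integrable, ?_⟩
  rw [← SchwartzMap.fourier_coe, FourierTransform.fourier_fourierInv_eq]
  rfl

theorem integrable_gaussian_plane {b : ℝ} (hb : 0 < b) :
    Integrable fun v : Plane => Complex.exp (-b * ‖v‖ ^ 2) := by
  have := GaussianFourier.integrable_cexp_neg_mul_sq_norm_add (V := Plane) (b := b)
    (by simpa using hb) 0 0
  simpa using this

theorem fourier_gaussian_plane {b : ℝ} (hb : 0 < b) (w : Plane) :
    𝓕 (fun v : Plane => Complex.exp (-b * ‖v‖ ^ 2)) w =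
      Real.pi / b * Complex.exp (-Real.pi ^ 2 * ‖w‖ ^ 2 / b) := by
  rw [fourier_gaussian_innerProductSpace (by simpa using hb)]
  simp

theorem hasKernel_gaussian : HasKernel fun ξ : Plane => (Real.exp (-‖ξ‖ ^ 2) : ℂ) := by
  have hpi : (0 : ℝ) < Real.pi ^ 2 := by positivity
  have hpi' : (Real.pi : ℂ) ≠ 0 := by exact_mod_cast Real.pi_ne_zero
  refine ⟨(Real.pi : ℂ) • fun v : Plane => Complex.exp (-(Real.pi ^ 2 : ℝ) * ‖v‖ ^ 2),
    (integrable_gaussian_plane hpi).smul _, ?_⟩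
  ext w
  have h := fourier_gaussian_plane hpi w
  rw [Real.fourier_eq] at h ⊢
  simp only [Pi.smul_apply]
  simp_rw [smul_comm _ (Real.pi : ℂ)]
  rw [integral_smul, h]
  push_cast
  rw [smul_eq_mul, ← mul_assoc]
  have e1 : -(Real.pi : ℂ) ^ 2 * ‖w‖ ^ 2 / (Real.pi : ℂ) ^ 2 = -‖w‖ ^ 2 := by field_simp
  rw [e1]
  field_simp

/-- The symbol `|ξ|² e^{-|ξ|²}` has an integrable kernel: differentiate the Fourier transform of
the Gaussian with respect to its width. -/
theorem hasKernel_sq_mul_gaussian :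
    HasKernel fun ξ : Plane => ((‖ξ‖ ^ 2 * Real.exp (-‖ξ‖ ^ 2) : ℝ) : ℂ) := by
  have hpi : (9 : ℝ) < Real.pi ^ 2 := by nlinarith [Real.pi_gt_three]
  have hpi' : (Real.pi : ℂ) ≠ 0 := by exact_mod_cast Real.pi_ne_zero
  have hI := integrable_gaussian_plane (b := 1) one_pos
  have hdom : ∀ (b : ℝ), 2 < b → ∀ v : Plane,
      ‖(‖v‖ ^ 2 : ℂ) * Complex.exp (-b * ‖v‖ ^ 2)‖ ≤ ‖Complex.exp (-(1 : ℝ) * ‖v‖ ^ 2)‖ := by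
    intro b hb v
    have e1 : (-b * ‖v‖ ^ 2 : ℂ) = ((-b * ‖v‖ ^ 2 : ℝ) : ℂ) := by push_cast; ring
    have e2 : (-(1 : ℝ) * ‖v‖ ^ 2 : ℂ) = ((-1 * ‖v‖ ^ 2 : ℝ) : ℂ) := by push_cast; ring
    have e3 : (‖v‖ ^ 2 : ℂ) = ((‖v‖ ^ 2 : ℝ) : ℂ) := by push_cast; ring
    rw [e1, e2, e3, norm_mul, Complex.norm_exp_ofReal, Complex.norm_exp_ofReal, Complex.norm_real,
      Real.norm_of_nonneg (by positivity)]
    have h2 : ‖v‖ ^ 2 ≤ Real.exp (‖v‖ ^ 2) := by linarith [Real.add_one_le_exp (‖v‖ ^ 2)]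
    calc ‖v‖ ^ 2 * Real.exp (-b * ‖v‖ ^ 2) ≤ Real.exp (‖v‖ ^ 2) * Real.exp (-b * ‖v‖ ^ 2) := by gcongr
      _ = Real.exp (‖v‖ ^ 2 + -b * ‖v‖ ^ 2) := by rw [Real.exp_add]
      _ ≤ _ := by
        apply Real.exp_le_exp.2
        nlinarith [sq_nonneg ‖v‖]
  have hI2 : Integrable fun v : Plane => (‖v‖ ^ 2 : ℂ) * Complex.exp (-(Real.pi ^ 2 : ℝ) * ‖v‖ ^ 2) := by
    refine hI.mono ?_ (Eventually.of_forall (hdom _ (by linarith)))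
    exact (by fun_prop : Continuous fun v : Plane =>
      (‖v‖ ^ 2 : ℂ) * Complex.exp (-(Real.pi ^ 2 : ℝ) * ‖v‖ ^ 2)).aestronglyMeasurable
  have hI1 := integrable_gaussian_plane (b := Real.pi ^ 2) (by linarith)
  refine ⟨fun v => (Real.pi - Real.pi ^ 3 * ‖v‖ ^ 2) * Complex.exp (-(Real.pi ^ 2 : ℝ) * ‖v‖ ^ 2),
    ?_, ?_⟩
  · refine ((hI1.const_mul (Real.pi : ℂ)).sub (hI2.const_mul ((Real.pi : ℂ) ^ 3))).congr
      (Eventually.of_forall fun v => ?_)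
    simp only [Pi.sub_apply]
    ring
  · ext w
    have hF := fourier_gaussian_plane (b := Real.pi ^ 2) (by linarith) w
    rw [Real.fourier_eq] at hF ⊢
    -- the derivative in `b` of the Fourier transform of `exp(-b|v|²)`, computed in two ways
    have key := hasDerivAt_integral_of_dominated_loc_of_deriv_le (𝕜 := ℝ) (E := ℂ)
      (μ := (volume : Measure Plane))
      (F := fun b v => Real.fourierChar (-inner ℝ v w) • Complex.exp (-b * ‖v‖ ^ 2))
      (x₀ := Real.pi ^ 2)
      (F' := fun b v => Real.fourierChar (-inner ℝ v w) •
        (-((‖v‖ ^ 2 : ℂ) * Complex.exp (-b * ‖v‖ ^ 2))))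
      (bound := fun v => ‖Complex.exp (-(1 : ℝ) * ‖v‖ ^ 2)‖)
      (s := Metric.ball (Real.pi ^ 2) 1) (Metric.ball_mem_nhds _ one_pos)
      (by
        filter_upwards [lt_mem_nhds (show (0 : ℝ) < Real.pi ^ 2 by linarith)] with b hb
        exact ((Real.fourierIntegral_convergent_iff (μ := volume) w).2
          (integrable_gaussian_plane hb)).aestronglyMeasurable)
      ((Real.fourierIntegral_convergent_iff (μ := volume) w).2 hI1)
      ((Real.fourierIntegral_convergent_iff (μ := volume) w).2 hI2.neg).aestronglyMeasurable
      (Eventually.of_forall fun v b hb => by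
        rw [Circle.norm_smul, norm_neg]
        refine hdom b ?_ v
        rw [Metric.mem_ball, Real.dist_eq, abs_lt] at hb
        linarith)
      hI.norm
      (Eventually.of_forall fun v b _ => by
        have h1 : HasDerivAt (fun b : ℝ => (-b * ‖v‖ ^ 2 : ℂ)) (-(‖v‖ ^ 2 : ℂ)) b := by
          have := ((hasDerivAt_id b).ofReal_comp.neg).mul_const (‖v‖ ^ 2 : ℂ)
          simpa using this
        have h2 := h1.cexp.const_mul (Real.fourierChar (-inner ℝ v w) : ℂ)
        simp only [Circle.smul_def, smul_eq_mul]
        exact h2.congr_deriv (by ring))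
    have h1 : HasDerivAt (fun b : ℝ => (Real.pi / b * Complex.exp (-Real.pi ^ 2 * ‖w‖ ^ 2 / b) : ℂ))
        ((Real.pi : ℂ)⁻¹ ^ 3 * (‖w‖ ^ 2 - 1) * Complex.exp (-‖w‖ ^ 2)) (Real.pi ^ 2) := by
      have hb0 : ((Real.pi ^ 2 : ℝ) : ℂ) ≠ 0 := by
        push_cast; exact pow_ne_zero _ hpi'
      have g1 : HasDerivAt (fun b : ℝ => (b : ℂ)) 1 (Real.pi ^ 2) := by
        simpa using (hasDerivAt_id (Real.pi ^ 2 : ℝ)).ofReal_comp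
      have g2 := (hasDerivAt_const (Real.pi ^ 2 : ℝ) (Real.pi : ℂ)).div g1 hb0
      have g3 := ((hasDerivAt_const (Real.pi ^ 2 : ℝ) (-Real.pi ^ 2 * ‖w‖ ^ 2 : ℂ)).div g1 hb0).cexp
      refine (g2.mul g3).congr_deriv ?_
      simp only [Pi.div_apply]
      push_cast
      have e1 : -(Real.pi : ℂ) ^ 2 * ‖w‖ ^ 2 / (Real.pi : ℂ) ^ 2 = -‖w‖ ^ 2 := by field_simp
      rw [e1]
      field_simp
      ring
    have h2 := key.2.unique (h1.congr_of_eventuallyEq (by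
      filter_upwards [lt_mem_nhds (show (0 : ℝ) < Real.pi ^ 2 by linarith)] with b hb
      rw [← fourier_gaussian_plane hb w, Real.fourier_eq]))
    have h3 : ∀ v : Plane, Real.fourierChar (-inner ℝ v w) •
        ((Real.pi - Real.pi ^ 3 * ‖v‖ ^ 2) * Complex.exp (-(Real.pi ^ 2 : ℝ) * ‖v‖ ^ 2) : ℂ) =
        (Real.pi : ℂ) * (Real.fourierChar (-inner ℝ v w) • Complex.exp (-(Real.pi ^ 2 : ℝ) * ‖v‖ ^ 2)) +
        (Real.pi : ℂ) ^ 3 * (Real.fourierChar (-inner ℝ v w) •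
          (-((‖v‖ ^ 2 : ℂ) * Complex.exp (-(Real.pi ^ 2 : ℝ) * ‖v‖ ^ 2)))) := by
      intro v
      simp only [Circle.smul_def, smul_eq_mul]
      ring
    simp_rw [h3]
    rw [integral_add, integral_const_mul, integral_const_mul, hF, h2]
    · push_cast
      have e1 : -(Real.pi : ℂ) ^ 2 * ‖w‖ ^ 2 / (Real.pi : ℂ) ^ 2 = -‖w‖ ^ 2 := by field_simp
      rw [e1]
      field_simp
      ring
    · exact ((Real.fourierIntegral_convergent_iff (μ := volume) w).2 hI1).const_mul _
    · exact ((Real.fourierIntegral_convergent_iff (μ := volume) w).2 hI2.neg).const_mul _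

section

variable (P : DyadicPartition)

/-! ### Littlewood-Paley blocks of coefficient sequences -/

/-- The coefficients of the `m`-th Littlewood-Paley block. As for `symbol`, the numbering starts at
`m = 0` with the symbol `χ`, so that `m` stands for the block `Δ_{m-1}`. -/
def blkC (m : ℕ) (a : Freq → ℂ) (l : Freq) : ℂ := (symbol P m (latticePoint l) : ℂ) * a l

/-- The supremum norm of the `m`-th Littlewood-Paley block of the distribution with Fourier
coefficients `a`. -/
def bsup (m : ℕ) (a : Freq → ℂ) : ℝ≥0∞ := ⨆ x, ‖(2 * Real.pi : ℂ)⁻¹ * synth (blkC P m a) x‖ₑ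

/-- The Besov norm as a function of the Fourier coefficients, with values in `[0, ∞]`. -/
def bnorm (s : ℝ) (a : Freq → ℂ) : ℝ≥0∞ :=
  ⨆ m : ℕ, ENNReal.ofReal ((2 : ℝ) ^ (((m : ℝ) - 1) * s)) * bsup P m a

theorem finite_support_blkC (m : ℕ) (a : Freq → ℂ) : (blkC P m a).support.Finite := by
  refine (symbol_finite P m).subset fun l hl h => hl ?_
  simp [blkC, h]

theorem bsup_eq (m : ℕ) (a : Freq → ℂ) :
    bsup P m a = ‖(2 * Real.pi : ℂ)⁻¹‖ₑ * trigNorm (blkC P m a) := by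
  unfold bsup trigNorm
  rw [ENNReal.mul_iSup]
  simp_rw [enorm_mul]

theorem trigNorm_blkC_eq (m : ℕ) (a : Freq → ℂ) :
    trigNorm (blkC P m a) = ‖(2 * Real.pi : ℂ)‖ₑ * bsup P m a := by
  have hpi : (2 * Real.pi : ℂ) ≠ 0 := by
    simp
  rw [bsup_eq, ← mul_assoc, ← enorm_mul, mul_inv_cancel₀ hpi, enorm_one, one_mul]

theorem bsup_lt_top (m : ℕ) (a : Freq → ℂ) : bsup P m a < ⊤ := by
  rw [bsup_eq]
  exact ENNReal.mul_lt_top enorm_lt_top (trigNorm_lt_top (finite_support_blkC P m a))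

theorem bsup_le (s : ℝ) (m : ℕ) (a : Freq → ℂ) :
    bsup P m a ≤ ENNReal.ofReal ((2 : ℝ) ^ (-(((m : ℝ) - 1) * s))) * bnorm P s a := by
  have h : ENNReal.ofReal ((2 : ℝ) ^ (((m : ℝ) - 1) * s)) * bsup P m a ≤ bnorm P s a :=
    le_iSup (fun m : ℕ => ENNReal.ofReal ((2 : ℝ) ^ (((m : ℝ) - 1) * s)) * bsup P m a) m
  calc bsup P m a = ENNReal.ofReal ((2 : ℝ) ^ (-(((m : ℝ) - 1) * s))) *
        (ENNReal.ofReal ((2 : ℝ) ^ (((m : ℝ) - 1) * s)) * bsup P m a) := by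
        rw [← mul_assoc, ← ENNReal.ofReal_mul (by positivity), ← Real.rpow_add (by norm_num)]
        simp
    _ ≤ _ := by gcongr

theorem bnorm_le_iff {s : ℝ} {a : Freq → ℂ} {B : ℝ≥0∞} : bnorm P s a ≤ B ↔
    ∀ m : ℕ, ENNReal.ofReal ((2 : ℝ) ^ (((m : ℝ) - 1) * s)) * bsup P m a ≤ B := iSup_le_iff

theorem weight_mul_bsup_le (s : ℝ) (m : ℕ) (a : Freq → ℂ) :
    ENNReal.ofReal ((2 : ℝ) ^ (((m : ℝ) - 1) * s)) * bsup P m a ≤ bnorm P s a :=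
  (bnorm_le_iff P).1 le_rfl m

theorem synth_add {a b : Freq → ℂ} (ha : a.support.Finite) (hb : b.support.Finite) (x : Plane) :
    synth (a + b) x = synth a x + synth b x := by
  have h1 : ∀ {c : Freq → ℂ}, c.support.Finite → Summable fun l => c l * expFn l x := fun hc =>
    summable_of_hasFiniteSupport (hc.subset fun l hl h => hl (by simp [h]))
  unfold synth
  rw [← (h1 ha).tsum_add (h1 hb)]
  simp [add_mul]

theorem synth_smul (z : ℂ) (a : Freq → ℂ) (x : Plane) : synth (z • a) x = z * synth a x := by
  unfold synth
  rw [← tsum_mul_left]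
  simp [mul_assoc]

theorem trigNorm_smul (z : ℂ) (a : Freq → ℂ) : trigNorm (z • a) = ‖z‖ₑ * trigNorm a := by
  unfold trigNorm
  rw [ENNReal.mul_iSup]
  simp_rw [synth_smul, enorm_mul]

theorem trigNorm_add_le {a b : Freq → ℂ} (ha : a.support.Finite) (hb : b.support.Finite) :
    trigNorm (a + b) ≤ trigNorm a + trigNorm b := by
  refine iSup_le fun x => ?_
  rw [synth_add ha hb]
  exact (enorm_add_le _ _).trans (add_le_add (enorm_synth_le a x) (enorm_synth_le b x))

theorem bsup_add_le (m : ℕ) (a b : Freq → ℂ) : bsup P m (a + b) ≤ bsup P m a + bsup P m b := by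
  have h : blkC P m (a + b) = blkC P m a + blkC P m b := by ext l; simp [blkC, mul_add]
  rw [bsup_eq, bsup_eq, bsup_eq, ← mul_add, h]
  gcongr
  exact trigNorm_add_le (finite_support_blkC P m a) (finite_support_blkC P m b)

theorem bsup_smul (m : ℕ) (z : ℂ) (a : Freq → ℂ) : bsup P m (z • a) = ‖z‖ₑ * bsup P m a := by
  have h : blkC P m (z • a) = z • blkC P m a := by ext l; simp [blkC, mul_left_comm]
  rw [bsup_eq, bsup_eq, h, trigNorm_smul, mul_left_comm]

theorem bnorm_add_le (s : ℝ) (a b : Freq → ℂ) : bnorm P s (a + b) ≤ bnorm P s a + bnorm P s b := by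
  refine (bnorm_le_iff P).2 fun m => ?_
  calc _ ≤ ENNReal.ofReal ((2 : ℝ) ^ (((m : ℝ) - 1) * s)) * (bsup P m a + bsup P m b) := by
        gcongr; exact bsup_add_le P m a b
    _ ≤ _ := by
        rw [mul_add]
        exact add_le_add (weight_mul_bsup_le P s m a) (weight_mul_bsup_le P s m b)

theorem bnorm_smul (s : ℝ) (z : ℂ) (a : Freq → ℂ) : bnorm P s (z • a) = ‖z‖ₑ * bnorm P s a := by
  unfold bnorm
  rw [ENNReal.mul_iSup]
  simp_rw [bsup_smul, mul_left_comm]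

theorem bnorm_neg (s : ℝ) (a : Freq → ℂ) : bnorm P s (-a) = bnorm P s a := by
  rw [← neg_one_smul ℂ, bnorm_smul]; simp

theorem bnorm_sub_le (s : ℝ) (a b : Freq → ℂ) : bnorm P s (a - b) ≤ bnorm P s a + bnorm P s b := by
  rw [sub_eq_add_neg, ← bnorm_neg P s b]; exact bnorm_add_le P s a (-b)

@[simp] theorem bnorm_zero (s : ℝ) : bnorm P s 0 = 0 := by
  have := bnorm_smul P s 0 0; simpa using this

theorem norm_le_of_symbol_ne_zero {m : ℕ} {x : Plane} (hx : symbol P m x ≠ 0) : ‖x‖ ≤ 4 * 2 ^ m := by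
  cases m with
  | zero =>
    have := P.χ_supp (subset_tsupport _ hx)
    simpa using this
  | succ j =>
    have h1 := (P.ρ_supp (subset_tsupport P.ρ (a := ((2 : ℝ) ^ j)⁻¹ • x) hx)).1
    rw [mem_closedBall_zero_iff, norm_smul, norm_inv, norm_pow, Real.norm_ofNat] at h1
    have h2 : (0 : ℝ) < 2 ^ j := by positivity
    rw [inv_mul_le_iff₀ h2] at h1
    rw [pow_succ]
    nlinarith

theorem mem_annulus_of_symbol_ne_zero {j : ℕ} {x : Plane} (hx : symbol P (j + 1) x ≠ 0) :
    1 ≤ ‖((2 : ℝ) ^ j)⁻¹ • x‖ ∧ ‖((2 : ℝ) ^ j)⁻¹ • x‖ ≤ 4 := by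
  have h1 := P.ρ_supp (subset_tsupport P.ρ (a := ((2 : ℝ) ^ j)⁻¹ • x) hx)
  exact ⟨by simpa using h1.2, by simpa using h1.1⟩

theorem le_norm_of_symbol_ne_zero {j : ℕ} {x : Plane} (hx : symbol P (j + 1) x ≠ 0) :
    2 ^ j ≤ ‖x‖ := by
  have h1 := (mem_annulus_of_symbol_ne_zero P hx).1
  rw [norm_smul, norm_inv, norm_pow, Real.norm_ofNat] at h1
  have h2 : (0 : ℝ) < 2 ^ j := by positivity
  rwa [le_inv_mul_iff₀ h2, mul_one] at h1

theorem hasSum_symbol (x : Plane) : HasSum (fun m => symbol P m x) 1 := by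
  have h := P.sum_eq_one x
  have h2 : HasSum (fun j => symbol P (j + 1) x) (1 - P.χ x) := h
  have := (hasSum_nat_add_iff (f := fun m => symbol P m x) 1).1 h2
  simpa [symbol] using this

/-- The sum of the first symbols is a dilate of `χ`. -/
theorem sum_symbol (N : ℕ) (x : Plane) :
    ∑ m ∈ Finset.range (N + 1), symbol P m x = P.χ (((2 : ℝ) ^ N)⁻¹ • x) := by
  have h1 := (hasSum_nat_add_iff' (N + 1)).2 (hasSum_symbol P x)
  have h2 := P.sum_eq_one (((2 : ℝ) ^ N)⁻¹ • x)
  have h3 : ∀ i : ℕ, symbol P (i + (N + 1)) x = P.ρ (((2 : ℝ) ^ i)⁻¹ • ((2 : ℝ) ^ N)⁻¹ • x) := by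
    intro i
    change P.ρ (((2 : ℝ) ^ (i + N))⁻¹ • x) = _
    rw [smul_smul, ← mul_inv, ← pow_add]
  simp_rw [h3] at h1
  have := h1.unique h2
  linarith

theorem symbol_eq_zero_of_lt {m : ℕ} {x : Plane} (h : ‖x‖ < 2 ^ m) (j : ℕ) (hj : m < j) :
    symbol P j x = 0 := by
  obtain ⟨k, rfl⟩ : ∃ k, j = k + 1 := ⟨j - 1, by omega⟩
  by_contra hne
  have h1 := le_norm_of_symbol_ne_zero P hne
  have h2 : (2 : ℝ) ^ m ≤ 2 ^ k := pow_le_pow_right₀ (by norm_num) (by omega)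
  linarith

theorem sum_symbol_eq_one {m : ℕ} {x : Plane} (h : ‖x‖ < 2 ^ m) {N : ℕ} (hN : m < N) :
    ∑ j ∈ Finset.range N, symbol P j x = 1 := by
  have h1 : HasSum (fun m => symbol P m x) (∑ j ∈ Finset.range N, symbol P j x) :=
    hasSum_sum_of_ne_finset_zero fun j hj => symbol_eq_zero_of_lt P h j (by simp at hj; omega)
  exact h1.unique (hasSum_symbol P x)

theorem χ_hasKernel : HasKernel fun x => (P.χ x : ℂ) := by
  refine hasKernel_of_hasCompactSupport ?_ (Complex.ofRealCLM.contDiff.comp P.χ_smooth)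
  refine HasCompactSupport.comp_left (g := fun r : ℝ => (r : ℂ)) ?_ Complex.ofReal_zero
  exact (isCompact_closedBall _ _).of_isClosed_subset (isClosed_tsupport _) P.χ_supp

theorem ρ_hasKernel : HasKernel fun x => (P.ρ x : ℂ) := by
  refine hasKernel_of_hasCompactSupport ?_ (Complex.ofRealCLM.contDiff.comp P.ρ_smooth)
  refine HasCompactSupport.comp_left (g := fun r : ℝ => (r : ℂ)) ?_ Complex.ofReal_zero
  exact (isCompact_closedBall _ _).of_isClosed_subset (isClosed_tsupport _)
    (P.ρ_supp.trans sdiff_subset)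

/-- Littlewood-Paley blocks are uniformly bounded in the supremum norm. -/
theorem exists_trigNorm_blkC_le : ∃ C : ℝ≥0∞, C ≠ ⊤ ∧ ∀ (m : ℕ) (c : Freq → ℂ), c.support.Finite →
    trigNorm (blkC P m c) ≤ C * trigNorm c := by
  obtain ⟨C₁, h₁, H₁⟩ := (χ_hasKernel P).exists_bound
  obtain ⟨C₂, h₂, H₂⟩ := (ρ_hasKernel P).exists_bound
  refine ⟨C₁ + C₂, ENNReal.add_ne_top.2 ⟨h₁, h₂⟩, fun m c hc => ?_⟩
  cases m with
  | zero =>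
    have := H₁ 1 c hc
    simp_rw [one_smul] at this
    exact this.trans (by gcongr; exact le_self_add)
  | succ j => exact (H₂ _ c hc).trans (by gcongr; exact le_add_self)

/-- The low frequency truncation of a coefficient sequence. -/
def lowC (N : ℕ) (a : Freq → ℂ) (l : Freq) : ℂ :=
  ∑ m ∈ Finset.range N, blkC P m a l

theorem lowC_eq (N : ℕ) (a : Freq → ℂ) (l : Freq) :
    lowC P (N + 1) a l = (P.χ (((2 : ℝ) ^ N)⁻¹ • latticePoint l) : ℂ) * a l := by
  unfold lowC blkC
  rw [← Finset.sum_mul, ← sum_symbol]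
  push_cast
  rfl

theorem lowC_eq_self {m : ℕ} {l : Freq} (h : ‖latticePoint l‖ < 2 ^ m) {N : ℕ} (hN : m < N)
    (a : Freq → ℂ) : lowC P N a l = a l := by
  unfold lowC blkC
  rw [← Finset.sum_mul, ← Complex.ofReal_sum, sum_symbol_eq_one P h hN, Complex.ofReal_one, one_mul]

theorem exists_bsup_lowC_le : ∃ C : ℝ≥0∞, C ≠ ⊤ ∧ ∀ (m N : ℕ) (a : Freq → ℂ),
    bsup P m (lowC P (N + 1) a) ≤ C * bsup P m a := by
  obtain ⟨C₁, h₁, H₁⟩ := (χ_hasKernel P).exists_bound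
  refine ⟨C₁, h₁, fun m N a => ?_⟩
  have h := H₁ ((2 : ℝ) ^ N)⁻¹ _ (finite_support_blkC P m a)
  have h2 : blkC P m (lowC P (N + 1) a) =
      fun l => (P.χ (((2 : ℝ) ^ N)⁻¹ • latticePoint l) : ℂ) * blkC P m a l := by
    ext l
    simp only [blkC, lowC_eq]
    ring
  rw [bsup_eq, bsup_eq, h2, mul_left_comm]
  gcongr

theorem exists_bnorm_lowC_le : ∃ C : ℝ≥0∞, C ≠ ⊤ ∧ ∀ (s : ℝ) (N : ℕ) (a : Freq → ℂ),
    bnorm P s (lowC P (N + 1) a) ≤ C * bnorm P s a := by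
  obtain ⟨C, h, H⟩ := exists_bsup_lowC_le P
  refine ⟨C, h, fun s N a => (bnorm_le_iff P).2 fun m => ?_⟩
  calc _ ≤ ENNReal.ofReal ((2 : ℝ) ^ (((m : ℝ) - 1) * s)) * (C * bsup P m a) := by gcongr; exact H m N a
    _ = C * (ENNReal.ofReal ((2 : ℝ) ^ (((m : ℝ) - 1) * s)) * bsup P m a) := by ring
    _ ≤ _ := by gcongr; exact weight_mul_bsup_le P s m a

/-- Besov spaces decrease with the regularity index. -/
theorem bnorm_mono {s s' : ℝ} (h : s' ≤ s) (a : Freq → ℂ) :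
    bnorm P s' a ≤ ENNReal.ofReal ((2 : ℝ) ^ (s - s')) * bnorm P s a := by
  refine (bnorm_le_iff P).2 fun m => ?_
  calc _ ≤ ENNReal.ofReal ((2 : ℝ) ^ (s - s') * 2 ^ (((m : ℝ) - 1) * s)) * bsup P m a := by
        gcongr
        rw [← Real.rpow_add (by norm_num)]
        refine Real.rpow_le_rpow_of_exponent_le (by norm_num) ?_
        have : (0 : ℝ) ≤ m := Nat.cast_nonneg m
        nlinarith
    _ = ENNReal.ofReal ((2 : ℝ) ^ (s - s')) *
        (ENNReal.ofReal ((2 : ℝ) ^ (((m : ℝ) - 1) * s)) * bsup P m a) := by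
        rw [ENNReal.ofReal_mul (by positivity), mul_assoc]
    _ ≤ _ := by gcongr; exact weight_mul_bsup_le P s m a

/-- High frequencies are small in a space of lower regularity. -/
theorem bnorm_le_sum_add (s : ℝ) {η : ℝ} (hη : 0 ≤ η) (N : ℕ) (a : Freq → ℂ) :
    bnorm P s a ≤ ∑ m ∈ Finset.range N, ENNReal.ofReal ((2 : ℝ) ^ (((m : ℝ) - 1) * s)) * bsup P m a
      + ENNReal.ofReal ((2 : ℝ) ^ (-(((N : ℝ) - 1) * η))) * bnorm P (s + η) a := by
  refine (bnorm_le_iff P).2 fun m => ?_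
  by_cases hm : m < N
  · exact (Finset.single_le_sum
      (f := fun m : ℕ => ENNReal.ofReal ((2 : ℝ) ^ (((m : ℝ) - 1) * s)) * bsup P m a)
      (fun _ _ => zero_le) (Finset.mem_range.2 hm)).trans le_self_add
  · refine le_trans ?_ le_add_self
    calc _ ≤ ENNReal.ofReal ((2 : ℝ) ^ (-(((N : ℝ) - 1) * η)) * 2 ^ (((m : ℝ) - 1) * (s + η))) *
          bsup P m a := by
          gcongr
          rw [← Real.rpow_add (by norm_num)]
          refine Real.rpow_le_rpow_of_exponent_le (by norm_num) ?_
          have : (N : ℝ) ≤ m := by exact_mod_cast not_lt.1 hm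
          nlinarith
      _ = ENNReal.ofReal ((2 : ℝ) ^ (-(((N : ℝ) - 1) * η))) *
          (ENNReal.ofReal ((2 : ℝ) ^ (((m : ℝ) - 1) * (s + η))) * bsup P m a) := by
          rw [ENNReal.ofReal_mul (by positivity), mul_assoc]
      _ ≤ _ := by gcongr; exact weight_mul_bsup_le P (s + η) m a

/-- The Fourier coefficients of an element of a Besov space grow at most polynomially. -/
theorem exists_enorm_coef_le (s : ℝ) : ∃ (C : ℝ) (K : ℕ), 0 ≤ C ∧ ∀ (a : Freq → ℂ) (l : Freq),
    ‖a l‖ₑ ≤ ENNReal.ofReal (C * (1 + ‖latticePoint l‖) ^ K) * bnorm P s a := by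
  refine ⟨3 * ((2 * Real.pi) * 2 ^ |s|), ⌈|s|⌉₊ + 1, by positivity, fun a l => ?_⟩
  set r := ‖latticePoint l‖ with hr
  have hr0 : 0 ≤ r := norm_nonneg _
  set M := ⌈r⌉₊ + 1 with hM
  have hlt : r < 2 ^ M := by
    have h1 := Nat.le_ceil r
    have h2 : ((M : ℕ) : ℝ) < 2 ^ M := by exact_mod_cast Nat.lt_two_pow_self
    have h3 : (M : ℝ) = ⌈r⌉₊ + 1 := by rw [hM]; push_cast; ring
    linarith
  have hsum := lowC_eq_self P (l := l) hlt (Nat.lt_succ_self M) a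
  have hterm : ∀ m ∈ Finset.range (M + 1), ‖blkC P m a l‖ₑ ≤
      ENNReal.ofReal ((2 * Real.pi) * 2 ^ |s| * (1 + r) ^ |s|) * bnorm P s a := by
    intro m _
    by_cases h0 : symbol P m (latticePoint l) = 0
    · simp [blkC, h0]
    have hw : (2 : ℝ) ^ (-(((m : ℝ) - 1) * s)) ≤ 2 ^ |s| * (1 + r) ^ |s| := by
      cases m with
      | zero =>
        calc (2 : ℝ) ^ (-((((0 : ℕ) : ℝ) - 1) * s)) ≤ 2 ^ |s| :=
              Real.rpow_le_rpow_of_exponent_le (by norm_num) (by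
                simp only [Nat.cast_zero]; linarith [le_abs_self s])
          _ ≤ 2 ^ |s| * (1 + r) ^ |s| :=
              le_mul_of_one_le_right (by positivity)
                (Real.one_le_rpow (by linarith) (abs_nonneg _))
      | succ j =>
        have h1 := le_norm_of_symbol_ne_zero P h0
        calc (2 : ℝ) ^ (-((((j + 1 : ℕ) : ℝ) - 1) * s)) ≤ 2 ^ ((j : ℝ) * |s|) :=
              Real.rpow_le_rpow_of_exponent_le (by norm_num) (by
                push_cast
                have : (0 : ℝ) ≤ j := Nat.cast_nonneg j
                nlinarith [neg_abs_le s])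
          _ = ((2 : ℝ) ^ j) ^ |s| := by rw [Real.rpow_mul (by norm_num), Real.rpow_natCast]
          _ ≤ (1 + r) ^ |s| := Real.rpow_le_rpow (by positivity) (by linarith) (abs_nonneg _)
          _ ≤ 2 ^ |s| * (1 + r) ^ |s| :=
              le_mul_of_one_le_left (by positivity) (Real.one_le_rpow (by norm_num) (abs_nonneg _))
    have h2pi : ‖(2 * Real.pi : ℂ)‖ₑ = ENNReal.ofReal (2 * Real.pi) := by
      rw [← ofReal_norm]; congr 1; simp [abs_of_pos Real.pi_pos]
    calc ‖blkC P m a l‖ₑ ≤ trigNorm (blkC P m a) := enorm_coef_le (finite_support_blkC P m a) l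
      _ = ENNReal.ofReal (2 * Real.pi) * bsup P m a := by rw [trigNorm_blkC_eq, h2pi]
      _ ≤ ENNReal.ofReal (2 * Real.pi) *
          (ENNReal.ofReal (2 ^ |s| * (1 + r) ^ |s|) * bnorm P s a) := by
          gcongr
          exact (bsup_le P s m a).trans (by gcongr)
      _ = _ := by
          rw [← mul_assoc, ← ENNReal.ofReal_mul (by positivity), ← mul_assoc (2 * Real.pi)]
  calc ‖a l‖ₑ = ‖∑ m ∈ Finset.range (M + 1), blkC P m a l‖ₑ := by rw [← hsum]; rfl
    _ ≤ ∑ m ∈ Finset.range (M + 1), ‖blkC P m a l‖ₑ := enorm_sum_le _ _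
    _ ≤ ∑ m ∈ Finset.range (M + 1),
        ENNReal.ofReal ((2 * Real.pi) * 2 ^ |s| * (1 + r) ^ |s|) * bnorm P s a :=
        Finset.sum_le_sum hterm
    _ = ENNReal.ofReal ((M + 1 : ℕ) * ((2 * Real.pi) * 2 ^ |s| * (1 + r) ^ |s|)) * bnorm P s a := by
        rw [Finset.sum_const, Finset.card_range, nsmul_eq_mul, ← mul_assoc,
          ENNReal.ofReal_mul (p := ((M + 1 : ℕ) : ℝ)) (by positivity), ENNReal.ofReal_natCast]
    _ ≤ _ := by
        refine mul_le_mul_left (ENNReal.ofReal_le_ofReal ?_) _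
        have h1 : ((M + 1 : ℕ) : ℝ) ≤ 3 * (1 + r) := by
          have := Nat.ceil_lt_add_one hr0
          rw [hM]; push_cast; linarith
        have h2 : (1 + r) ^ |s| ≤ (1 + r) ^ ⌈|s|⌉₊ := by
          rw [← Real.rpow_natCast]
          exact Real.rpow_le_rpow_of_exponent_le (by linarith) (Nat.le_ceil _)
        calc ((M + 1 : ℕ) : ℝ) * ((2 * Real.pi) * 2 ^ |s| * (1 + r) ^ |s|)
            ≤ (3 * (1 + r)) * ((2 * Real.pi) * 2 ^ |s| * (1 + r) ^ ⌈|s|⌉₊) := by gcongr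
          _ = _ := by ring

theorem eq_zero_of_bnorm_eq_zero {s : ℝ} {a : Freq → ℂ} (h : bnorm P s a = 0) : a = 0 := by
  obtain ⟨C, K, -, H⟩ := exists_enorm_coef_le P s
  ext l
  have := H a l
  rw [h, mul_zero] at this
  simpa using this

theorem polyBdd_of_bnorm_lt_top {s : ℝ} {a : Freq → ℂ} (h : bnorm P s a < ⊤) : PolyBdd a := by
  obtain ⟨C, K, hC, H⟩ := exists_enorm_coef_le P s
  refine ⟨C * (bnorm P s a).toReal, K, fun l => ?_⟩
  have h1 := ENNReal.toReal_mono (ENNReal.mul_lt_top ENNReal.ofReal_lt_top h).ne (H a l)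
  rw [toReal_enorm, ENNReal.toReal_mul, ENNReal.toReal_ofReal (by positivity)] at h1
  linarith

/-- The Besov norm is lower semicontinuous for coefficientwise convergence. -/
theorem lowerSemicontinuous_bnorm (s : ℝ) : LowerSemicontinuous (bnorm P s) := by
  refine lowerSemicontinuous_iSup fun m => ?_
  have h : (fun a : Freq → ℂ => ENNReal.ofReal ((2 : ℝ) ^ (((m : ℝ) - 1) * s)) * bsup P m a) =
      fun a => ⨆ x, ENNReal.ofReal ((2 : ℝ) ^ (((m : ℝ) - 1) * s)) *
        ‖(2 * Real.pi : ℂ)⁻¹ * synth (blkC P m a) x‖ₑ := by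
    ext a
    unfold bsup
    rw [ENNReal.mul_iSup]
  rw [h]
  refine lowerSemicontinuous_iSup fun x => Continuous.lowerSemicontinuous ?_
  refine (ENNReal.continuous_const_mul ENNReal.ofReal_ne_top).comp (continuous_enorm.comp ?_)
  refine continuous_const.mul ?_
  have h2 : (fun a : Freq → ℂ => synth (blkC P m a) x) =
      fun a => ∑ l ∈ (symbol_finite P m).toFinset, blkC P m a l * expFn l x := by
    ext a
    refine synth_eq_sum (fun l hl => ?_) x
    have : symbol P m (latticePoint l) = 0 := by simpa using hl
    simp [blkC, this]
  rw [h2]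
  unfold blkC
  fun_prop

theorem measurable_bnorm (s : ℝ) : Measurable (bnorm P s) :=
  (lowerSemicontinuous_bnorm P s).measurable

end

section

variable (P : DyadicPartition)

theorem bsup_le_sum (m : ℕ) (a : Freq → ℂ) :
    bsup P m a ≤ ‖(2 * Real.pi : ℂ)⁻¹‖ₑ * ∑ l ∈ (symbol_finite P m).toFinset, ‖blkC P m a l‖ₑ := by
  rw [bsup_eq]
  gcongr
  refine iSup_le fun x => ?_
  rw [synth_eq_sum (s := (symbol_finite P m).toFinset) (fun l hl => by
    have : symbol P m (latticePoint l) = 0 := by simpa using hl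
    simp [blkC, this])]
  refine (enorm_sum_le _ _).trans (Finset.sum_le_sum fun l _ => ?_)
  rw [enorm_mul]
  have : ‖expFn l x‖ₑ = 1 := by rw [← ofReal_norm, norm_expFn, ENNReal.ofReal_one]
  rw [this, mul_one]

/-- Coefficientwise convergence together with boundedness in a Besov space implies convergence in
every Besov space of lower regularity. -/
theorem tendsto_bnorm_zero {ι : Type*} {F : Filter ι} {u : ι → Freq → ℂ} (s : ℝ) {η : ℝ}
    (hη : 0 < η) {M : ℝ≥0∞} (hM : M ≠ ⊤) (hu : ∀ᶠ i in F, bnorm P (s + η) (u i) ≤ M)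
    (hc : ∀ l, Tendsto (fun i => u i l) F (𝓝 0)) : Tendsto (fun i => bnorm P s (u i)) F (𝓝 0) := by
  have hb : ∀ m, Tendsto (fun i => bsup P m (u i)) F (𝓝 0) := by
    intro m
    have h1 : Tendsto (fun i => ‖(2 * Real.pi : ℂ)⁻¹‖ₑ *
        ∑ l ∈ (symbol_finite P m).toFinset, ‖blkC P m (u i) l‖ₑ) F (𝓝 0) := by
      have h2 : Tendsto (fun i => ∑ l ∈ (symbol_finite P m).toFinset, ‖blkC P m (u i) l‖ₑ) F (𝓝 0) := by
        have h3 : (0 : ℝ≥0∞) = ∑ l ∈ (symbol_finite P m).toFinset, 0 := by simp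
        rw [h3]
        refine tendsto_finsetSum _ fun l _ => ?_
        have h4 := ((hc l).const_mul (symbol P m (latticePoint l) : ℂ)).enorm
        rw [mul_zero, enorm_zero] at h4
        exact h4
      have h4 := ENNReal.Tendsto.const_mul (a := ‖(2 * Real.pi : ℂ)⁻¹‖ₑ) h2 (Or.inr enorm_ne_top)
      rwa [mul_zero] at h4
    exact tendsto_of_tendsto_of_tendsto_of_le_of_le tendsto_const_nhds h1 (fun _ => zero_le)
      fun i => bsup_le_sum P m (u i)
  rw [ENNReal.tendsto_nhds_zero]
  intro ε hε
  have hε2 : 0 < ε / 2 := ENNReal.half_pos hε.ne'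
  obtain ⟨N, hN⟩ : ∃ N : ℕ, ENNReal.ofReal ((2 : ℝ) ^ (-(((N : ℝ) - 1) * η))) * M ≤ ε / 2 := by
    have h1 : Tendsto (fun N : ℕ => (2 : ℝ) ^ (-(((N : ℝ) - 1) * η))) atTop (𝓝 0) := by
      have h2 : Tendsto (fun N : ℕ => ((N : ℝ) - 1) * η) atTop atTop :=
        (tendsto_atTop_add_const_right _ (-1) tendsto_natCast_atTop_atTop).atTop_mul_const hη
      have h3 := (tendsto_rpow_atBot_of_base_gt_one (2 : ℝ) (by norm_num)).comp
        (tendsto_neg_atTop_atBot.comp h2)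
      exact h3
    have h2 := ENNReal.Tendsto.mul_const (b := M) (ENNReal.tendsto_ofReal h1) (Or.inr hM)
    rw [ENNReal.ofReal_zero, zero_mul] at h2
    exact ((ENNReal.tendsto_nhds_zero.1 h2) _ hε2).exists
  have hsum : Tendsto (fun i => ∑ m ∈ Finset.range N,
      ENNReal.ofReal ((2 : ℝ) ^ (((m : ℝ) - 1) * s)) * bsup P m (u i)) F (𝓝 0) := by
    have h3 : (0 : ℝ≥0∞) = ∑ m ∈ Finset.range N, 0 := by simp
    rw [h3]
    refine tendsto_finsetSum _ fun m _ => ?_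
    simpa using ENNReal.Tendsto.const_mul (hb m) (Or.inr ENNReal.ofReal_ne_top)
  filter_upwards [hu, ENNReal.tendsto_nhds_zero.1 hsum _ hε2] with i hi1 hi2
  calc bnorm P s (u i) ≤ _ := bnorm_le_sum_add P s hη.le N (u i)
    _ ≤ ε / 2 + ENNReal.ofReal ((2 : ℝ) ^ (-(((N : ℝ) - 1) * η))) * M := by gcongr
    _ ≤ ε / 2 + ε / 2 := by gcongr
    _ = ε := ENNReal.add_halves ε

/-- Low frequency truncations converge in every Besov space of lower regularity. -/
theorem tendsto_bnorm_sub_lowC (s : ℝ) {η : ℝ} (hη : 0 < η) {a : Freq → ℂ}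
    (ha : bnorm P (s + η) a < ⊤) :
    Tendsto (fun N => bnorm P s (a - lowC P (N + 1) a)) atTop (𝓝 0) := by
  obtain ⟨C, hC, H⟩ := exists_bnorm_lowC_le P
  refine tendsto_bnorm_zero P s hη (M := bnorm P (s + η) a + C * bnorm P (s + η) a)
    (ENNReal.add_ne_top.2 ⟨ha.ne, ENNReal.mul_ne_top hC ha.ne⟩)
    (Eventually.of_forall fun N => (bnorm_sub_le P _ _ _).trans (by gcongr; exact H _ _ _))
    fun l => ?_
  obtain ⟨m, hm⟩ := pow_unbounded_of_one_lt ‖latticePoint l‖ (one_lt_two)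
  refine tendsto_const_nhds.congr' ?_
  filter_upwards [eventually_ge_atTop m] with N hN
  rw [Pi.sub_apply, lowC_eq_self P hm (by omega), sub_self]

/-! ### The heat semigroup on Besov spaces -/

/-- The heat semigroup on coefficient sequences. -/
def heatC (t : ℝ) (a : Freq → ℂ) (l : Freq) : ℂ :=
  (Real.exp (-t * ‖latticePoint l‖ ^ 2) : ℂ) * a l

theorem blkC_heatC (m : ℕ) (t : ℝ) (a : Freq → ℂ) : blkC P m (heatC t a) = heatC t (blkC P m a) := by
  ext l; simp only [blkC, heatC]; ring

/-- The heat semigroup is bounded on each block, uniformly in time: `e^{-t|l|²}` is a dilate of the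
Gaussian. -/
theorem exists_bsup_heatC_le : ∃ C : ℝ≥0∞, C ≠ ⊤ ∧ ∀ (t : ℝ) (_ : 0 ≤ t) (m : ℕ) (a : Freq → ℂ),
    bsup P m (heatC t a) ≤ C * bsup P m a := by
  obtain ⟨C, hC, H⟩ := hasKernel_gaussian.exists_bound
  refine ⟨C, hC, fun t ht m a => ?_⟩
  have h := H (√t) _ (finite_support_blkC P m a)
  have h2 : heatC t (blkC P m a) =
      fun l => (Real.exp (-‖√t • latticePoint l‖ ^ 2) : ℂ) * blkC P m a l := by
    ext l
    rw [norm_smul, mul_pow, Real.norm_of_nonneg (Real.sqrt_nonneg t), Real.sq_sqrt ht, heatC,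
      neg_mul]
  rw [bsup_eq, bsup_eq, blkC_heatC, h2, mul_left_comm]
  gcongr

theorem exists_bnorm_heatC_le : ∃ C : ℝ≥0∞, C ≠ ⊤ ∧ ∀ (s t : ℝ) (_ : 0 ≤ t) (a : Freq → ℂ),
    bnorm P s (heatC t a) ≤ C * bnorm P s a := by
  obtain ⟨C, h, H⟩ := exists_bsup_heatC_le P
  refine ⟨C, h, fun s t ht a => (bnorm_le_iff P).2 fun m => ?_⟩
  calc _ ≤ ENNReal.ofReal ((2 : ℝ) ^ (((m : ℝ) - 1) * s)) * (C * bsup P m a) := by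
        gcongr; exact H t ht m a
    _ = C * (ENNReal.ofReal ((2 : ℝ) ^ (((m : ℝ) - 1) * s)) * bsup P m a) := by ring
    _ ≤ _ := by gcongr; exact weight_mul_bsup_le P s m a

/-- There is a symbol with integrable kernel that equals `|ξ|⁻²` on the annulus `1 ≤ |ξ| ≤ 4`, which
contains the support of `ρ`. -/
theorem exists_inv_sq_symbol : ∃ θ : Plane → ℂ, HasKernel θ ∧
    ∀ ξ : Plane, 1 ≤ ‖ξ‖ → ‖ξ‖ ≤ 4 → θ ξ * ‖ξ‖ ^ 2 = 1 := by
  let b₁ : ContDiffBump (0 : Plane) := ⟨4, 5, by norm_num, by norm_num⟩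
  let b₂ : ContDiffBump (0 : Plane) := ⟨1 / 4, 1 / 2, by norm_num, by norm_num⟩
  let η : Plane → ℝ := fun ξ => b₁ ξ - b₂ ξ
  have hη0 : ∀ ξ : Plane, ‖ξ‖ < 1 / 4 → η ξ = 0 := by
    intro ξ hξ
    have h1 : b₁ ξ = 1 := b₁.one_of_mem_closedBall (by
      rw [mem_closedBall_zero_iff]; change ‖ξ‖ ≤ 4; linarith)
    have h2 : b₂ ξ = 1 := b₂.one_of_mem_closedBall (by
      rw [mem_closedBall_zero_iff]; change ‖ξ‖ ≤ 1 / 4; linarith)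
    simp [η, h1, h2]
  let θ : Plane → ℝ := fun ξ => η ξ * (‖ξ‖ ^ 2)⁻¹
  have hηs : ContDiff ℝ ∞ η := b₁.contDiff.sub b₂.contDiff
  have hθs : ContDiff ℝ ∞ θ := by
    rw [contDiff_iff_contDiffAt]
    intro ξ
    by_cases h0 : ξ = 0
    · have : θ =ᶠ[𝓝 ξ] fun _ => 0 := by
        rw [h0]
        filter_upwards [Metric.ball_mem_nhds (0 : Plane) (show (0 : ℝ) < 1 / 4 by norm_num)] with y hy
        rw [mem_ball_zero_iff] at hy
        simp [θ, hη0 y hy]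
      exact contDiffAt_const.congr_of_eventuallyEq this
    · refine hηs.contDiffAt.mul (ContDiffAt.inv (contDiff_norm_sq ℝ).contDiffAt ?_)
      simpa using h0
  have hηc : HasCompactSupport η := by
    refine HasCompactSupport.intro (isCompact_closedBall (0 : Plane) 5) fun ξ hξ => ?_
    rw [mem_closedBall_zero_iff, not_le] at hξ
    have h1 : b₁ ξ = 0 := b₁.zero_of_le_dist (by rw [dist_zero_right]; exact hξ.le)
    have h2 : b₂ ξ = 0 := b₂.zero_of_le_dist (by
      rw [dist_zero_right]; change 1 / 2 ≤ ‖ξ‖; linarith)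
    simp [η, h1, h2]
  have hθc : HasCompactSupport θ := hηc.mul_right
  refine ⟨fun ξ => (θ ξ : ℂ), hasKernel_of_hasCompactSupport
    (hθc.comp_left (g := fun r : ℝ => (r : ℂ)) Complex.ofReal_zero)
    (Complex.ofRealCLM.contDiff.comp hθs), fun ξ h1 h4 => ?_⟩
  have e1 : b₁ ξ = 1 := b₁.one_of_mem_closedBall (by rw [mem_closedBall_zero_iff]; exact h4)
  have e2 : b₂ ξ = 0 := b₂.zero_of_le_dist (by
    rw [dist_zero_right]; change 1 / 2 ≤ ‖ξ‖; linarith)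
  have e3 : ‖ξ‖ ^ 2 ≠ 0 := by positivity
  have : θ ξ * ‖ξ‖ ^ 2 = 1 := by
    simp only [θ, η, e1, e2, sub_zero, one_mul]
    exact inv_mul_cancel₀ e3
  change (θ ξ : ℂ) * (‖ξ‖ : ℂ) ^ 2 = 1
  exact_mod_cast this

/-- On the block of frequencies of size `2^j` the heat semigroup gains the factor `1 / (t 4^j)`. The
symbol `e^{-t|l|²}` is the product of a dilate of `|ξ|² e^{-|ξ|²}`, of `(t 4^j)⁻¹`, and of a dilate
of the function that replaces `|ξ|⁻²` on the annulus carrying the block. -/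
theorem exists_bsup_heatC_succ_le : ∃ C : ℝ≥0∞, C ≠ ⊤ ∧
    ∀ (t : ℝ) (_ : 0 < t) (j : ℕ) (a : Freq → ℂ),
    bsup P (j + 1) (heatC t a) ≤ C * ENNReal.ofReal (t * 4 ^ j)⁻¹ * bsup P (j + 1) a := by
  obtain ⟨θ, hθ, hθ1⟩ := exists_inv_sq_symbol
  obtain ⟨C₁, hC₁, H₁⟩ := hasKernel_sq_mul_gaussian.exists_bound
  obtain ⟨C₂, hC₂, H₂⟩ := hθ.exists_bound
  refine ⟨C₁ * C₂, ENNReal.mul_ne_top hC₁ hC₂, fun t ht j a => ?_⟩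
  have hfin := finite_support_blkC P (j + 1) a
  have h2 := H₂ ((2 : ℝ) ^ j)⁻¹ _ hfin
  have h1 := H₁ (√t) (fun l => θ (((2 : ℝ) ^ j)⁻¹ • latticePoint l) * blkC P (j + 1) a l)
    (hfin.subset fun l hl h => hl (by simp [h]))
  -- on the support of the block, `1 = θ(ξ)|ξ|²` with `ξ = 2^{-j} l`
  have h3 : heatC t (blkC P (j + 1) a) = (((t * 4 ^ j)⁻¹ : ℝ) : ℂ) • fun l =>
      ((‖√t • latticePoint l‖ ^ 2 * Real.exp (-‖√t • latticePoint l‖ ^ 2) : ℝ) : ℂ) *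
      (θ (((2 : ℝ) ^ j)⁻¹ • latticePoint l) * blkC P (j + 1) a l) := by
    ext l
    rw [Pi.smul_apply]
    by_cases h0 : symbol P (j + 1) (latticePoint l) = 0
    · simp [heatC, blkC, h0]
    obtain ⟨k1, k2⟩ := mem_annulus_of_symbol_ne_zero P h0
    have k3 := hθ1 _ k1 k2
    have k4 : ((‖((2 : ℝ) ^ j)⁻¹ • latticePoint l‖ : ℝ) : ℂ) ^ 2 =
        (4 ^ j : ℂ)⁻¹ * (‖latticePoint l‖ : ℂ) ^ 2 := by
      rw [norm_smul, norm_inv, norm_pow, Real.norm_ofNat]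
      push_cast
      rw [mul_pow, inv_pow, ← pow_mul, mul_comm j 2, pow_mul]
      norm_num
    rw [k4] at k3
    have k5 : ‖√t • latticePoint l‖ ^ 2 = t * ‖latticePoint l‖ ^ 2 := by
      rw [norm_smul, mul_pow, Real.norm_of_nonneg (Real.sqrt_nonneg t), Real.sq_sqrt ht.le]
    rw [k5, heatC, smul_eq_mul, neg_mul]
    have ht' : (t : ℂ) ≠ 0 := by exact_mod_cast ht.ne'
    push_cast
    rw [mul_inv]
    calc _ = Complex.exp (-(t * ‖latticePoint l‖ ^ 2)) * (θ (((2 : ℝ) ^ j)⁻¹ • latticePoint l) *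
          ((4 ^ j : ℂ)⁻¹ * (‖latticePoint l‖ : ℂ) ^ 2)) * blkC P (j + 1) a l := by rw [k3, mul_one]
      _ = ((t : ℂ)⁻¹ * t) * (Complex.exp (-(t * ‖latticePoint l‖ ^ 2)) *
          (θ (((2 : ℝ) ^ j)⁻¹ • latticePoint l) *
          ((4 ^ j : ℂ)⁻¹ * (‖latticePoint l‖ : ℂ) ^ 2)) * blkC P (j + 1) a l) := by
          rw [inv_mul_cancel₀ ht', one_mul]
      _ = _ := by ring
  have h4 : ‖(((t * 4 ^ j)⁻¹ : ℝ) : ℂ)‖ₑ = ENNReal.ofReal (t * 4 ^ j)⁻¹ := by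
    rw [← ofReal_norm, Complex.norm_real, Real.norm_of_nonneg (by positivity)]
  rw [bsup_eq, bsup_eq, blkC_heatC, h3, trigNorm_smul, h4]
  calc _ ≤ ‖(2 * Real.pi : ℂ)⁻¹‖ₑ * (ENNReal.ofReal (t * 4 ^ j)⁻¹ *
        (C₁ * (C₂ * trigNorm (blkC P (j + 1) a)))) := by gcongr; exact h1.trans (by gcongr)
    _ = _ := by ring

/-- The smoothing estimate for the heat semigroup on Besov spaces, by interpolation on each block
between boundedness and the gain of two derivatives. -/
theorem exists_bnorm_heatC_smoothing : ∃ C : ℝ≥0∞, C ≠ ⊤ ∧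
    ∀ (s σ t : ℝ) (_ : 0 ≤ σ) (_ : σ ≤ 2) (_ : 0 < t) (_ : t ≤ 1) (a : Freq → ℂ),
    bnorm P (s + σ) (heatC t a) ≤ C * ENNReal.ofReal (t ^ (-(σ / 2))) * bnorm P s a := by
  obtain ⟨C₁, hC₁, H₁⟩ := exists_bsup_heatC_le P
  obtain ⟨C₂, hC₂, H₂⟩ := exists_bsup_heatC_succ_le P
  refine ⟨C₁ + C₂, ENNReal.add_ne_top.2 ⟨hC₁, hC₂⟩, fun s σ t hσ hσ2 ht ht1 a =>
    (bnorm_le_iff P).2 fun m => ?_⟩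
  -- it suffices to gain the factor `2^{-(m-1)σ} t^{-σ/2}` on each block
  suffices h : ENNReal.ofReal ((2 : ℝ) ^ (((m : ℝ) - 1) * σ)) * bsup P m (heatC t a) ≤
      (C₁ + C₂) * ENNReal.ofReal (t ^ (-(σ / 2))) * bsup P m a by
    calc _ = ENNReal.ofReal ((2 : ℝ) ^ (((m : ℝ) - 1) * s)) *
          (ENNReal.ofReal ((2 : ℝ) ^ (((m : ℝ) - 1) * σ)) * bsup P m (heatC t a)) := by
          rw [← mul_assoc, ← ENNReal.ofReal_mul (by positivity), ← Real.rpow_add (by norm_num),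
            mul_add]
      _ ≤ ENNReal.ofReal ((2 : ℝ) ^ (((m : ℝ) - 1) * s)) *
          ((C₁ + C₂) * ENNReal.ofReal (t ^ (-(σ / 2))) * bsup P m a) := by gcongr
      _ = (C₁ + C₂) * ENNReal.ofReal (t ^ (-(σ / 2))) *
          (ENNReal.ofReal ((2 : ℝ) ^ (((m : ℝ) - 1) * s)) * bsup P m a) := by ring
      _ ≤ _ := by gcongr; exact weight_mul_bsup_le P s m a
  have ht2 : (1 : ℝ) ≤ t ^ (-(σ / 2)) :=
    Real.one_le_rpow_of_pos_of_le_one_of_nonpos ht ht1 (by linarith)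
  cases m with
  | zero =>
    have h1 : (2 : ℝ) ^ ((((0 : ℕ) : ℝ) - 1) * σ) ≤ t ^ (-(σ / 2)) := by
      refine le_trans (Real.rpow_le_one_of_one_le_of_nonpos (by norm_num) ?_) ht2
      simp; exact hσ
    calc _ ≤ ENNReal.ofReal (t ^ (-(σ / 2))) * (C₁ * bsup P 0 a) := by
          gcongr; exact H₁ t ht.le 0 a
      _ = C₁ * ENNReal.ofReal (t ^ (-(σ / 2))) * bsup P 0 a := by ring
      _ ≤ _ := by gcongr; exact le_self_add
  | succ j =>
    have e1 : (2 : ℝ) ^ (((j + 1 : ℕ) : ℝ) - 1) = 2 ^ j := by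
      push_cast; rw [add_sub_cancel_right, Real.rpow_natCast]
    have e2 : (2 : ℝ) ^ ((((j + 1 : ℕ) : ℝ) - 1) * σ) = (t * 4 ^ j) ^ (σ / 2) * t ^ (-(σ / 2)) := by
      rw [Real.mul_rpow ht.le (by positivity), mul_right_comm, ← Real.rpow_add ht]
      rw [show (4 : ℝ) = 2 ^ (2 : ℕ) by norm_num, ← pow_mul, ← Real.rpow_natCast,
        ← Real.rpow_mul (by norm_num)]
      simp only [add_neg_cancel, Real.rpow_zero, one_mul]
      congr 1
      push_cast
      ring
    set y := t * 4 ^ j with hy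
    have hy0 : 0 < y := by positivity
    rw [e2, ENNReal.ofReal_mul (by positivity)]
    rcases le_total y 1 with hy1 | hy1
    · have h1 : y ^ (σ / 2) ≤ 1 := Real.rpow_le_one hy0.le hy1 (by linarith)
      calc _ ≤ ENNReal.ofReal 1 * ENNReal.ofReal (t ^ (-(σ / 2))) * (C₁ * bsup P (j + 1) a) := by
            gcongr; exact H₁ t ht.le _ a
        _ = C₁ * ENNReal.ofReal (t ^ (-(σ / 2))) * bsup P (j + 1) a := by
            rw [ENNReal.ofReal_one]; ring
        _ ≤ _ := by gcongr; exact le_self_add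
    · have h1 : y ^ (σ / 2) * y⁻¹ ≤ 1 := by
        rw [← Real.rpow_neg_one, ← Real.rpow_add hy0]
        exact Real.rpow_le_one_of_one_le_of_nonpos hy1 (by linarith)
      calc _ ≤ ENNReal.ofReal (y ^ (σ / 2)) * ENNReal.ofReal (t ^ (-(σ / 2))) *
            (C₂ * ENNReal.ofReal y⁻¹ * bsup P (j + 1) a) := by
            gcongr; exact H₂ t ht _ a
        _ = C₂ * ENNReal.ofReal (t ^ (-(σ / 2))) * bsup P (j + 1) a *
            ENNReal.ofReal (y ^ (σ / 2) * y⁻¹) := by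
            rw [ENNReal.ofReal_mul (by positivity)]; ring
        _ ≤ C₂ * ENNReal.ofReal (t ^ (-(σ / 2))) * bsup P (j + 1) a * ENNReal.ofReal 1 := by gcongr
        _ = C₂ * ENNReal.ofReal (t ^ (-(σ / 2))) * bsup P (j + 1) a := by
            rw [ENNReal.ofReal_one, mul_one]
        _ ≤ _ := by gcongr; exact le_add_self

end

section

variable (P : DyadicPartition)

/-! ### Products of distributions -/

/-- The Fourier coefficients of the product `Δ_m f Δ_n g`. -/
def pcoef (m n : ℕ) (a b : Freq → ℂ) (l : Freq) : ℂ :=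
  (2 * Real.pi : ℂ)⁻¹ * ∑ j ∈ (symbol_finite P m).toFinset, blkC P m a j * blkC P n b (l - j)

theorem blkC_eq_zero_of_notMem {m : ℕ} {j : Freq} (h : j ∉ (symbol_finite P m).toFinset)
    (a : Freq → ℂ) : blkC P m a j = 0 := by
  have : symbol P m (latticePoint j) = 0 := by simpa using h
  simp [blkC, this]

theorem pcoef_eq_tsum (m n : ℕ) (a b : Freq → ℂ) (l : Freq) :
    pcoef P m n a b l = (2 * Real.pi : ℂ)⁻¹ * ∑' j, blkC P m a j * blkC P n b (l - j) := by
  rw [pcoef, tsum_eq_sum fun j hj => by rw [blkC_eq_zero_of_notMem P hj, zero_mul]]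

theorem pcoef_comm (m n : ℕ) (a b : Freq → ℂ) : pcoef P m n a b = pcoef P n m b a := by
  ext l
  rw [pcoef_eq_tsum, pcoef_eq_tsum, ← (Equiv.subLeft l).tsum_eq]
  simp [mul_comm]

theorem pcoef_add_left (m n : ℕ) (a a' b : Freq → ℂ) :
    pcoef P m n (a + a') b = pcoef P m n a b + pcoef P m n a' b := by
  ext l
  simp only [pcoef, Pi.add_apply, blkC, mul_add, add_mul, Finset.sum_add_distrib]

theorem pcoef_smul_left (m n : ℕ) (z : ℂ) (a b : Freq → ℂ) :
    pcoef P m n (z • a) b = z • pcoef P m n a b := by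
  ext l
  simp only [pcoef, Pi.smul_apply, blkC, smul_eq_mul]
  rw [mul_left_comm z, Finset.mul_sum _ _ z]
  congr 1
  exact Finset.sum_congr rfl fun j _ => by ring

theorem finite_support_pcoef (m n : ℕ) (a b : Freq → ℂ) : (pcoef P m n a b).support.Finite := by
  refine (((symbol_finite P m).add (symbol_finite P n))).subset fun l hl => ?_
  obtain ⟨j, hj, hne⟩ := Finset.exists_ne_zero_of_sum_ne_zero (right_ne_zero_of_mul hl)
  refine Set.mem_add.2 ⟨j, by simpa using hj, l - j, ?_, by abel⟩
  intro h0
  exact right_ne_zero_of_mul hne (by simp [blkC, h0])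

theorem synth_pcoef (m n : ℕ) (a b : Freq → ℂ) (x : Plane) :
    synth (pcoef P m n a b) x =
      (2 * Real.pi : ℂ)⁻¹ * (synth (blkC P m a) x * synth (blkC P n b) x) := by
  have hs : ∀ j, HasSum (fun l => blkC P n b (l - j) * expFn (l - j) x) (synth (blkC P n b) x) := by
    intro j
    have h1 : Summable fun l => blkC P n b l * expFn l x :=
      summable_of_hasFiniteSupport ((finite_support_blkC P n b).subset fun l hl h => hl (by simp [h]))
    exact (Equiv.subRight j).hasSum_iff.2 h1.hasSum
  have h2 : HasSum (fun l => ∑ j ∈ (symbol_finite P m).toFinset,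
      (blkC P m a j * expFn j x) * (blkC P n b (l - j) * expFn (l - j) x))
      (∑ j ∈ (symbol_finite P m).toFinset, (blkC P m a j * expFn j x) * synth (blkC P n b) x) :=
    hasSum_sum fun j _ => (hs j).mul_left _
  have h3 := h2.mul_left (2 * Real.pi : ℂ)⁻¹
  rw [← Finset.sum_mul, ← synth_eq_sum (fun l hl => blkC_eq_zero_of_notMem P hl a)] at h3
  rw [← h3.tsum_eq]
  refine tsum_congr fun l => ?_
  rw [pcoef, mul_assoc, Finset.sum_mul]
  congr 1
  refine Finset.sum_congr rfl fun j _ => ?_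
  have : expFn l x = expFn j x * expFn (l - j) x := by rw [← expFn_add]; congr 1; abel
  rw [this]
  ring

theorem trigNorm_pcoef_le (m n : ℕ) (a b : Freq → ℂ) :
    trigNorm (pcoef P m n a b) ≤ ENNReal.ofReal (2 * Real.pi) * (bsup P m a * bsup P n b) := by
  have h2pi : ‖(2 * Real.pi : ℂ)‖ₑ = ENNReal.ofReal (2 * Real.pi) := by
    rw [← ofReal_norm]; congr 1; simp [abs_of_pos Real.pi_pos]
  have hpi : (2 * Real.pi : ℂ) ≠ 0 := by simp
  refine iSup_le fun x => ?_
  have h : synth (pcoef P m n a b) x = (2 * Real.pi : ℂ) *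
      (((2 * Real.pi : ℂ)⁻¹ * synth (blkC P m a) x) * ((2 * Real.pi : ℂ)⁻¹ * synth (blkC P n b) x)) := by
    rw [synth_pcoef]
    field_simp
  rw [h, enorm_mul, h2pi, enorm_mul]
  gcongr
  · exact le_iSup (fun x => ‖(2 * Real.pi : ℂ)⁻¹ * synth (blkC P m a) x‖ₑ) x
  · exact le_iSup (fun x => ‖(2 * Real.pi : ℂ)⁻¹ * synth (blkC P n b) x‖ₑ) x

/-- The spectral support property behind the product estimate: if `n` is large compared to `m`,
then `Δ_m f Δ_n g` only has frequencies of size comparable to `2^n`. -/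
theorem pcoef_eq_zero {m n k : ℕ} {l : Freq} (hl : ‖latticePoint l‖ ≤ 4 * 2 ^ k) (hk : k + 5 ≤ n)
    (hm : m + 4 ≤ n) (a b : Freq → ℂ) : pcoef P m n a b l = 0 := by
  rw [pcoef]
  refine mul_eq_zero_of_right _ (Finset.sum_eq_zero fun j _ => ?_)
  by_contra hne
  have h1 : symbol P m (latticePoint j) ≠ 0 := fun h => hne (by simp [blkC, h])
  have h2 : symbol P n (latticePoint (l - j)) ≠ 0 := fun h => hne (by simp [blkC, h])
  obtain ⟨i, rfl⟩ : ∃ i, n = i + 1 := ⟨n - 1, by omega⟩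
  have h3 := norm_le_of_symbol_ne_zero P h1
  have h4 := le_norm_of_symbol_ne_zero P h2
  rw [latticePoint_sub] at h4
  have h5 := norm_sub_le (latticePoint l) (latticePoint j)
  obtain ⟨d, rfl⟩ : ∃ d, i = d + 4 := ⟨i - 4, by omega⟩
  have h6 : (2 : ℝ) ^ k ≤ 2 ^ d := pow_le_pow_right₀ (by norm_num) (by omega)
  have h7 : (2 : ℝ) ^ m ≤ 2 ^ (d + 1) := pow_le_pow_right₀ (by norm_num) (by omega)
  have h8 : (0 : ℝ) < 2 ^ d := by positivity
  rw [pow_succ] at h7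
  rw [pow_add] at h4
  norm_num at h4
  linarith

/-- The weights of the double series defining the product: up to a constant, `pweight β ε k (m, n)` bounds
`Δ_m f Δ_n g` at frequencies of size up to `4 * 2 ^ k`, for `f` and `g` of norm one in `B^β` and
`B^{-ε}`. It vanishes where the term has no such frequencies. -/
def pweight (β ε : ℝ) (k : ℕ) (p : ℕ × ℕ) : ℝ≥0∞ :=
  if p.2 < k + 5 ∨ p.2 < p.1 + 4 then
    ENNReal.ofReal ((2 : ℝ) ^ (-(((p.1 : ℝ) - 1) * β)) * (2 : ℝ) ^ (((p.2 : ℝ) - 1) * ε)) else 0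

/-- The sum of the weights grows like `2^{kε}`: the terms with `n < k + 5` contribute `∑ 2^{nε}`, and
in those with `n < m + 4` the factor `2^{-mβ}` wins over `2^{nε}`, because `ε < β`. -/
theorem exists_tsum_pweight_le {β ε : ℝ} (hε : 0 < ε) (hβ : ε < β) :
    ∃ C : ℝ, 0 ≤ C ∧ ∀ k : ℕ, ∑' p, pweight β ε k p ≤ ENNReal.ofReal (C * 2 ^ (k * ε)) := by
  set κ := (β - ε) / 2 with hκ
  have hκ0 : 0 < κ := by rw [hκ]; linarith
  set q : ℝ := 2 ^ (-κ) with hq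
  have hq0 : 0 < q := by positivity
  have hq1 : q < 1 := Real.rpow_lt_one_of_one_lt_of_neg (by norm_num) (by linarith)
  have hqn : ∀ n : ℕ, (2 : ℝ) ^ (-(n * κ)) = q ^ n := fun n => by
    rw [hq, ← Real.rpow_natCast, ← Real.rpow_mul (by norm_num)]; congr 1; ring
  set r : ℝ := 2 ^ ε with hr
  have hr1 : 1 < r := Real.one_lt_rpow (by norm_num) hε
  have hrn : ∀ n : ℕ, (2 : ℝ) ^ (n * ε) = r ^ n := fun n => by
    rw [hr, ← Real.rpow_natCast, ← Real.rpow_mul (by norm_num)]; congr 1; ring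
  obtain ⟨c, hc⟩ : ∃ c : ℝ, c = 2 ^ (β - ε) * 2 ^ (3 * (ε + κ)) := ⟨_, rfl⟩
  have hc0 : 0 < c := by rw [hc]; positivity
  set w : ℕ → ℕ → ℝ≥0∞ := fun k n =>
    ENNReal.ofReal (q ^ n) + if n < k + 5 then ENNReal.ofReal (r ^ n) else 0 with hw
  have hpt : ∀ k p, pweight β ε k p ≤
      ENNReal.ofReal c * (ENNReal.ofReal (q ^ p.1) * w k p.2) := by
    rintro k ⟨m, n⟩
    unfold pweight
    dsimp only
    split_ifs with h
    · have e0 : (2 : ℝ) ^ (-(((m : ℝ) - 1) * β)) * (2 : ℝ) ^ (((n : ℝ) - 1) * ε) =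
          2 ^ (β - ε) * (2 ^ (-(m * β) + n * ε)) := by
        rw [← Real.rpow_add (by norm_num), ← Real.rpow_add (by norm_num)]
        congr 1; ring
      have hm0 : (0 : ℝ) ≤ m := Nat.cast_nonneg m
      rw [e0]
      by_cases h1 : n < k + 5
      · calc _ ≤ ENNReal.ofReal (c * (q ^ m * r ^ n)) := by
              apply ENNReal.ofReal_le_ofReal
              rw [hc, mul_assoc]
              refine mul_le_mul_of_nonneg_left ?_ (Real.rpow_nonneg zero_le_two _)
              rw [← hqn, ← hrn, ← Real.rpow_add (by norm_num), ← Real.rpow_add (by norm_num)]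
              refine Real.rpow_le_rpow_of_exponent_le (by norm_num) ?_
              nlinarith
          _ = ENNReal.ofReal c * (ENNReal.ofReal (q ^ m) * ENNReal.ofReal (r ^ n)) := by
              rw [ENNReal.ofReal_mul hc0.le, ENNReal.ofReal_mul (by positivity)]
          _ ≤ _ := by
              gcongr
              simp only [hw, if_pos h1]
              exact le_add_self
      · have h2 : n < m + 4 := h.resolve_left h1
        calc _ ≤ ENNReal.ofReal (c * (q ^ m * q ^ n)) := by
              apply ENNReal.ofReal_le_ofReal
              rw [hc, mul_assoc]
              refine mul_le_mul_of_nonneg_left ?_ (Real.rpow_nonneg zero_le_two _)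
              rw [← hqn, ← hqn, ← Real.rpow_add (by norm_num), ← Real.rpow_add (by norm_num)]
              refine Real.rpow_le_rpow_of_exponent_le (by norm_num) ?_
              have h3 : (n : ℝ) ≤ m + 3 := by exact_mod_cast (by omega : n ≤ m + 3)
              have h4 : β = ε + 2 * κ := by rw [hκ]; ring
              rw [h4]
              nlinarith
          _ = ENNReal.ofReal c * (ENNReal.ofReal (q ^ m) * ENNReal.ofReal (q ^ n)) := by
              rw [ENNReal.ofReal_mul hc0.le, ENNReal.ofReal_mul (by positivity)]
          _ ≤ _ := by
              gcongr
              simp only [hw]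
              exact le_self_add
    · exact zero_le
  have hgeo : ∑' n : ℕ, ENNReal.ofReal (q ^ n) = ENNReal.ofReal (1 - q)⁻¹ := by
    rw [← ENNReal.ofReal_tsum_of_nonneg (fun n => by positivity)
      (summable_geometric_of_lt_one hq0.le hq1), tsum_geometric_of_lt_one hq0.le hq1]
  have hq2 : 0 < 1 - q := by linarith
  have hr2 : 0 < r - 1 := by linarith
  have hS : ∀ k : ℕ, ∑' n : ℕ, (if n < k + 5 then ENNReal.ofReal (r ^ n) else 0) ≤
      ENNReal.ofReal (r ^ 5 / (r - 1) * r ^ k) := by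
    intro k
    rw [tsum_eq_sum (s := Finset.range (k + 5)) (fun n hn => if_neg (by simpa using hn))]
    rw [Finset.sum_congr rfl (fun n hn => if_pos (Finset.mem_range.1 hn)),
      ← ENNReal.ofReal_sum_of_nonneg (fun n _ => by positivity), geom_sum_eq hr1.ne']
    apply ENNReal.ofReal_le_ofReal
    rw [div_mul_eq_mul_div, pow_add, mul_comm]
    gcongr
    linarith
  refine ⟨c * ((1 - q)⁻¹ * ((1 - q)⁻¹ + r ^ 5 / (r - 1))), by positivity, fun k => ?_⟩
  have hrk : 1 ≤ r ^ k := one_le_pow₀ hr1.le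
  calc ∑' p, pweight β ε k p ≤ ∑' p : ℕ × ℕ, ENNReal.ofReal c * (ENNReal.ofReal (q ^ p.1) * w k p.2) :=
        ENNReal.tsum_le_tsum (hpt k)
    _ = ENNReal.ofReal c * (ENNReal.ofReal (1 - q)⁻¹ * ∑' n, w k n) := by
        rw [ENNReal.tsum_mul_left, ENNReal.tsum_prod']
        simp_rw [ENNReal.tsum_mul_left]
        rw [ENNReal.tsum_mul_right, hgeo]
    _ ≤ ENNReal.ofReal c * (ENNReal.ofReal (1 - q)⁻¹ * (ENNReal.ofReal (1 - q)⁻¹ +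
        ENNReal.ofReal (r ^ 5 / (r - 1) * r ^ k))) := by
        gcongr
        simp only [hw]
        rw [ENNReal.tsum_add, hgeo]
        gcongr
        exact hS k
    _ = ENNReal.ofReal (c * ((1 - q)⁻¹ * ((1 - q)⁻¹ + r ^ 5 / (r - 1) * r ^ k))) := by
        rw [← ENNReal.ofReal_add (by positivity) (by positivity),
          ← ENNReal.ofReal_mul (by positivity), ← ENNReal.ofReal_mul (by positivity)]
    _ ≤ _ := by
        apply ENNReal.ofReal_le_ofReal
        rw [hrn, mul_assoc, mul_assoc]
        gcongr
        rw [add_mul]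
        gcongr
        exact le_mul_of_one_le_right (by positivity) hrk

/-- The Fourier coefficients of the product of two distributions. -/
def prodC (a b : Freq → ℂ) (l : Freq) : ℂ := ∑' p : ℕ × ℕ, pcoef P p.1 p.2 a b l

theorem bsup_mul_bsup_le (β ε : ℝ) (m n : ℕ) (a b : Freq → ℂ) :
    bsup P m a * bsup P n b ≤
      ENNReal.ofReal ((2 : ℝ) ^ (-(((m : ℝ) - 1) * β)) * (2 : ℝ) ^ (((n : ℝ) - 1) * ε)) *
        (bnorm P β a * bnorm P (-ε) b) := by
  have h1 := bsup_le P β m a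
  have h2 := bsup_le P (-ε) n b
  rw [mul_neg, neg_neg] at h2
  calc _ ≤ _ := mul_le_mul' h1 h2
    _ = _ := by rw [ENNReal.ofReal_mul (by positivity)]; ring

/-- Absolute convergence of the double series for each Fourier coefficient of a product. -/
theorem exists_tsum_enorm_pcoef_le {β ε : ℝ} (hε : 0 < ε) (hβ : ε < β) :
    ∃ C : ℝ, 0 ≤ C ∧ ∀ (a b : Freq → ℂ) (k : ℕ) (l : Freq), ‖latticePoint l‖ ≤ 4 * 2 ^ k →
      ∑' p : ℕ × ℕ, ‖pcoef P p.1 p.2 a b l‖ₑ ≤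
        ENNReal.ofReal (C * 2 ^ (k * ε)) * (bnorm P β a * bnorm P (-ε) b) := by
  obtain ⟨C, hC, H⟩ := exists_tsum_pweight_le hε hβ
  refine ⟨2 * Real.pi * C, by positivity, fun a b k l hl => ?_⟩
  calc ∑' p : ℕ × ℕ, ‖pcoef P p.1 p.2 a b l‖ₑ ≤ ∑' p : ℕ × ℕ, ENNReal.ofReal (2 * Real.pi) *
        (pweight β ε k p * (bnorm P β a * bnorm P (-ε) b)) := by
        refine ENNReal.tsum_le_tsum fun p => ?_
        unfold pweight
        split_ifs with h
        · refine (enorm_coef_le (finite_support_pcoef P _ _ a b) l).trans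
            ((trigNorm_pcoef_le P _ _ a b).trans ?_)
          exact mul_le_mul' le_rfl (bsup_mul_bsup_le P β ε p.1 p.2 a b)
        · push Not at h
          rw [pcoef_eq_zero P hl h.1 h.2]
          simp
    _ = ENNReal.ofReal (2 * Real.pi) * ((∑' p, pweight β ε k p) * (bnorm P β a * bnorm P (-ε) b)) := by
        rw [ENNReal.tsum_mul_left, ENNReal.tsum_mul_right]
    _ ≤ ENNReal.ofReal (2 * Real.pi) * (ENNReal.ofReal (C * 2 ^ (k * ε)) *
        (bnorm P β a * bnorm P (-ε) b)) := by gcongr; exact H k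
    _ = _ := by
        rw [← mul_assoc, ← ENNReal.ofReal_mul (by positivity), mul_assoc (2 * Real.pi)]

theorem exists_norm_le_four_mul_two_pow (l : Freq) : ∃ k : ℕ, ‖latticePoint l‖ ≤ 4 * 2 ^ k ∧
    (2 : ℝ) ^ k ≤ 1 + ‖latticePoint l‖ := by
  obtain ⟨k, hk1, hk2⟩ := exists_nat_pow_near (x := 1 + ‖latticePoint l‖)
    (by linarith [norm_nonneg (latticePoint l)]) (one_lt_two)
  refine ⟨k, ?_, hk1⟩
  rw [pow_succ] at hk2
  have : (0 : ℝ) < 2 ^ k := by positivity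
  linarith

theorem summable_pcoef {β ε : ℝ} (hε : 0 < ε) (hβ : ε < β) {a b : Freq → ℂ}
    (ha : bnorm P β a < ⊤) (hb : bnorm P (-ε) b < ⊤) (l : Freq) :
    Summable fun p : ℕ × ℕ => pcoef P p.1 p.2 a b l := by
  obtain ⟨C, hC, H⟩ := exists_tsum_enorm_pcoef_le P hε hβ
  obtain ⟨k, hk, -⟩ := exists_norm_le_four_mul_two_pow l
  have h := (H a b k l hk).trans_lt (ENNReal.mul_lt_top ENNReal.ofReal_lt_top
    (ENNReal.mul_lt_top ha hb))
  exact .of_enorm h.ne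

/-- The product estimate `B^β × B^{-ε} → B^{-ε}` for `0 < ε < β`. -/
theorem exists_bnorm_prodC_le {β ε : ℝ} (hε : 0 < ε) (hβ : ε < β) :
    ∃ C : ℝ≥0∞, C ≠ ⊤ ∧ ∀ (a b : Freq → ℂ), bnorm P β a < ⊤ → bnorm P (-ε) b < ⊤ →
      bnorm P (-ε) (prodC P a b) ≤ C * (bnorm P β a * bnorm P (-ε) b) := by
  obtain ⟨C, hC, H⟩ := exists_tsum_pweight_le hε hβ
  obtain ⟨CP, hCP, HP⟩ := exists_trigNorm_blkC_le P
  refine ⟨ENNReal.ofReal (2 ^ ε * C) * CP, ENNReal.mul_ne_top ENNReal.ofReal_ne_top hCP,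
    fun a b ha hb => (bnorm_le_iff P).2 fun k => ?_⟩
  have h2pi : ‖(2 * Real.pi : ℂ)⁻¹‖ₑ * ENNReal.ofReal (2 * Real.pi) = 1 := by
    have : ENNReal.ofReal (2 * Real.pi) = ‖(2 * Real.pi : ℂ)‖ₑ := by
      rw [← ofReal_norm]; congr 1; simp [abs_of_pos Real.pi_pos]
    rw [this, ← enorm_mul, inv_mul_cancel₀ (by simp), enorm_one]
  have hblk : bsup P k (prodC P a b) ≤
      CP * (ENNReal.ofReal (C * 2 ^ (k * ε)) * (bnorm P β a * bnorm P (-ε) b)) := by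
    have h1 : trigNorm (blkC P k (prodC P a b)) ≤
        ∑' p : ℕ × ℕ, trigNorm (blkC P k (pcoef P p.1 p.2 a b)) := by
      refine iSup_le fun x => ?_
      have h2 : HasSum (fun p : ℕ × ℕ => synth (blkC P k (pcoef P p.1 p.2 a b)) x)
          (synth (blkC P k (prodC P a b)) x) := by
        have h3 : ∀ c : Freq → ℂ, synth (blkC P k c) x =
            ∑ l ∈ (symbol_finite P k).toFinset, blkC P k c l * expFn l x := fun c =>
          synth_eq_sum (fun l hl => blkC_eq_zero_of_notMem P hl c) x
        simp_rw [h3]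
        refine hasSum_sum fun l _ => ?_
        exact ((summable_pcoef P hε hβ ha hb l).hasSum.mul_left _).mul_right _
      rw [← h2.tsum_eq]
      exact enorm_tsum_le_tsum_enorm.trans (ENNReal.tsum_le_tsum fun p => enorm_synth_le _ x)
    calc bsup P k (prodC P a b) ≤ ‖(2 * Real.pi : ℂ)⁻¹‖ₑ *
          ∑' p : ℕ × ℕ, trigNorm (blkC P k (pcoef P p.1 p.2 a b)) := by
          rw [bsup_eq]; gcongr
      _ ≤ ‖(2 * Real.pi : ℂ)⁻¹‖ₑ * ∑' p : ℕ × ℕ, CP * (ENNReal.ofReal (2 * Real.pi) *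
          (pweight β ε k p * (bnorm P β a * bnorm P (-ε) b))) := by
          gcongr with p
          unfold pweight
          split_ifs with h
          · refine (HP k _ (finite_support_pcoef P _ _ a b)).trans ?_
            gcongr
            refine (trigNorm_pcoef_le P _ _ a b).trans ?_
            exact mul_le_mul' le_rfl (bsup_mul_bsup_le P β ε p.1 p.2 a b)
          · push Not at h
            have h0 : blkC P k (pcoef P p.1 p.2 a b) = 0 := by
              ext l
              by_cases hs : symbol P k (latticePoint l) = 0
              · simp [blkC, hs]
              · simp [blkC, pcoef_eq_zero P (norm_le_of_symbol_ne_zero P hs) h.1 h.2]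
            rw [h0]
            have : trigNorm 0 = 0 := by
              have := trigNorm_smul 0 0
              simpa using this
            rw [this]
            exact zero_le
      _ = (‖(2 * Real.pi : ℂ)⁻¹‖ₑ * ENNReal.ofReal (2 * Real.pi)) * (CP *
          ((∑' p, pweight β ε k p) * (bnorm P β a * bnorm P (-ε) b))) := by
          rw [ENNReal.tsum_mul_left, ENNReal.tsum_mul_left, ENNReal.tsum_mul_right]
          ring
      _ ≤ _ := by
          rw [h2pi, one_mul]
          gcongr
          exact H k
  calc _ ≤ ENNReal.ofReal ((2 : ℝ) ^ (((k : ℝ) - 1) * -ε)) *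
        (CP * (ENNReal.ofReal (C * 2 ^ (k * ε)) * (bnorm P β a * bnorm P (-ε) b))) := by gcongr
    _ = ENNReal.ofReal ((2 : ℝ) ^ (((k : ℝ) - 1) * -ε) * (C * 2 ^ (k * ε))) * CP *
        (bnorm P β a * bnorm P (-ε) b) := by
        rw [ENNReal.ofReal_mul (p := (2 : ℝ) ^ (((k : ℝ) - 1) * -ε)) (by positivity)]; ac_rfl
    _ = _ := by
        congr 3
        rw [mul_left_comm, ← Real.rpow_add (by norm_num), mul_comm]
        congr 2
        ring

theorem prodC_comm (a b : Freq → ℂ) : prodC P a b = prodC P b a := by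
  ext l
  unfold prodC
  rw [← (Equiv.prodComm ℕ ℕ).tsum_eq]
  exact tsum_congr fun p => congrFun (pcoef_comm P _ _ a b) l

theorem prodC_smul_left (z : ℂ) (a b : Freq → ℂ) : prodC P (z • a) b = z • prodC P a b := by
  ext l
  unfold prodC
  simp_rw [pcoef_smul_left, Pi.smul_apply, smul_eq_mul]
  rw [tsum_mul_left]

theorem prodC_add_left {β ε : ℝ} (hε : 0 < ε) (hβ : ε < β) {a a' b : Freq → ℂ}
    (ha : bnorm P β a < ⊤) (ha' : bnorm P β a' < ⊤) (hb : bnorm P (-ε) b < ⊤) :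
    prodC P (a + a') b = prodC P a b + prodC P a' b := by
  ext l
  unfold prodC
  simp_rw [pcoef_add_left, Pi.add_apply]
  exact (summable_pcoef P hε hβ ha hb l).tsum_add (summable_pcoef P hε hβ ha' hb l)

theorem prodC_add_right {β ε : ℝ} (hε : 0 < ε) (hβ : ε < β) {a b b' : Freq → ℂ}
    (ha : bnorm P β a < ⊤) (hb : bnorm P (-ε) b < ⊤) (hb' : bnorm P (-ε) b' < ⊤) :
    prodC P a (b + b') = prodC P a b + prodC P a b' := by
  have h1 : ∀ (m n : ℕ), pcoef P m n a (b + b') = pcoef P m n a b + pcoef P m n a b' := fun m n => by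
    rw [pcoef_comm, pcoef_add_left, pcoef_comm, pcoef_comm P n m b' a]
  ext l
  unfold prodC
  simp_rw [h1, Pi.add_apply]
  exact (summable_pcoef P hε hβ ha hb l).tsum_add (summable_pcoef P hε hβ ha hb' l)

theorem prodC_smul_right (z : ℂ) (a b : Freq → ℂ) : prodC P a (z • b) = z • prodC P a b := by
  rw [prodC_comm, prodC_smul_left, prodC_comm]

end

section

variable (P : DyadicPartition)

theorem synth_sum {ι : Type*} (s : Finset ι) (c : ι → Freq → ℂ) (hc : ∀ i ∈ s, (c i).support.Finite)
    (x : Plane) : synth (fun l => ∑ i ∈ s, c i l) x = ∑ i ∈ s, synth (c i) x := by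
  unfold synth
  rw [← Summable.tsum_finsetSum]
  · simp_rw [Finset.sum_mul]
  · intro i hi
    exact summable_of_hasFiniteSupport ((hc i hi).subset fun l hl h => hl (by simp [h]))

theorem fnPair_synth {c : Freq → ℂ} (hc : c.support.Finite) (φ : TestFn) :
    fnPair (fun x => (2 * Real.pi : ℂ)⁻¹ * synth c x) (φ : Plane → ℂ) =
      (2 * Real.pi : ℂ)⁻¹ * ∑' l, c l * fnPair (expFn l) (φ : Plane → ℂ) := by
  rw [tsum_eq_sum (s := hc.toFinset) (fun l hl => by
    have : c l = 0 := by simpa using hl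
    rw [this, zero_mul])]
  unfold fnPair
  simp_rw [synth_eq_sum_toFinset hc, Finset.mul_sum, Finset.sum_mul]
  rw [integral_finsetSum, Finset.mul_sum]
  · refine Finset.sum_congr rfl fun l _ => ?_
    rw [← integral_const_mul, ← integral_const_mul, ← integral_const_mul, ← integral_const_mul]
    congr 1
    ext x
    ring
  · intro l _
    exact integrable_cell (by
      have h1 := continuous_expFn l
      have h2 := φ.2.1.continuous
      fun_prop)

/-- The product of distributions converges, in the sense of distributions, to the distribution
with Fourier coefficients `prodC`. -/
theorem tendsto_fnPair_lowPass {β ε : ℝ} (hε : 0 < ε) (hε1 : ε ≤ 1) (hβ : ε < β) {f g : Dist}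
    (hf : bnorm P β (fourierCoef f) < ⊤) (hg : bnorm P (-ε) (fourierCoef g) < ⊤) (φ : TestFn) :
    Tendsto (fun N => fnPair (fun x => lowPass P N f x * lowPass P N g x) (φ : Plane → ℂ)) atTop
      (𝓝 ((2 * Real.pi : ℂ)⁻¹ * ∑' l, prodC P (fourierCoef f) (fourierCoef g) l *
        fnPair (expFn l) (φ : Plane → ℂ))) := by
  set a := fourierCoef f with ha
  set b := fourierCoef g with hb
  let S : ℕ → Freq → ℂ := fun N l => ∑ p ∈ Finset.range N ×ˢ Finset.range N, pcoef P p.1 p.2 a b l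
  have hS : ∀ N, (S N).support.Finite := by
    intro N
    refine ((Finset.range N ×ˢ Finset.range N).finite_toSet.biUnion
      (fun p _ => finite_support_pcoef P p.1 p.2 a b)).subset fun l hl => ?_
    obtain ⟨p, hp, hne⟩ := Finset.exists_ne_zero_of_sum_ne_zero hl
    exact mem_biUnion (Finset.mem_coe.2 hp) hne
  have hprod : ∀ N x, lowPass P N f x * lowPass P N g x = (2 * Real.pi : ℂ)⁻¹ * synth (S N) x := by
    intro N x
    rw [synth_sum _ _ (fun p _ => finite_support_pcoef P p.1 p.2 a b), Finset.sum_product]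
    simp_rw [synth_pcoef]
    unfold lowPass
    rw [Finset.sum_mul_sum, Finset.mul_sum]
    refine Finset.sum_congr rfl fun m _ => ?_
    rw [Finset.mul_sum]
    refine Finset.sum_congr rfl fun n _ => ?_
    change (2 * Real.pi : ℂ)⁻¹ * synth (blkC P m a) x * ((2 * Real.pi : ℂ)⁻¹ * synth (blkC P n b) x) = _
    ring
  simp_rw [hprod, fnPair_synth (hS _)]
  refine Tendsto.const_mul _ ?_
  obtain ⟨C, hC, H⟩ := exists_tsum_enorm_pcoef_le P hε hβ
  have hAB : bnorm P β a * bnorm P (-ε) b < ⊤ := ENNReal.mul_lt_top hf hg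
  set D := (bnorm P β a * bnorm P (-ε) b).toReal with hD
  refine tendsto_tsum_of_dominated_convergence
    (bound := fun l => C * D * ((1 + ‖latticePoint l‖) ^ 1 * ‖fnPair (expFn l) (φ : Plane → ℂ)‖))
    ((summable_pow_mul_fnPair 1 φ).mul_left _) (fun l => ?_) (Eventually.of_forall fun N l => ?_)
  · refine Tendsto.mul_const _ ?_
    refine (summable_pcoef P hε hβ hf hg l).hasSum.comp ?_
    refine tendsto_atTop_finset_of_monotone (fun N M h => ?_) fun p => ?_
    · exact Finset.product_subset_product (Finset.range_mono h) (Finset.range_mono h)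
    · refine ⟨max p.1 p.2 + 1, Finset.mem_product.2 ⟨?_, ?_⟩⟩ <;> rw [Finset.mem_range]
      · exact Nat.lt_succ_of_le (le_max_left _ _)
      · exact Nat.lt_succ_of_le (le_max_right _ _)
  · obtain ⟨k, hk1, hk2⟩ := exists_norm_le_four_mul_two_pow l
    have h1 : ‖S N l‖ₑ ≤ ENNReal.ofReal (C * 2 ^ (k * ε)) * (bnorm P β a * bnorm P (-ε) b) :=
      ((enorm_sum_le _ _).trans (ENNReal.sum_le_tsum _)).trans (H a b k l hk1)
    have h2 := ENNReal.toReal_mono (ENNReal.mul_lt_top ENNReal.ofReal_lt_top hAB).ne h1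
    rw [toReal_enorm, ENNReal.toReal_mul, ENNReal.toReal_ofReal (by positivity), ← hD] at h2
    have h3 : (2 : ℝ) ^ (k * ε) ≤ 1 + ‖latticePoint l‖ := by
      refine le_trans ?_ hk2
      rw [← Real.rpow_natCast]
      refine Real.rpow_le_rpow_of_exponent_le (by norm_num) ?_
      exact mul_le_of_le_one_right (Nat.cast_nonneg k) hε1
    rw [norm_mul, pow_one, ← mul_assoc]
    refine mul_le_mul_of_nonneg_right (h2.trans ?_) (norm_nonneg _)
    have hD0 : 0 ≤ D := ENNReal.toReal_nonneg
    calc C * 2 ^ (k * ε) * D ≤ C * (1 + ‖latticePoint l‖) * D := by gcongr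
      _ = _ := by ring

/-- The product of `f ∈ B^β` and `g ∈ B^{-ε}` exists, and `prodC` gives its Fourier coefficients. -/
theorem isProduct_iff {β ε : ℝ} (hε : 0 < ε) (hε1 : ε ≤ 1) (hβ : ε < β) {f g h : Dist}
    (hf : bnorm P β (fourierCoef f) < ⊤) (hg : bnorm P (-ε) (fourierCoef g) < ⊤) :
    IsProduct P f g h ↔ fourierCoef h = prodC P (fourierCoef f) (fourierCoef g) := by
  have hpi : (Real.pi : ℂ) ≠ 0 := by exact_mod_cast Real.pi_ne_zero
  constructor
  · intro H
    ext l
    have h1 := tendsto_nhds_unique (H (expTest (-l)))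
      (tendsto_fnPair_lowPass P hε hε1 hβ hf hg (expTest (-l)))
    change fourierCoef h l = _ at h1
    rw [h1]
    change (2 * Real.pi : ℂ)⁻¹ * ∑' k, prodC P _ _ k * fnPair (expFn k) (expFn (-l)) = _
    simp_rw [fnPair_expFn_expFn]
    rw [tsum_eq_single l]
    · simp
      field_simp
    · intro k hk
      simp [hk]
  · intro H φ
    rw [pair_eq_tsum, H]
    exact tendsto_fnPair_lowPass P hε hε1 hβ hf hg φ

end

/-! ### Convolution inequalities on the real line -/

/-- Young's inequality `‖K * f‖_r ≤ ‖K‖_1 ‖f‖_r`. -/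
theorem lintegral_conv_rpow_le {r : ℝ} (hr : 1 ≤ r) {K f : ℝ → ℝ≥0∞} (hK : Measurable K)
    (hf : Measurable f) :
    ∫⁻ t, (∫⁻ s, K (t - s) * f s) ^ r ≤ (∫⁻ s, K s) ^ r * ∫⁻ s, f s ^ r := by
  have htr : ∀ t, ∫⁻ s, K (t - s) = ∫⁻ s, K s := fun t => lintegral_sub_left_eq_self K t
  have hpt : ∀ t, (∫⁻ s, K (t - s) * f s) ^ r ≤ (∫⁻ s, K s) ^ (r - 1) * ∫⁻ s, K (t - s) * f s ^ r := by
    intro t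
    rcases hr.eq_or_lt with rfl | hr1
    · simp
    have hr0 : 0 < r := by linarith
    have hconj : (r.conjExponent).HolderConjugate r := (Real.HolderConjugate.conjExponent hr1).symm
    set r' := r.conjExponent with hr'
    have hKt : Measurable fun s => K (t - s) := hK.comp (measurable_const.sub measurable_id)
    have h1 := ENNReal.lintegral_mul_le_Lp_mul_Lq volume hconj
      (f := fun s => K (t - s) ^ (1 / r')) (g := fun s => K (t - s) ^ (1 / r) * f s)
      (by fun_prop) (by fun_prop)
    have e1 : ∀ s, ((fun s => K (t - s) ^ (1 / r')) * fun s => K (t - s) ^ (1 / r) * f s) s =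
        K (t - s) * f s := by
      intro s
      simp only [Pi.mul_apply]
      have hr'0 : 0 < r' := hconj.pos
      rw [← mul_assoc, ← ENNReal.rpow_add_of_nonneg _ _ (by positivity) (by positivity),
        one_div, one_div, hconj.inv_add_inv_eq_one, ENNReal.rpow_one]
    simp_rw [e1] at h1
    have e2 : ∀ s, (K (t - s) ^ (1 / r')) ^ r' = K (t - s) := fun s => by
      rw [← ENNReal.rpow_mul, one_div, inv_mul_cancel₀ hconj.pos.ne', ENNReal.rpow_one]
    have e3 : ∀ s, (K (t - s) ^ (1 / r) * f s) ^ r = K (t - s) * f s ^ r := fun s => by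
      rw [ENNReal.mul_rpow_of_nonneg _ _ hr0.le, ← ENNReal.rpow_mul, one_div,
        inv_mul_cancel₀ hr0.ne', ENNReal.rpow_one]
    simp_rw [e2, e3] at h1
    rw [htr] at h1
    calc _ ≤ ((∫⁻ s, K s) ^ (1 / r') * (∫⁻ s, K (t - s) * f s ^ r) ^ (1 / r)) ^ r := by
          gcongr
      _ = _ := by
          rw [ENNReal.mul_rpow_of_nonneg _ _ hr0.le, ← ENNReal.rpow_mul, ← ENNReal.rpow_mul]
          congr 2
          · have := hconj.inv_add_inv_eq_one
            field_simp at this ⊢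
            linarith
          · rw [one_div, inv_mul_cancel₀ hr0.ne', ENNReal.rpow_one]
  calc _ ≤ ∫⁻ t, (∫⁻ s, K s) ^ (r - 1) * ∫⁻ s, K (t - s) * f s ^ r := lintegral_mono hpt
    _ = (∫⁻ s, K s) ^ (r - 1) * ∫⁻ t, ∫⁻ s, K (t - s) * f s ^ r := by
        rw [lintegral_const_mul]
        exact Measurable.lintegral_prod_right' (f := fun z : ℝ × ℝ => K (z.1 - z.2) * f z.2 ^ r)
          (by fun_prop)
    _ = (∫⁻ s, K s) ^ (r - 1) * ((∫⁻ s, K s) * ∫⁻ s, f s ^ r) := by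
        congr 1
        rw [lintegral_lintegral_swap]
        · have : ∀ s, ∫⁻ t, K (t - s) * f s ^ r = (∫⁻ t, K t) * f s ^ r := fun s => by
            rw [lintegral_mul_const _ (by fun_prop), lintegral_sub_right_eq_self]
          simp_rw [this]
          rw [lintegral_const_mul _ (by fun_prop)]
        · exact (by fun_prop : Measurable fun z : ℝ × ℝ => K (z.1 - z.2) * f z.2 ^ r).aemeasurable
    _ = _ := by
        rw [← mul_assoc]
        congr 1
        conv_lhs => rw [← ENNReal.rpow_one (∫⁻ s, K s), ← ENNReal.rpow_mul, one_mul]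
        rw [← ENNReal.rpow_add_of_nonneg _ _ (by linarith) (by norm_num)]
        congr 1
        ring

/-- A convolution inequality of Young type for products, `‖k * (x g)‖_γ ≤ ‖k‖_q ‖x‖_γ ‖g‖_p` for
conjugate exponents `p`, `q`. Hölder's inequality bounds the convolution at `t` by the `L^p` norm
of `g` times `(k^q * x^q)(t)^{1/q}`, and Young's inequality in `L^{γ/q}` applies to the latter. -/
theorem lintegral_conv_mul_rpow_le {p q γ : ℝ} (hpq : p.HolderConjugate q) (hγ : q ≤ γ)
    {k x g : ℝ → ℝ≥0∞} (hk : Measurable k) (hx : Measurable x) (hg : Measurable g) :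
    ∫⁻ t, (∫⁻ s, k (t - s) * (x s * g s)) ^ γ ≤
      (∫⁻ s, k s ^ q) ^ (γ / q) * (∫⁻ s, x s ^ γ) * (∫⁻ s, g s ^ p) ^ (γ / p) := by
  have hq0 : 0 < q := hpq.symm.pos
  have hp0 : 0 < p := hpq.pos
  have hγ0 : 0 < γ := hq0.trans_le hγ
  have hpt : ∀ t, (∫⁻ s, k (t - s) * (x s * g s)) ^ γ ≤
      (∫⁻ s, k (t - s) ^ q * x s ^ q) ^ (γ / q) * (∫⁻ s, g s ^ p) ^ (γ / p) := by
    intro t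
    have h1 := ENNReal.lintegral_mul_le_Lp_mul_Lq volume hpq.symm
      (f := fun s => k (t - s) * x s) (g := g) (by fun_prop) hg.aemeasurable
    simp only [Pi.mul_apply, mul_assoc, ENNReal.mul_rpow_of_nonneg _ _ hq0.le] at h1
    calc _ ≤ ((∫⁻ s, k (t - s) ^ q * x s ^ q) ^ (1 / q) * (∫⁻ s, g s ^ p) ^ (1 / p)) ^ γ := by
          gcongr
      _ = _ := by
          rw [ENNReal.mul_rpow_of_nonneg _ _ hγ0.le, ← ENNReal.rpow_mul, ← ENNReal.rpow_mul]
          congr 2 <;> ring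
  have h2 := lintegral_conv_rpow_le (r := γ / q) ((one_le_div hq0).2 hγ)
    (K := fun s => k s ^ q) (f := fun s => x s ^ q) (by fun_prop) (by fun_prop)
  have e1 : ∀ s, (x s ^ q) ^ (γ / q) = x s ^ γ := fun s => by
    rw [← ENNReal.rpow_mul, mul_div_cancel₀ _ hq0.ne']
  simp_rw [e1] at h2
  calc _ ≤ ∫⁻ t, (∫⁻ s, k (t - s) ^ q * x s ^ q) ^ (γ / q) * (∫⁻ s, g s ^ p) ^ (γ / p) :=
        lintegral_mono hpt
    _ = (∫⁻ t, (∫⁻ s, k (t - s) ^ q * x s ^ q) ^ (γ / q)) * (∫⁻ s, g s ^ p) ^ (γ / p) := by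
        rw [lintegral_mul_const]
        exact (Measurable.lintegral_prod_right'
          (f := fun z : ℝ × ℝ => k (z.1 - z.2) ^ q * x z.2 ^ q) (by fun_prop)).pow_const _
    _ ≤ _ := by gcongr

/-- A Gronwall lemma for singular convolution inequalities: the weight `e^{-λt}` makes the kernel
small, and the inequality becomes a strict contraction. -/
theorem ae_eq_zero_of_le_conv {p q γ : ℝ} (hpq : p.HolderConjugate q) (hγ : q ≤ γ)
    {k y g : ℝ → ℝ≥0∞} (hk : Measurable k) (hy : Measurable y) (hg : Measurable g)
    (hk0 : ∀ s ≤ 0, k s = 0) (hkq : ∫⁻ s, k s ^ q ≠ ⊤) (hgp : ∫⁻ s, g s ^ p ≠ ⊤)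
    (hy0 : ∀ s ≤ 0, y s = 0) (hyγ : ∫⁻ s, y s ^ γ ≠ ⊤)
    (h : ∀ᵐ t, y t ≤ ∫⁻ s, k (t - s) * (y s * g s)) : y =ᵐ[volume] 0 := by
  have hq0 : 0 < q := hpq.symm.pos
  have hp0 : 0 < p := hpq.pos
  have hγ0 : 0 < γ := hq0.trans_le hγ
  -- the weights `e^{-λs}` with `λ = n`; `∫ (k e^{-λs})^q` tends to zero by dominated convergence
  let e : ℕ → ℝ → ℝ≥0∞ := fun n s => ENNReal.ofReal (Real.exp (-(n * s)))
  have he : ∀ n, Measurable (e n) := fun n => by fun_prop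
  have he1 : ∀ n s, 0 ≤ s → e n s ≤ 1 := fun n s hs => by
    rw [← ENNReal.ofReal_one]
    apply ENNReal.ofReal_le_ofReal
    rw [Real.exp_le_one_iff]
    have : (0 : ℝ) ≤ n * s := by positivity
    linarith
  have hlim : Tendsto (fun n => ∫⁻ s, (k s * e n s) ^ q) atTop (𝓝 (∫⁻ _ : ℝ, 0)) := by
    refine tendsto_lintegral_of_dominated_convergence (fun s => k s ^ q) (fun n => by fun_prop)
      (fun n => Eventually.of_forall fun s => ?_) hkq ?_
    · rcases le_or_gt s 0 with hs | hs
      · simp [hk0 s hs, hq0]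
      · refine ENNReal.rpow_le_rpow ?_ hq0.le
        exact mul_le_of_le_one_right' (he1 n s hs.le)
    · have hfin : ∀ᵐ s, k s ^ q < ⊤ := ae_lt_top (by fun_prop) hkq
      filter_upwards [hfin] with s hs
      rcases le_or_gt s 0 with hs0 | hs0
      · simp [hk0 s hs0, hq0]
      · have hks : k s ≠ ⊤ := fun h => by simp [h, hq0] at hs
        have h1 : Tendsto (fun n : ℕ => e n s) atTop (𝓝 0) := by
          rw [← ENNReal.ofReal_zero]
          refine ENNReal.tendsto_ofReal ?_
          refine Real.tendsto_exp_neg_atTop_nhds_zero.comp ?_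
          exact tendsto_natCast_atTop_atTop.atTop_mul_const hs0
        have h2 := ENNReal.Tendsto.const_mul (a := k s) h1 (Or.inr hks)
        rw [mul_zero] at h2
        have h3 := (ENNReal.continuous_rpow_const (y := q)).tendsto 0 |>.comp h2
        rw [ENNReal.zero_rpow_of_pos hq0] at h3
        exact h3
  rw [lintegral_zero] at hlim
  set G := (∫⁻ s, g s ^ p) ^ (γ / p) with hG
  have hGt : G ≠ ⊤ := ENNReal.rpow_ne_top_of_nonneg (by positivity) hgp
  have hlim2 : Tendsto (fun n => (∫⁻ s, (k s * e n s) ^ q) ^ (γ / q) * G) atTop (𝓝 0) := by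
    have h3 := (ENNReal.continuous_rpow_const (y := γ / q)).tendsto 0 |>.comp hlim
    rw [ENNReal.zero_rpow_of_pos (by positivity)] at h3
    have h4 := ENNReal.Tendsto.mul_const (b := G) h3 (Or.inr hGt)
    rw [zero_mul] at h4
    exact h4
  obtain ⟨n, hn⟩ := ((ENNReal.tendsto_nhds_zero.1 hlim2) (1 / 2) (by norm_num)).exists
  have hw : ∀ᵐ t, y t * e n t ≤ ∫⁻ s, (k (t - s) * e n (t - s)) * ((y s * e n s) * g s) := by
    filter_upwards [h] with t ht
    have e1 : ∀ s, e n t = e n (t - s) * e n s := fun s => by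
      simp only [e]
      rw [← ENNReal.ofReal_mul (by positivity), ← Real.exp_add]
      congr 2
      ring
    calc y t * e n t ≤ (∫⁻ s, k (t - s) * (y s * g s)) * e n t := by gcongr
      _ = ∫⁻ s, k (t - s) * (y s * g s) * e n t := by
          rw [lintegral_mul_const]
          fun_prop
      _ = _ := by
          refine lintegral_congr fun s => ?_
          rw [e1 s]
          ring
  have hmain := lintegral_conv_mul_rpow_le hpq hγ (k := fun s => k s * e n s)
    (x := fun s => y s * e n s) (g := g) (by fun_prop) (by fun_prop) hg
  set I := ∫⁻ s, (y s * e n s) ^ γ with hI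
  have hI1 : I ≤ 1 / 2 * I := by
    calc I ≤ ∫⁻ t, (∫⁻ s, (k (t - s) * e n (t - s)) * ((y s * e n s) * g s)) ^ γ :=
          lintegral_mono_ae (hw.mono fun t ht => ENNReal.rpow_le_rpow ht hγ0.le)
      _ ≤ _ := hmain
      _ = ((∫⁻ s, (k s * e n s) ^ q) ^ (γ / q) * G) * I := by rw [hG, hI]; ring
      _ ≤ _ := by gcongr
  have hIt : I ≠ ⊤ := by
    refine ne_top_of_le_ne_top hyγ (lintegral_mono fun s => ?_)
    rcases le_or_gt s 0 with hs | hs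
    · simp [hy0 s hs, hγ0]
    · exact ENNReal.rpow_le_rpow (mul_le_of_le_one_right' (he1 n s hs.le)) hγ0.le
  have hI0 : I = 0 := by
    by_contra hne
    have h1 := ENNReal.half_lt_self hne hIt
    rw [ENNReal.div_eq_inv_mul] at h1
    rw [one_div] at hI1
    exact absurd hI1 (not_le.2 h1)
  have h2 := (lintegral_eq_zero_iff (by fun_prop)).1 hI0
  filter_upwards [h2] with s hs
  have h3 : y s * e n s = 0 := by
    have hs' : (y s * e n s) ^ γ = 0 := hs
    exact (ENNReal.rpow_eq_zero_iff_of_pos hγ0).1 hs'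
  have h4 : e n s ≠ 0 := by
    simp only [e]
    rw [Ne, ENNReal.ofReal_eq_zero, not_le]
    positivity
  simpa [h4] using h3

section

variable (P : DyadicPartition)

/-! ### The Duhamel integral -/

/-- The Fourier coefficients of `∫₀ᵗ e^{(t-s)Δ} F(s) ds`. -/
def duh (F : ℝ → Freq → ℂ) (t : ℝ) (l : Freq) : ℂ := ∫ s in (0 : ℝ)..t, heatC (t - s) (F s) l

/-- The kernel `τ^{-θ}` on `(0, T]`, by which the smoothing of the heat flow is measured. -/
def kern (θ T : ℝ) : ℝ → ℝ≥0∞ := (Ioc 0 T).indicator fun τ => ENNReal.ofReal (τ ^ (-θ))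

theorem measurable_kern (θ T : ℝ) : Measurable (kern θ T) :=
  Measurable.indicator (by fun_prop) measurableSet_Ioc

theorem kern_of_nonpos {θ T τ : ℝ} (h : τ ≤ 0) : kern θ T τ = 0 :=
  indicator_of_notMem (fun h' => absurd h'.1 (not_lt.2 h)) _

theorem lintegral_kern_rpow {θ T q : ℝ} (hT : 0 < T) (hq : 0 < q) (hθ : θ * q < 1) :
    ∫⁻ τ, kern θ T τ ^ q = ENNReal.ofReal (T ^ (1 - θ * q) / (1 - θ * q)) := by
  have h1 : ∀ τ, kern θ T τ ^ q =
      (Ioc 0 T).indicator (fun τ => ENNReal.ofReal (τ ^ (-(θ * q)))) τ := by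
    intro τ
    by_cases h : τ ∈ Ioc 0 T
    · rw [kern, indicator_of_mem h, indicator_of_mem h,
        ENNReal.ofReal_rpow_of_nonneg (Real.rpow_nonneg h.1.le _) hq.le, ← Real.rpow_mul h.1.le,
        neg_mul]
    · rw [kern, indicator_of_notMem h, indicator_of_notMem h, ENNReal.zero_rpow_of_pos hq]
  simp_rw [h1]
  rw [lintegral_indicator measurableSet_Ioc]
  have h2 : IntervalIntegrable (fun τ : ℝ => τ ^ (-(θ * q))) volume 0 T :=
    intervalIntegral.intervalIntegrable_rpow' (by linarith)
  rw [← ofReal_integral_eq_lintegral_ofReal, ← intervalIntegral.integral_of_le hT.le,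
    integral_rpow (Or.inl (by linarith))]
  · rw [Real.zero_rpow (by linarith)]
    congr 1
    rw [sub_zero, neg_add_eq_sub]
  · exact (intervalIntegrable_iff_integrableOn_Ioc_of_le hT.le).1 h2
  · filter_upwards [ae_restrict_mem measurableSet_Ioc] with τ hτ
    exact Real.rpow_nonneg hτ.1.le _

theorem lintegral_kern_rpow_ne_top {θ T q : ℝ} (hT : 0 < T) (hq : 0 < q) (hθ : θ * q < 1) :
    ∫⁻ τ, kern θ T τ ^ q ≠ ⊤ := by
  rw [lintegral_kern_rpow hT hq hθ]
  exact ENNReal.ofReal_ne_top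

variable {P} in
theorem integrable_coef {s : ℝ} {F : ℝ → Freq → ℂ} (hF : Measurable F)
    (h : ∫⁻ t, bnorm P s (F t) ≠ ⊤) (l : Freq) : Integrable fun t => F t l := by
  obtain ⟨C, K, hC, hb⟩ := exists_enorm_coef_le P s
  refine ⟨((measurable_pi_apply l).comp hF).aestronglyMeasurable, ?_⟩
  refine lt_of_le_of_lt (lintegral_mono fun t => hb (F t) l) ?_
  rw [lintegral_const_mul' _ _ ENNReal.ofReal_ne_top]
  exact ENNReal.mul_lt_top ENNReal.ofReal_lt_top h.lt_top

theorem intervalIntegrable_heatC {F : ℝ → Freq → ℂ} {l : Freq} (h : Integrable fun t => F t l)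
    (t a b : ℝ) : IntervalIntegrable (fun s => heatC (t - s) (F s) l) volume a b := by
  unfold heatC
  refine IntervalIntegrable.continuousOn_mul h.intervalIntegrable ?_
  fun_prop

theorem duh_eq (F : ℝ → Freq → ℂ) (t : ℝ) (l : Freq) :
    duh F t l = (Real.exp (-t * ‖latticePoint l‖ ^ 2) : ℂ) *
      ∫ s in (0 : ℝ)..t, (Real.exp (s * ‖latticePoint l‖ ^ 2) : ℂ) * F s l := by
  rw [duh, ← intervalIntegral.integral_const_mul]
  congr 1
  ext s
  rw [heatC, ← mul_assoc, ← Complex.ofReal_mul, ← Real.exp_add]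
  congr 3
  ring_nf

theorem continuous_duh {F : ℝ → Freq → ℂ} {l : Freq} (h : Integrable fun t => F t l) :
    Continuous fun t => duh F t l := by
  simp_rw [duh_eq]
  refine Continuous.mul (by fun_prop) ?_
  refine intervalIntegral.continuous_primitive (fun a b => ?_) 0
  exact IntervalIntegrable.continuousOn_mul h.intervalIntegrable (by fun_prop)

theorem measurable_duh {F : ℝ → Freq → ℂ} (h : ∀ l, Integrable fun t => F t l) :
    Measurable (duh F) :=
  measurable_pi_iff.2 fun l => (continuous_duh (h l)).measurable

theorem duh_sub {F G : ℝ → Freq → ℂ} (hF : ∀ l, Integrable fun t => F t l)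
    (hG : ∀ l, Integrable fun t => G t l) (t : ℝ) : duh (F - G) t = duh F t - duh G t := by
  ext l
  simp only [duh, Pi.sub_apply]
  rw [← intervalIntegral.integral_sub (intervalIntegrable_heatC (hF l) _ _ _)
    (intervalIntegrable_heatC (hG l) _ _ _)]
  congr 1
  ext s
  simp [heatC, mul_sub]

theorem duh_add {F G : ℝ → Freq → ℂ} (hF : ∀ l, Integrable fun t => F t l)
    (hG : ∀ l, Integrable fun t => G t l) (t : ℝ) : duh (F + G) t = duh F t + duh G t := by
  ext l
  simp only [duh, Pi.add_apply]
  rw [← intervalIntegral.integral_add (intervalIntegrable_heatC (hF l) _ _ _)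
    (intervalIntegrable_heatC (hG l) _ _ _)]
  congr 1
  ext s
  simp [heatC, mul_add]

theorem duh_congr {F G : ℝ → Freq → ℂ} {t : ℝ} (ht : 0 ≤ t)
    (h : ∀ᵐ s ∂(volume.restrict (Ioc 0 t)), F s = G s) : duh F t = duh G t := by
  ext l
  rw [duh, duh, intervalIntegral.integral_of_le ht, intervalIntegral.integral_of_le ht]
  refine integral_congr_ae ?_
  filter_upwards [h] with s hs
  simp [heatC, hs]

theorem bnorm_duh_le (s : ℝ) {F : ℝ → Freq → ℂ} (hF : ∀ l, Integrable fun t => F t l) {t : ℝ}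
    (ht : 0 ≤ t) :
    bnorm P s (duh F t) ≤ ∫⁻ r in Ioc 0 t, bnorm P s (heatC (t - r) (F r)) := by
  rw [bnorm_le_iff]
  intro m
  have hS : ∀ a : Freq → ℂ, ∀ x, synth (blkC P m a) x =
      ∑ l ∈ (symbol_finite P m).toFinset, (symbol P m (latticePoint l) : ℂ) * a l * expFn l x := by
    intro a x
    rw [synth_eq_sum fun l hl => blkC_eq_zero_of_notMem P hl a]
    rfl
  have h1 : bsup P m (duh F t) ≤ ∫⁻ r in Ioc 0 t, bsup P m (heatC (t - r) (F r)) := by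
    refine iSup_le fun x => ?_
    have h2 : (2 * Real.pi : ℂ)⁻¹ * synth (blkC P m (duh F t)) x =
        ∫ r in Ioc 0 t, (2 * Real.pi : ℂ)⁻¹ * synth (blkC P m (heatC (t - r) (F r))) x := by
      simp_rw [hS]
      rw [integral_const_mul, integral_finsetSum]
      · congr 1
        refine Finset.sum_congr rfl fun l _ => ?_
        rw [integral_mul_const, integral_const_mul, duh, intervalIntegral.integral_of_le ht]
      · intro l _
        exact (((intervalIntegrable_iff_integrableOn_Ioc_of_le ht).1
          (intervalIntegrable_heatC (hF l) t 0 t)).const_mul _).mul_const _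
    rw [h2]
    refine (enorm_integral_le_lintegral_enorm _).trans (lintegral_mono fun r => ?_)
    exact le_iSup (fun x => ‖(2 * Real.pi : ℂ)⁻¹ * synth (blkC P m (heatC (t - r) (F r))) x‖ₑ) x
  refine (mul_le_mul' le_rfl h1).trans ?_
  rw [← lintegral_const_mul' _ _ ENNReal.ofReal_ne_top]
  exact lintegral_mono fun r => weight_mul_bsup_le P s m _

/-- The smoothing of the heat flow turns the Duhamel integral into a convolution with a
power kernel. -/
theorem exists_bnorm_duh_le {σ : ℝ} (hσ : 0 ≤ σ) (hσ2 : σ ≤ 2) : ∃ C : ℝ≥0∞, C ≠ ⊤ ∧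
    ∀ (s T : ℝ) (_ : T ≤ 1) (F : ℝ → Freq → ℂ), (∀ l, Integrable fun t => F t l) →
      ∀ t ∈ Icc 0 T, bnorm P (s + σ) (duh F t) ≤
        C * ∫⁻ r, kern (σ / 2) T (t - r) * bnorm P s (F r) := by
  obtain ⟨C, hC, hb⟩ := exists_bnorm_heatC_smoothing P
  refine ⟨C, hC, fun s T hT F hF t ht => ?_⟩
  refine (bnorm_duh_le P (s + σ) hF ht.1).trans ?_
  rw [← lintegral_const_mul' _ _ hC, ← lintegral_indicator measurableSet_Ioc]
  refine lintegral_mono_ae ?_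
  have hne : ∀ᵐ r : ℝ, r ≠ t := by simp [ae_iff]
  filter_upwards [hne] with r hr
  by_cases h : r ∈ Ioc 0 t
  · rw [indicator_of_mem h]
    have h1 : 0 < t - r := sub_pos.2 (lt_of_le_of_ne h.2 hr)
    have h2 : t - r ≤ T := by linarith [h.1, ht.2]
    refine (hb s σ (t - r) hσ hσ2 h1 (h2.trans hT) (F r)).trans (le_of_eq ?_)
    rw [kern, indicator_of_mem (show t - r ∈ Ioc 0 T from ⟨h1, h2⟩), mul_assoc]
  · rw [indicator_of_notMem h]
    exact zero_le

end

section

variable (P : DyadicPartition)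

/-! ### Curves in Besov spaces -/

/-- The `L^r(ℝ)` norm of a nonnegative function. -/
def lpn (r : ℝ) (f : ℝ → ℝ≥0∞) : ℝ≥0∞ := (∫⁻ t, f t ^ r) ^ (1 / r)

theorem lpn_mono_ae {r : ℝ} (hr : 0 ≤ r) {f g : ℝ → ℝ≥0∞} (h : ∀ᵐ t, f t ≤ g t) :
    lpn r f ≤ lpn r g :=
  ENNReal.rpow_le_rpow (lintegral_mono_ae (h.mono fun _ ht => ENNReal.rpow_le_rpow ht hr))
    (by positivity)

theorem lpn_add_le {r : ℝ} (hr : 1 ≤ r) {f g : ℝ → ℝ≥0∞} (hf : Measurable f) (hg : Measurable g) :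
    lpn r (fun t => f t + g t) ≤ lpn r f + lpn r g :=
  ENNReal.lintegral_Lp_add_le hf.aemeasurable hg.aemeasurable hr

theorem lpn_const_mul {r : ℝ} (hr : 0 < r) {c : ℝ≥0∞} (hc : c ≠ ⊤) (f : ℝ → ℝ≥0∞) :
    lpn r (fun t => c * f t) = c * lpn r f := by
  unfold lpn
  simp_rw [ENNReal.mul_rpow_of_nonneg _ _ hr.le]
  rw [lintegral_const_mul' _ _ (ENNReal.rpow_ne_top_of_nonneg hr.le hc),
    ENNReal.mul_rpow_of_nonneg _ _ (by positivity), ← ENNReal.rpow_mul, mul_one_div_cancel hr.ne',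
    ENNReal.rpow_one]

theorem lpn_ne_top_iff {r : ℝ} (hr : 0 < r) {f : ℝ → ℝ≥0∞} :
    lpn r f ≠ ⊤ ↔ ∫⁻ t, f t ^ r ≠ ⊤ := by
  rw [lpn, Ne, Ne, ENNReal.rpow_eq_top_iff_of_pos (by positivity)]

/-- On a set of measure at most one, Lebesgue norms increase with the exponent. -/
theorem lpn_le_lpn {r γ T : ℝ} (hr : 0 < r) (hγ : r ≤ γ) (hT : T ≤ 1) {f : ℝ → ℝ≥0∞}
    (hf : Measurable f) (h0 : ∀ t ∉ Ioc 0 T, f t = 0) : lpn r f ≤ lpn γ f := by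
  have h1 : ∀ ρ : ℝ, 0 < ρ → lpn ρ f = eLpNorm' f ρ (volume.restrict (Ioc 0 T)) := by
    intro ρ hρ
    rw [eLpNorm'_eq_lintegral_enorm, lpn, ← lintegral_indicator measurableSet_Ioc]
    congr 2
    ext t
    by_cases ht : t ∈ Ioc 0 T
    · rw [indicator_of_mem ht]; rfl
    · rw [indicator_of_notMem ht, h0 t ht, ENNReal.zero_rpow_of_pos hρ]
  rw [h1 r hr, h1 γ (hr.trans_le hγ)]
  refine (eLpNorm'_le_eLpNorm'_mul_rpow_measure_univ hr hγ hf.aestronglyMeasurable).trans ?_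
  refine mul_le_of_le_one_right' ?_
  refine ENNReal.rpow_le_one ?_ (sub_nonneg.2 (one_div_le_one_div_of_le hr hγ))
  rw [Measure.restrict_apply_univ, Real.volume_Ioc]
  exact ENNReal.ofReal_le_one.2 (by linarith)

theorem lpn_conv_le {p q γ : ℝ} (hpq : p.HolderConjugate q) (hγ : q ≤ γ)
    {k x g : ℝ → ℝ≥0∞} (hk : Measurable k) (hx : Measurable x) (hg : Measurable g) :
    lpn γ (fun t => ∫⁻ s, k (t - s) * (x s * g s)) ≤ lpn q k * (lpn γ x * lpn p g) := by
  have hγ0 : 0 < γ := hpq.symm.pos.trans_le hγ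
  refine (ENNReal.rpow_le_rpow (lintegral_conv_mul_rpow_le hpq hγ hk hx hg)
    (by positivity : 0 ≤ 1 / γ)).trans (le_of_eq ?_)
  rw [ENNReal.mul_rpow_of_nonneg _ _ (by positivity), ENNReal.mul_rpow_of_nonneg _ _ (by positivity),
    ← ENNReal.rpow_mul, ← ENNReal.rpow_mul, mul_assoc]
  have e1 : ∀ z : ℝ, γ / z * (1 / γ) = 1 / z := fun z => by
    rw [div_mul_div_comm, mul_one, mul_comm z, ← div_div, div_self hγ0.ne']
  rw [e1, e1]
  rfl

/-- `a` is a measurable curve of Fourier coefficients that vanishes outside `(0, T]` and whose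
`B^s` norm is in `L^r`. Vanishing outside the interval makes restrictions of measures
unnecessary. -/
structure Curve (s r T : ℝ) (a : ℝ → Freq → ℂ) : Prop where
  meas : Measurable a
  zero : ∀ t ∉ Ioc 0 T, a t = 0
  fin : lpn r (fun t => bnorm P s (a t)) ≠ ⊤

variable {P}

theorem measurable_bnorm_comp (s : ℝ) {a : ℝ → Freq → ℂ} (ha : Measurable a) :
    Measurable fun t => bnorm P s (a t) := (measurable_bnorm P s).comp ha

theorem lpn_bnorm_add_le (s : ℝ) {r : ℝ} (hr : 1 ≤ r) {a b : ℝ → Freq → ℂ} (ha : Measurable a)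
    (hb : Measurable b) : lpn r (fun t => bnorm P s ((a + b) t)) ≤
      lpn r (fun t => bnorm P s (a t)) + lpn r (fun t => bnorm P s (b t)) :=
  (lpn_mono_ae (zero_le_one.trans hr)
    (Eventually.of_forall fun t => bnorm_add_le P s (a t) (b t))).trans
    (lpn_add_le hr (measurable_bnorm_comp s ha) (measurable_bnorm_comp s hb))

theorem lpn_bnorm_mono {s s' : ℝ} (h : s' ≤ s) {r : ℝ} (hr : 0 < r) (a : ℝ → Freq → ℂ) :
    lpn r (fun t => bnorm P s' (a t)) ≤
      ENNReal.ofReal (2 ^ (s - s')) * lpn r (fun t => bnorm P s (a t)) := by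
  rw [← lpn_const_mul hr ENNReal.ofReal_ne_top]
  exact lpn_mono_ae hr.le (Eventually.of_forall fun t => bnorm_mono P h (a t))

namespace Curve

variable {s r T : ℝ} {a b : ℝ → Freq → ℂ}

theorem add (hr : 1 ≤ r) (ha : Curve P s r T a) (hb : Curve P s r T b) :
    Curve P s r T (a + b) where
  meas := ha.meas.add hb.meas
  zero t ht := by rw [Pi.add_apply, ha.zero t ht, hb.zero t ht, add_zero]
  fin := ne_top_of_le_ne_top (ENNReal.add_ne_top.2 ⟨ha.fin, hb.fin⟩)
    (lpn_bnorm_add_le s hr ha.meas hb.meas)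

theorem neg (ha : Curve P s r T a) : Curve P s r T (-a) where
  meas := ha.meas.neg
  zero t ht := by rw [Pi.neg_apply, ha.zero t ht, neg_zero]
  fin := by simpa only [Pi.neg_apply, bnorm_neg] using ha.fin

theorem sub (hr : 1 ≤ r) (ha : Curve P s r T a) (hb : Curve P s r T b) :
    Curve P s r T (a - b) := by
  rw [sub_eq_add_neg]
  exact ha.add hr hb.neg

theorem smul (hr : 0 < r) (c : ℂ) (ha : Curve P s r T a) : Curve P s r T (c • a) where
  meas := ha.meas.const_smul c
  zero t ht := by rw [Pi.smul_apply, ha.zero t ht, smul_zero]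
  fin := by
    simp only [Pi.smul_apply, bnorm_smul]
    rw [lpn_const_mul hr enorm_ne_top]
    exact ENNReal.mul_ne_top enorm_ne_top ha.fin

theorem mono_time {T' : ℝ} (hT : T ≤ T') (ha : Curve P s r T a) : Curve P s r T' a where
  meas := ha.meas
  zero t ht := ha.zero t fun h => ht ⟨h.1, h.2.trans hT⟩
  fin := ha.fin

theorem mono_index {s' : ℝ} (hr : 0 < r) (h : s' ≤ s) (ha : Curve P s r T a) :
    Curve P s' r T a where
  meas := ha.meas
  zero := ha.zero
  fin := ne_top_of_le_ne_top (ENNReal.mul_ne_top ENNReal.ofReal_ne_top ha.fin)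
    (lpn_bnorm_mono h hr a)

theorem lpn_le {r' : ℝ} (hr : 0 < r') (h : r' ≤ r) (hT : T ≤ 1) (ha : Curve P s r T a) :
    lpn r' (fun t => bnorm P s (a t)) ≤ lpn r (fun t => bnorm P s (a t)) :=
  lpn_le_lpn hr h hT (measurable_bnorm_comp s ha.meas) fun t ht => by
    simp [ha.zero t ht]

theorem mono_exponent {r' : ℝ} (hr : 0 < r') (h : r' ≤ r) (hT : T ≤ 1) (ha : Curve P s r T a) :
    Curve P s r' T a where
  meas := ha.meas
  zero := ha.zero
  fin := ne_top_of_le_ne_top ha.fin (ha.lpn_le hr h hT)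

theorem lintegral_ne_top (hr : 1 ≤ r) (hT : T ≤ 1) (ha : Curve P s r T a) :
    ∫⁻ t, bnorm P s (a t) ≠ ⊤ := by
  have h := (ha.mono_exponent one_pos hr hT).fin
  rw [lpn_ne_top_iff one_pos] at h
  simpa using h

theorem ae_lt_top (hr : 0 < r) (ha : Curve P s r T a) : ∀ᵐ t, bnorm P s (a t) < ⊤ := by
  have h := MeasureTheory.ae_lt_top ((measurable_bnorm_comp s ha.meas).pow_const r) ((lpn_ne_top_iff hr).1 ha.fin)
  filter_upwards [h] with t ht
  exact (ENNReal.rpow_lt_top_iff_of_pos hr).1 ht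

theorem integrable (hr : 1 ≤ r) (hT : T ≤ 1) (ha : Curve P s r T a) (l : Freq) :
    Integrable fun t => a t l :=
  integrable_coef ha.meas (ha.lintegral_ne_top hr hT) l

theorem indicator (T' : ℝ) (hr : 0 < r) (ha : Curve P s r T a) :
    Curve P s r T' ((Ioc 0 T').indicator a) where
  meas := ha.meas.indicator measurableSet_Ioc
  zero t ht := indicator_of_notMem ht _
  fin := ne_top_of_le_ne_top ha.fin (lpn_mono_ae hr.le (Eventually.of_forall fun t => by
    by_cases h : t ∈ Ioc 0 T'
    · rw [indicator_of_mem h]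
    · rw [indicator_of_notMem h, bnorm_zero]; exact zero_le))

end Curve

variable (P) in
/-- The curves with `L^r` integrable `B^s` norm are complete: a sequence with geometrically
decreasing differences converges. -/
theorem exists_curve_limit {s r T : ℝ} (hr : 1 ≤ r) {a : ℕ → ℝ → Freq → ℂ}
    (ha : ∀ n, Curve P s r T (a n)) {C : ℝ≥0∞} (hC : C ≠ ⊤)
    (h : ∀ n, lpn r (fun t => bnorm P s ((a (n + 1) - a n) t)) ≤ C * 2⁻¹ ^ n) :
    ∃ v, Curve P s r T v ∧
      ∀ n, lpn r (fun t => bnorm P s ((v - a n) t)) ≤ 2 * C * 2⁻¹ ^ n := by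
  have hr0 : 0 < r := by linarith
  let d : ℕ → ℝ → ℝ≥0∞ := fun n t => bnorm P s ((a (n + 1) - a n) t)
  have hd : ∀ n, Measurable (d n) := fun n =>
    measurable_bnorm_comp s ((ha (n + 1)).meas.sub (ha n).meas)
  let D : ℕ → ℝ → ℝ≥0∞ := fun n t => ∑' k, d (n + k) t
  have hsum : ∀ n m, lpn r (fun t => ∑ k ∈ Finset.range m, d (n + k) t) ≤
      ∑ k ∈ Finset.range m, C * 2⁻¹ ^ (n + k) := by
    intro n m
    induction m with
    | zero => simp [lpn, hr0]
    | succ m ih =>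
      simp_rw [Finset.sum_range_succ]
      refine (lpn_add_le hr (by fun_prop) (hd _)).trans (add_le_add ih (h _))
  have hgeo : ∀ n m, ∑ k ∈ Finset.range m, C * 2⁻¹ ^ (n + k) ≤ 2 * C * 2⁻¹ ^ n := by
    intro n m
    refine (ENNReal.sum_le_tsum _).trans (le_of_eq ?_)
    simp_rw [pow_add]
    rw [ENNReal.tsum_mul_left, ENNReal.tsum_mul_left, ENNReal.tsum_geometric,
      ENNReal.one_sub_inv_two, inv_inv]
    ring
  have hDn : ∀ n, lpn r (D n) ≤ 2 * C * 2⁻¹ ^ n := by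
    intro n
    have h1 : ∀ t, D n t ^ r = ⨆ m, (∑ k ∈ Finset.range m, d (n + k) t) ^ r := by
      intro t
      simp only [D]
      rw [ENNReal.tsum_eq_iSup_nat]
      exact (ENNReal.orderIsoRpow r hr0).map_iSup _
    have h2 : ∫⁻ t, D n t ^ r = ⨆ m, ∫⁻ t, (∑ k ∈ Finset.range m, d (n + k) t) ^ r := by
      simp_rw [h1]
      refine lintegral_iSup (fun m => by fun_prop) fun m m' hm t => ?_
      refine ENNReal.rpow_le_rpow (Finset.sum_le_sum_of_subset ?_) hr0.le
      exact Finset.range_mono hm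
    rw [lpn, h2, one_div, ENNReal.rpow_inv_le_iff hr0]
    refine iSup_le fun m => ?_
    rw [← ENNReal.rpow_inv_le_iff hr0, ← one_div]
    exact (hsum n m).trans (hgeo n m)
  have hD0 : ∀ᵐ t, D 0 t < ⊤ := by
    have h1 : lpn r (D 0) ≠ ⊤ := ne_top_of_le_ne_top
      (ENNReal.mul_ne_top (ENNReal.mul_ne_top (by simp) hC) (by simp)) (hDn 0)
    have h2 := MeasureTheory.ae_lt_top ((Measurable.tsum fun k => hd (0 + k)).pow_const r)
      ((lpn_ne_top_iff hr0).1 h1)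
    filter_upwards [h2] with t ht
    exact (ENNReal.rpow_lt_top_iff_of_pos hr0).1 ht
  let v : ℝ → Freq → ℂ := fun t l => a 0 t l + ∑' k, (a (k + 1) t l - a k t l)
  have hcoef : ∀ n l, Measurable fun t => a n t l := fun n l =>
    (measurable_pi_apply l).comp (ha n).meas
  have hv : Measurable v := measurable_pi_iff.2 fun l =>
    (hcoef 0 l).add (Measurable.tsum fun k => (hcoef (k + 1) l).sub (hcoef k l))
  have hlim : ∀ᵐ t, ∀ n, bnorm P s ((v - a n) t) ≤ D n t := by
    obtain ⟨c, K, hc, hb⟩ := exists_enorm_coef_le P s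
    filter_upwards [hD0] with t ht n
    have h1 : Tendsto (fun m => a m t) atTop (𝓝 (v t)) := by
      rw [tendsto_pi_nhds]
      intro l
      have h2 : Summable fun k => a (k + 1) t l - a k t l := by
        refine .of_enorm (ne_top_of_le_ne_top ?_ (ENNReal.tsum_le_tsum fun k =>
          hb ((a (k + 1) - a k) t) l))
        rw [ENNReal.tsum_mul_left]
        refine ENNReal.mul_ne_top ENNReal.ofReal_ne_top ?_
        simpa [D, d] using ht.ne
      have h3 := h2.hasSum.tendsto_sum_nat.const_add (a 0 t l)
      simpa only [Finset.sum_range_sub fun k => a k t l, add_sub_cancel] using h3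
    have h2 : Tendsto (fun m => a (n + m) t - a n t) atTop (𝓝 ((v - a n) t)) := by
      refine Tendsto.sub_const ?_ _
      simp_rw [add_comm n]
      exact h1.comp (tendsto_add_atTop_nat n)
    have hclosed := (lowerSemicontinuous_bnorm P s).isClosed_preimage (D n t)
    refine hclosed.mem_of_tendsto h2 (Eventually.of_forall fun m => ?_)
    change bnorm P s (a (n + m) t - a n t) ≤ D n t
    refine le_trans ?_ (ENNReal.sum_le_tsum (Finset.range m))
    induction m with
    | zero => simp
    | succ m ih =>
      rw [Finset.sum_range_succ]
      refine le_trans ?_ (add_le_add_left ih _)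
      refine le_trans (le_of_eq ?_) (bnorm_add_le P s _ _)
      congr 1
      change a (n + m + 1) t - a n t = a (n + m) t - a n t + (a (n + m + 1) t - a (n + m) t)
      abel
  have hvn : ∀ n, lpn r (fun t => bnorm P s ((v - a n) t)) ≤ 2 * C * 2⁻¹ ^ n := fun n =>
    (lpn_mono_ae hr0.le (hlim.mono fun t ht => ht n)).trans (hDn n)
  have hfin : Curve P s r T (v - a 0) :=
    { meas := hv.sub (ha 0).meas
      zero := fun t ht => by
        ext l
        simp [v, (ha _).zero t ht]
      fin := ne_top_of_le_ne_top
        (ENNReal.mul_ne_top (ENNReal.mul_ne_top (by simp) hC) (by simp)) (hvn 0) }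
  refine ⟨v, ?_, hvn⟩
  have := hfin.add hr (ha 0)
  rwa [sub_add_cancel] at this

end

section

variable (P : DyadicPartition)

/-! ### The fixed point problem -/

/-- The product estimate without finiteness assumptions. If one of the norms is zero and the other
infinite, the right hand side is zero, but then one of the factors vanishes. -/
theorem exists_bnorm_prodC_le_mul {β ε : ℝ} (hε : 0 < ε) (hβ : ε < β) :
    ∃ C : ℝ≥0∞, C ≠ ⊤ ∧ ∀ a b : Freq → ℂ,
      bnorm P (-ε) (prodC P a b) ≤ C * (bnorm P β a * bnorm P (-ε) b) := by
  obtain ⟨C, hC, hb⟩ := exists_bnorm_prodC_le P hε hβ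
  have h0 : ∀ a : Freq → ℂ, prodC P a 0 = 0 := fun a => by
    simpa using prodC_smul_right P 0 a 0
  refine ⟨C + 1, by simp [hC], fun a b => ?_⟩
  rcases eq_or_ne (bnorm P β a) 0 with ha | ha
  · rw [eq_zero_of_bnorm_eq_zero P ha, prodC_comm, h0, bnorm_zero]
    exact zero_le
  rcases eq_or_ne (bnorm P (-ε) b) 0 with hb0 | hb0
  · rw [eq_zero_of_bnorm_eq_zero P hb0, h0, bnorm_zero]
    exact zero_le
  by_cases hfin : bnorm P β a < ⊤ ∧ bnorm P (-ε) b < ⊤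
  · exact (hb a b hfin.1 hfin.2).trans (mul_le_mul' le_self_add le_rfl)
  · have : bnorm P β a * bnorm P (-ε) b = ⊤ := by
      rw [ENNReal.mul_eq_top]
      by_cases h : bnorm P β a = ⊤
      · exact Or.inr ⟨h, hb0⟩
      · refine Or.inl ⟨ha, ?_⟩
        by_contra h'
        exact hfin ⟨lt_top_iff_ne_top.2 h, lt_top_iff_ne_top.2 h'⟩
    rw [this, ENNReal.mul_top (by simp)]
    exact le_top

theorem measurable_pcoef {α : Type*} [MeasurableSpace α] (m n : ℕ) {a b : α → Freq → ℂ}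
    (ha : Measurable a) (hb : Measurable b) (l : Freq) :
    Measurable fun t => pcoef P m n (a t) (b t) l := by
  have ha' : ∀ j, Measurable fun t => a t j := fun j => (measurable_pi_apply j).comp ha
  have hb' : ∀ j, Measurable fun t => b t j := fun j => (measurable_pi_apply j).comp hb
  unfold pcoef blkC
  fun_prop

theorem measurable_prodC {α : Type*} [MeasurableSpace α] {a b : α → Freq → ℂ} (ha : Measurable a)
    (hb : Measurable b) : Measurable fun t => prodC P (a t) (b t) :=
  measurable_pi_iff.2 fun l => Measurable.tsum fun p => measurable_pcoef P p.1 p.2 ha hb l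

/-- The relations between the exponents under which the fixed point problem is solved in
`L^γ(B^β)`, with data in `L^p(B^{-ε})`. The number `(β + ε) / 2` is the order of the singularity
of the heat flow from `B^{-ε}` to `B^β`, which has to be in `L^q`. -/
structure Admissible (ε β γ p q : ℝ) : Prop where
  pos : 0 < ε
  lt : ε < β
  conj : p.HolderConjugate q
  q_le : q ≤ γ
  p_le : p ≤ γ
  sing : (β + ε) / 2 * q < 1

variable {P} {ε β γ p q T T₁ : ℝ}

theorem Admissible.one_le (h : Admissible ε β γ p q) : 1 ≤ γ := h.conj.lt.le.trans h.p_le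

theorem Curve.prodC (h : Admissible ε β γ p q) (hT : T ≤ 1) {v b : ℝ → Freq → ℂ}
    (hv : Curve P β γ T v) (hb : Curve P (-ε) p T₁ b) :
    Curve P (-ε) 1 T fun t => prodC P (v t) (b t) where
  meas := measurable_prodC P hv.meas hb.meas
  zero t ht := by
    rw [hv.zero t ht]
    simpa using prodC_smul_left P 0 0 (b t)
  fin := by
    obtain ⟨C, hC, hC'⟩ := exists_bnorm_prodC_le_mul P h.pos h.lt
    have h1 := ENNReal.lintegral_mul_le_Lp_mul_Lq volume h.conj
      (measurable_bnorm_comp (P := P) (-ε) hb.meas).aemeasurable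
      (measurable_bnorm_comp (P := P) β hv.meas).aemeasurable
    have h2 := (hv.mono_exponent h.conj.symm.pos h.q_le hT).fin
    refine ne_top_of_le_ne_top ?_ (lpn_mono_ae zero_le_one
      (Eventually.of_forall fun t => hC' (v t) (b t)))
    rw [lpn_const_mul one_pos hC]
    refine ENNReal.mul_ne_top hC ?_
    rw [lpn_ne_top_iff one_pos]
    simp only [ENNReal.rpow_one]
    refine ne_top_of_le_ne_top (ENNReal.mul_ne_top hb.fin h2) (le_trans (le_of_eq ?_) h1)
    exact lintegral_congr fun t => mul_comm _ _

variable (P) in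
theorem exists_bnorm_duh_prodC_le (hε : 0 < ε) (hβ : ε < β) {s : ℝ} (hs : -ε ≤ s)
    (hs2 : s + ε ≤ 2) : ∃ C : ℝ≥0∞, C ≠ ⊤ ∧ ∀ (T : ℝ) (_ : T ≤ 1) (v b : ℝ → Freq → ℂ),
      (∀ l, Integrable fun t => prodC P (v t) (b t) l) → ∀ t ∈ Icc 0 T,
        bnorm P s (duh (fun r => prodC P (v r) (b r)) t) ≤
          ∫⁻ r, (C * kern ((s + ε) / 2) T (t - r)) *
            (bnorm P β (v r) * bnorm P (-ε) (b r)) := by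
  obtain ⟨C, hC, hC'⟩ := exists_bnorm_prodC_le_mul P hε hβ
  obtain ⟨D, hD, hD'⟩ := exists_bnorm_duh_le P (σ := s + ε) (by linarith) hs2
  refine ⟨D * C, ENNReal.mul_ne_top hD hC, fun T hT v b hi t ht => ?_⟩
  have h1 := hD' (-ε) T hT _ hi t ht
  rw [neg_add_cancel_comm_assoc] at h1
  refine h1.trans ?_
  rw [← lintegral_const_mul' _ _ hD]
  refine lintegral_mono fun r => ?_
  calc _ ≤ D * (kern ((s + ε) / 2) T (t - r) * (C * (bnorm P β (v r) * bnorm P (-ε) (b r)))) :=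
        mul_le_mul' le_rfl (mul_le_mul' le_rfl (hC' _ _))
    _ = _ := by ring

variable (P) in
/-- The bilinear operator `(v, b) ↦ ∫₀ᵗ e^{(t-s)Δ} (v(s) b(s)) ds` on `(0, T]`. -/
def bil (T : ℝ) (v b : ℝ → Freq → ℂ) : ℝ → Freq → ℂ :=
  (Ioc 0 T).indicator (duh fun s => prodC P (v s) (b s))

variable (P) in
theorem exists_bil_le (h : Admissible ε β γ p q) : ∃ C : ℝ≥0∞, C ≠ ⊤ ∧
    ∀ (T T₁ : ℝ) (_ : T ≤ 1) (v b : ℝ → Freq → ℂ), Curve P β γ T v → Curve P (-ε) p T₁ b →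
      (∀ t, bnorm P β (bil P T v b t) ≤ ∫⁻ r, (C * kern ((β + ε) / 2) T (t - r)) *
        (bnorm P β (v r) * bnorm P (-ε) (b r))) ∧
      lpn γ (fun t => bnorm P β (bil P T v b t)) ≤ C * lpn q (kern ((β + ε) / 2) T) *
        (lpn γ (fun t => bnorm P β (v t)) * lpn p (fun t => bnorm P (-ε) (b t))) := by
  have hq1 := h.conj.symm.lt
  have hs2 : β + ε ≤ 2 := by nlinarith [h.sing, h.pos, h.lt]
  obtain ⟨C, hC, hC'⟩ := exists_bnorm_duh_prodC_le P h.pos h.lt (s := β) (by linarith [h.pos, h.lt])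
    hs2
  refine ⟨C, hC, fun T T₁ hT v b hv hb => ?_⟩
  have h1 : ∀ t, bnorm P β (bil P T v b t) ≤ ∫⁻ r, (C * kern ((β + ε) / 2) T (t - r)) *
        (bnorm P β (v r) * bnorm P (-ε) (b r)) := by
    intro t
    by_cases ht : t ∈ Ioc 0 T
    · rw [bil, indicator_of_mem ht]
      exact hC' T hT v b ((hv.prodC h hT hb).integrable le_rfl hT) t (Ioc_subset_Icc_self ht)
    · rw [bil, indicator_of_notMem ht, bnorm_zero]
      exact zero_le
  refine ⟨h1, ?_⟩
  rw [← lpn_const_mul (by linarith) hC]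
  have hγ : 0 ≤ γ := zero_le_one.trans h.one_le
  refine (lpn_mono_ae hγ (Eventually.of_forall h1)).trans ?_
  exact lpn_conv_le h.conj h.q_le (k := fun τ => C * kern ((β + ε) / 2) T τ)
    ((measurable_kern _ _).const_mul C) (measurable_bnorm_comp β hv.meas)
    (measurable_bnorm_comp (-ε) hb.meas)

theorem Curve.bil (h : Admissible ε β γ p q) (hT0 : 0 < T) (hT : T ≤ 1) {v b : ℝ → Freq → ℂ}
    (hv : Curve P β γ T v) (hb : Curve P (-ε) p T₁ b) : Curve P β γ T (bil P T v b) where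
  meas := (measurable_duh ((hv.prodC h hT hb).integrable le_rfl hT)).indicator measurableSet_Ioc
  zero t ht := indicator_of_notMem ht _
  fin := by
    obtain ⟨C, hC, hC'⟩ := exists_bil_le P h
    refine ne_top_of_le_ne_top (ENNReal.mul_ne_top (ENNReal.mul_ne_top hC ?_)
      (ENNReal.mul_ne_top hv.fin hb.fin)) (hC' T T₁ hT v b hv hb).2
    exact (lpn_ne_top_iff h.conj.symm.pos).2 (lintegral_kern_rpow_ne_top hT0 h.conj.symm.pos h.sing)

theorem prodC_sub_left (hε : 0 < ε) (hβ : ε < β) {a a' b : Freq → ℂ} (ha : bnorm P β a < ⊤)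
    (ha' : bnorm P β a' < ⊤) (hb : bnorm P (-ε) b < ⊤) :
    prodC P (a - a') b = prodC P a b - prodC P a' b := by
  have h1 : a - a' = a + (-1 : ℂ) • a' := by rw [neg_one_smul, sub_eq_add_neg]
  have h2 : bnorm P β ((-1 : ℂ) • a') < ⊤ := by rwa [neg_one_smul, bnorm_neg]
  rw [h1, prodC_add_left P hε hβ ha h2 hb, prodC_smul_left, neg_one_smul, sub_eq_add_neg]

/-- The difference of two squares, in the form in which it is used for the nonlinearity. -/
theorem prodC_sub_prodC (hε : 0 < ε) (hβ : ε < β) {v w x : Freq → ℂ} (hv : bnorm P β v < ⊤)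
    (hw : bnorm P β w < ⊤) (hx : bnorm P (-ε) x < ⊤) :
    prodC P v (v + x) - prodC P w (w + x) = prodC P (v - w) (v + w + x) := by
  have hmono : ∀ {a}, bnorm P β a < ⊤ → bnorm P (-ε) a < ⊤ := fun {a} ha =>
    (bnorm_mono P (by linarith : -ε ≤ β) a).trans_lt
      (ENNReal.mul_lt_top ENNReal.ofReal_lt_top ha)
  have hadd : ∀ {a b}, bnorm P (-ε) a < ⊤ → bnorm P (-ε) b < ⊤ → bnorm P (-ε) (a + b) < ⊤ :=
    fun ha hb => (bnorm_add_le P _ _ _).trans_lt (ENNReal.add_lt_top.2 ⟨ha, hb⟩)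
  have e1 : v + w + x = w + (v + x) := by abel
  have e2 : w + (v + x) = v + (w + x) := by abel
  rw [e1, prodC_sub_left hε hβ hv hw (hadd (hmono hw) (hadd (hmono hv) hx)),
    prodC_add_right P hε hβ hv (hmono hw) (hadd (hmono hv) hx), e2,
    prodC_add_right P hε hβ hw (hmono hv) (hadd (hmono hw) hx), prodC_comm P v w]
  abel

theorem bil_sub_bil (h : Admissible ε β γ p q) (hTT : T ≤ T₁) (hT₁ : T₁ ≤ 1)
    {v w x : ℝ → Freq → ℂ} (hv : Curve P β γ T v) (hw : Curve P β γ T w)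
    (hx : Curve P (-ε) p T₁ x) :
    bil P T v (v + x) - bil P T w (w + x) = bil P T (v - w) (v + w + x) := by
  have hT : T ≤ 1 := hTT.trans hT₁
  have hp := h.conj.lt
  have hγ : 0 < γ := one_pos.trans_le h.one_le
  have hc : ∀ {u}, Curve P β γ T u → Curve P (-ε) p T₁ u := fun hu =>
    ((hu.mono_index hγ (by linarith [h.pos, h.lt])).mono_exponent (by linarith) h.p_le
      hT).mono_time hTT
  ext1 t
  rw [Pi.sub_apply]
  by_cases ht : t ∈ Ioc 0 T
  · simp only [bil, indicator_of_mem ht]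
    rw [← duh_sub ((hv.prodC h hT ((hc hv).add hp.le hx)).integrable le_rfl hT)
      ((hw.prodC h hT ((hc hw).add hp.le hx)).integrable le_rfl hT)]
    refine duh_congr ht.1.le (ae_restrict_of_ae ?_)
    filter_upwards [hv.ae_lt_top hγ, hw.ae_lt_top hγ, hx.ae_lt_top (by linarith)] with s h1 h2 h3
    exact prodC_sub_prodC h.pos h.lt h1 h2 h3
  · simp only [bil, indicator_of_notMem ht, sub_zero]

theorem Curve.lpn_neg_le (h : Admissible ε β γ p q) (hT : T ≤ 1) {v : ℝ → Freq → ℂ}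
    (hv : Curve P β γ T v) : lpn p (fun t => bnorm P (-ε) (v t)) ≤
      ENNReal.ofReal (2 ^ (β + ε)) * lpn γ (fun t => bnorm P β (v t)) := by
  have hγ : 0 < γ := one_pos.trans_le h.one_le
  have h1 : -ε ≤ β := by linarith [h.pos, h.lt]
  refine ((hv.mono_index hγ h1).lpn_le h.conj.pos h.p_le hT).trans ?_
  have := lpn_bnorm_mono (P := P) h1 hγ v
  rwa [sub_neg_eq_add] at this

variable (P) in
/-- Picard iteration: for short times, `v = U + B(v, v + x)` has a solution. -/
theorem exists_fixed_point (h : Admissible ε β γ p q) : ∃ A : ℝ≥0∞, A ≠ ⊤ ∧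
    ∀ (T T₁ : ℝ) (_ : 0 < T) (_ : T ≤ T₁) (_ : T₁ ≤ 1) (U x : ℝ → Freq → ℂ), Curve P β γ T U →
      Curve P (-ε) p T₁ x →
      A * lpn q (kern ((β + ε) / 2) T) *
        (lpn γ (fun t => bnorm P β (U t)) + lpn p (fun t => bnorm P (-ε) (x t))) ≤ 2⁻¹ →
      ∃ v, Curve P β γ T v ∧ v =ᵐ[volume] U + bil P T v (v + x) := by
  obtain ⟨C, hC, hC'⟩ := exists_bil_le P h
  obtain ⟨c, hc⟩ : ∃ c : ℝ≥0∞, c = ENNReal.ofReal (2 ^ (β + ε)) := ⟨_, rfl⟩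
  have hct : c ≠ ⊤ := hc ▸ ENNReal.ofReal_ne_top
  refine ⟨C * (8 * c + 1), ENNReal.mul_ne_top hC (by finiteness), ?_⟩
  intro T T₁ hT0 hTT hT₁ U x hU hx hsmall
  have hT : T ≤ 1 := hTT.trans hT₁
  have hp := h.conj.lt
  have hγ1 := h.one_le
  have hγ : 0 < γ := one_pos.trans_le h.one_le
  have hcv : ∀ {u}, Curve P β γ T u → Curve P (-ε) p T₁ u := fun hu =>
    ((hu.mono_index hγ (by linarith [h.pos, h.lt])).mono_exponent (by linarith) h.p_le
      hT).mono_time hTT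
  obtain ⟨N, hN⟩ : ∃ N : (ℝ → Freq → ℂ) → ℝ≥0∞, N = fun a => lpn γ fun t => bnorm P β (a t) :=
    ⟨_, rfl⟩
  obtain ⟨M, hM⟩ : ∃ M : (ℝ → Freq → ℂ) → ℝ≥0∞, M = fun a => lpn p fun t => bnorm P (-ε) (a t) :=
    ⟨_, rfl⟩
  have hN_add : ∀ {a b}, Measurable a → Measurable b → N (a + b) ≤ N a + N b := by
    subst hN; exact fun ha hb => lpn_bnorm_add_le β hγ1 ha hb
  have hM_add : ∀ {a b}, Measurable a → Measurable b → M (a + b) ≤ M a + M b := by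
    subst hM; exact fun ha hb => lpn_bnorm_add_le (-ε) hp.le ha hb
  have hMN : ∀ {a}, Curve P β γ T a → M a ≤ c * N a := by
    subst hN hM hc; exact fun ha => ha.lpn_neg_le h hT
  have hB : ∀ {v b}, Curve P β γ T v → Curve P (-ε) p T₁ b →
      N (bil P T v b) ≤ C * lpn q (kern ((β + ε) / 2) T) * (N v * M b) := by
    subst hN hM; exact fun hv hb => (hC' T T₁ hT _ _ hv hb).2
  have hNfin : ∀ {a}, Curve P β γ T a → N a ≠ ⊤ := by subst hN; exact fun ha => ha.fin
  replace hsmall : C * (8 * c + 1) * lpn q (kern ((β + ε) / 2) T) * (N U + M x) ≤ 2⁻¹ := by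
    subst hN hM; exact hsmall
  obtain ⟨κ, hκ⟩ : ∃ κ : ℝ≥0∞, κ = C * lpn q (kern ((β + ε) / 2) T) := ⟨_, rfl⟩
  rw [← hκ] at hB
  have hsm : ∀ {y}, y ≤ c * (4 * N U) + c * (4 * N U) + M x → κ * y ≤ 2⁻¹ := by
    intro y hy
    refine le_trans (mul_le_mul' le_rfl hy) (le_trans ?_ hsmall)
    calc κ * (c * (4 * N U) + c * (4 * N U) + M x) = κ * (8 * c * N U + 1 * M x) := by ring
      _ ≤ κ * ((8 * c + 1) * N U + (8 * c + 1) * M x) := by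
          gcongr
          · exact le_self_add
          · exact le_add_self
      _ = _ := by rw [hκ]; ring
  have hMvx : ∀ {v}, Curve P β γ T v → M (v + x) ≤ c * N v + M x := fun hv =>
    (hM_add hv.meas hx.meas).trans (by gcongr; exact hMN hv)
  -- the map is a contraction of the ball of radius `4 ‖U‖`
  let Φ : (ℝ → Freq → ℂ) → ℝ → Freq → ℂ := fun v => U + bil P T v (v + x)
  have hΦ : ∀ {v}, Curve P β γ T v → Curve P β γ T (Φ v) := fun hv =>
    hU.add hγ1 (hv.bil h hT0 hT ((hcv hv).add hp.le hx))
  have hball : ∀ {v}, Curve P β γ T v → N v ≤ 2 * N U → N (Φ v) ≤ 2 * N U := by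
    intro v hv hvU
    have hv4 : N v ≤ 4 * N U := hvU.trans (by gcongr; norm_num)
    have hvx := (hcv hv).add hp.le hx
    calc N (Φ v) ≤ N U + N (bil P T v (v + x)) := hN_add hU.meas (hv.bil h hT0 hT hvx).meas
      _ ≤ N U + κ * (N v * M (v + x)) := by gcongr; exact hB hv hvx
      _ = N U + κ * M (v + x) * N v := by ring
      _ ≤ N U + 2⁻¹ * (2 * N U) := by
          gcongr
          refine hsm ((hMvx hv).trans ?_)
          calc c * N v + M x ≤ c * (4 * N U) + M x := by gcongr
            _ ≤ _ := by rw [add_assoc]; exact le_add_self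
      _ = 2 * N U := by
          rw [← mul_assoc, ENNReal.inv_mul_cancel (by simp) (by simp), one_mul, two_mul]
  have hcontr : ∀ {v w}, Curve P β γ T v → Curve P β γ T w → N v ≤ 4 * N U → N w ≤ 4 * N U →
      N (Φ v - Φ w) ≤ 2⁻¹ * N (v - w) := by
    intro v w hv hw hvU hwU
    have e1 : Φ v - Φ w = bil P T (v - w) (v + w + x) := by
      rw [← bil_sub_bil h hTT hT₁ hv hw hx]
      exact add_sub_add_left_eq_sub _ _ _
    rw [e1]
    have hvwx := ((hcv hv).add hp.le (hcv hw)).add hp.le hx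
    calc _ ≤ κ * (N (v - w) * M (v + w + x)) := hB (hv.sub hγ1 hw) hvwx
      _ = κ * M (v + w + x) * N (v - w) := by ring
      _ ≤ _ := by
          gcongr
          refine hsm ((hM_add (hv.meas.add hw.meas) hx.meas).trans ?_)
          gcongr
          refine (hM_add hv.meas hw.meas).trans ?_
          gcongr
          · exact (hMN hv).trans (by gcongr)
          · exact (hMN hw).trans (by gcongr)
  let a : ℕ → ℝ → Freq → ℂ := fun n => Φ^[n] 0
  have hasucc : ∀ n, a (n + 1) = Φ (a n) := fun n => Function.iterate_succ_apply' Φ n 0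
  have hN0 : N 0 = 0 := by subst hN; simp [lpn, hγ]
  have ha0 : Curve P β γ T (a 0) :=
    { meas := measurable_const, zero := fun _ _ => rfl
      fin := by have : N (a 0) ≠ ⊤ := by { change N 0 ≠ ⊤; simp [hN0] }
                subst hN; exact this }
  have ha : ∀ n, Curve P β γ T (a n) ∧ N (a n) ≤ 2 * N U := by
    intro n
    induction n with
    | zero => exact ⟨ha0, by change N 0 ≤ _; rw [hN0]; exact zero_le⟩
    | succ n ih => rw [hasucc]; exact ⟨hΦ ih.1, hball ih.1 ih.2⟩
  have h24 : 2 * N U ≤ 4 * N U := by gcongr; norm_num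
  have hdiff : ∀ n, N (a (n + 1) - a n) ≤ 2 * N U * 2⁻¹ ^ n := by
    intro n
    induction n with
    | zero =>
      have : a 0 = 0 := rfl
      rw [this, sub_zero, pow_zero, mul_one]
      exact (ha 1).2
    | succ n ih =>
      have h1 := hcontr (ha (n + 1)).1 (ha n).1 ((ha _).2.trans h24) ((ha _).2.trans h24)
      rw [← hasucc, ← hasucc] at h1
      refine h1.trans ?_
      calc _ ≤ 2⁻¹ * (2 * N U * 2⁻¹ ^ n) := by gcongr
        _ = _ := by rw [pow_succ]; ring
  have hNU := hNfin hU
  obtain ⟨v, hv, hlim⟩ := exists_curve_limit P hγ1 (fun n => (ha n).1)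
    (C := 2 * N U) (by finiteness) (by subst hN; exact hdiff)
  replace hlim : ∀ n, N (v - a n) ≤ 2 * (2 * N U) * 2⁻¹ ^ n := by subst hN; exact hlim
  refine ⟨v, hv, ?_⟩
  have hvU : N v ≤ 4 * N U := by
    have h1 := hlim 0
    have : a 0 = 0 := rfl
    rw [this, sub_zero, pow_zero, mul_one] at h1
    exact h1.trans (le_of_eq (by ring))
  have hfix : ∀ n, N (v - Φ v) ≤ 4 * N U * 2⁻¹ ^ n := by
    intro n
    have e1 : v - Φ v = (v - a (n + 1)) + (Φ (a n) - Φ v) := by rw [hasucc]; abel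
    have h2 : N (a n - v) = N (v - a n) := by
      subst hN
      dsimp only
      congr 1
      ext t
      rw [← neg_sub, Pi.neg_apply, bnorm_neg]
    rw [e1]
    calc _ ≤ N (v - a (n + 1)) + N (Φ (a n) - Φ v) :=
          hN_add (hv.meas.sub (ha _).1.meas) ((hΦ (ha n).1).meas.sub (hΦ hv).meas)
      _ ≤ 2 * (2 * N U) * 2⁻¹ ^ (n + 1) + 2⁻¹ * (2 * (2 * N U) * 2⁻¹ ^ n) := by
          gcongr
          · exact hlim _
          · refine (hcontr (ha n).1 hv ((ha _).2.trans h24) hvU).trans ?_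
            rw [h2]
            gcongr
            exact hlim n
      _ = 4 * N U * (2⁻¹ ^ n * (2⁻¹ * 2)) := by rw [pow_succ]; ring
      _ = _ := by rw [ENNReal.inv_mul_cancel (by simp) (by simp), mul_one]
  have hzero : N (v - Φ v) = 0 := by
    refine le_antisymm (ge_of_tendsto' (x := atTop) ?_ hfix) zero_le
    have h1 : Tendsto (fun n : ℕ => (2⁻¹ : ℝ≥0∞) ^ n) atTop (𝓝 0) :=
      ENNReal.tendsto_pow_atTop_nhds_zero_of_lt_one (by simp)
    have h2 := ENNReal.Tendsto.const_mul (a := 4 * N U) h1 (Or.inr (by finiteness))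
    rwa [mul_zero] at h2
  have hae : ∀ᵐ t, bnorm P β ((v - Φ v) t) ^ γ = 0 := by
    subst hN
    have h1 := (ENNReal.rpow_eq_zero_iff_of_pos (by positivity)).1 hzero
    exact (lintegral_eq_zero_iff
      ((measurable_bnorm_comp β (hv.meas.sub (hΦ hv).meas)).pow_const γ)).1 h1
  filter_upwards [hae] with t ht
  have h1 := eq_zero_of_bnorm_eq_zero P ((ENNReal.rpow_eq_zero_iff_of_pos hγ).1 ht)
  exact sub_eq_zero.1 h1

/-- Uniqueness for the fixed point problem, without any smallness. -/
theorem ae_eq_of_fixed_point (h : Admissible ε β γ p q) (hT0 : 0 < T) (hTT : T ≤ T₁) (hT₁ : T₁ ≤ 1)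
    {U v w x : ℝ → Freq → ℂ} (hx : Curve P (-ε) p T₁ x) (hv : Curve P β γ T v)
    (hw : Curve P β γ T w) (hv' : v =ᵐ[volume] U + bil P T v (v + x))
    (hw' : w =ᵐ[volume] U + bil P T w (w + x)) : v =ᵐ[volume] w := by
  obtain ⟨C, hC, hC'⟩ := exists_bil_le P h
  have hT : T ≤ 1 := hTT.trans hT₁
  have hp := h.conj.lt
  have hγ1 := h.one_le
  have hγ : 0 < γ := one_pos.trans_le h.one_le
  have hq0 := h.conj.symm.pos
  have hcv : ∀ {u}, Curve P β γ T u → Curve P (-ε) p T₁ u := fun hu =>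
    ((hu.mono_index hγ (by linarith [h.pos, h.lt])).mono_exponent (by linarith) h.p_le
      hT).mono_time hTT
  have hvw := hv.sub hγ1 hw
  have hb := ((hcv hv).add hp.le (hcv hw)).add hp.le hx
  have key := ae_eq_zero_of_le_conv h.conj h.q_le (k := fun τ => C * kern ((β + ε) / 2) T τ)
    (y := fun t => bnorm P β ((v - w) t)) (g := fun t => bnorm P (-ε) ((v + w + x) t))
    ((measurable_kern _ _).const_mul C) (measurable_bnorm_comp β hvw.meas)
    (measurable_bnorm_comp (-ε) hb.meas) (fun s hs => by simp [kern_of_nonpos hs])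
    (by
      rw [← lpn_ne_top_iff hq0, lpn_const_mul hq0 hC]
      exact ENNReal.mul_ne_top hC ((lpn_ne_top_iff hq0).2
        (lintegral_kern_rpow_ne_top hT0 hq0 h.sing)))
    ((lpn_ne_top_iff (by linarith)).1 hb.fin)
    (fun s hs => by
      rw [hvw.zero s fun h' => absurd h'.1 (not_lt.2 hs), bnorm_zero])
    ((lpn_ne_top_iff hγ).1 hvw.fin) (by
      filter_upwards [hv', hw'] with t h1 h2
      refine le_trans (le_of_eq ?_) ((hC' T T₁ hT _ _ hvw hb).1 t)
      rw [← bil_sub_bil h hTT hT₁ hv hw hx, Pi.sub_apply, h1, h2, Pi.sub_apply, Pi.add_apply,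
        Pi.add_apply, add_sub_add_left_eq_sub])
  filter_upwards [key] with t ht
  exact sub_eq_zero.1 (eq_zero_of_bnorm_eq_zero P ht)

end

section

variable (P : DyadicPartition)

/-! ### Solutions on the level of Fourier coefficients -/

/-- The `L^q(0, T)` norm of the kernel `τ^{-θ}` tends to zero with `T`. -/
theorem exists_time_small {θ q : ℝ} (hq : 0 < q) (hθ : θ * q < 1) {K : ℝ≥0∞} (hK : K ≠ ⊤)
    {T₁ : ℝ} (hT₁ : 0 < T₁) :
    ∃ T₀, 0 < T₀ ∧ T₀ ≤ T₁ ∧ ∀ T, 0 < T → T ≤ T₀ → K * lpn q (kern θ T) ≤ 2⁻¹ := by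
  have ha : 0 < 1 - θ * q := by linarith
  have h1 : Tendsto (fun T : ℝ => T ^ (1 - θ * q) / (1 - θ * q)) (𝓝[>] 0) (𝓝 0) := by
    have h2 : Tendsto (fun T : ℝ => T ^ (1 - θ * q)) (𝓝[>] 0) (𝓝 (0 ^ (1 - θ * q))) :=
      ((Real.continuousAt_rpow_const 0 _ (Or.inr ha.le)).tendsto).mono_left nhdsWithin_le_nhds
    rw [Real.zero_rpow ha.ne'] at h2
    simpa using h2.div_const (1 - θ * q)
  have h3 : Tendsto (fun T : ℝ => K * ENNReal.ofReal (T ^ (1 - θ * q) / (1 - θ * q)) ^ (1 / q))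
      (𝓝[>] 0) (𝓝 0) := by
    have h4 := ENNReal.tendsto_ofReal h1
    rw [ENNReal.ofReal_zero] at h4
    have h5 := (ENNReal.continuous_rpow_const (y := 1 / q)).tendsto 0 |>.comp h4
    rw [ENNReal.zero_rpow_of_pos (by positivity)] at h5
    have h6 := ENNReal.Tendsto.const_mul (a := K) h5 (Or.inr hK)
    rwa [mul_zero] at h6
  obtain ⟨u, hu, hsub⟩ := mem_nhdsGT_iff_exists_Ioc_subset.1
    ((ENNReal.tendsto_nhds_zero.1 h3) 2⁻¹ (by simp))
  refine ⟨min u T₁, lt_min hu hT₁, min_le_right _ _, fun T h0 hT => ?_⟩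
  rw [lpn, lintegral_kern_rpow h0 hq hθ]
  exact hsub ⟨h0, hT.trans (min_le_left _ _)⟩

/-- Qualitative form of Young's convolution inequality. -/
theorem lpn_conv_ne_top {ϱ γ p q : ℝ} (hϱ : 0 < ϱ) (hpq : p.HolderConjugate q)
    (hq : q ≤ γ) (h : ϱ / γ + ϱ / p = 1) {k y : ℝ → ℝ≥0∞} (hk : Measurable k) (hy : Measurable y)
    (hk' : lpn q k ≠ ⊤) (hy' : lpn ϱ y ≠ ⊤) :
    lpn γ (fun t => ∫⁻ s, k (t - s) * y s) ≠ ⊤ := by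
  have hp0 := hpq.pos
  have hγ : 0 < γ := hpq.symm.pos.trans_le hq
  have h1 := lpn_conv_le hpq hq hk (hy.pow_const (ϱ / γ)) (hy.pow_const (ϱ / p))
  have e1 : ∀ s, y s ^ (ϱ / γ) * y s ^ (ϱ / p) = y s := fun s => by
    rw [← ENNReal.rpow_add_of_nonneg _ _ (by positivity) (by positivity), h, ENNReal.rpow_one]
  have e2 : ∀ z : ℝ, 0 < z → lpn z (fun s => y s ^ (ϱ / z)) ≠ ⊤ := fun z hz => by
    rw [lpn_ne_top_iff hz]
    simp_rw [← ENNReal.rpow_mul, div_mul_cancel₀ ϱ hz.ne']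
    exact (lpn_ne_top_iff hϱ).1 hy'
  simp_rw [e1] at h1
  exact ne_top_of_le_ne_top (ENNReal.mul_ne_top hk' (ENNReal.mul_ne_top (e2 γ hγ) (e2 p hp0))) h1

theorem le_rpow_inv {r : ℝ} (hr : 0 < r) {a m : ℝ≥0∞} (h : a ^ r ≤ m) : a ≤ m ^ (1 / r) := by
  rw [one_div, ENNReal.le_rpow_inv_iff hr]
  exact h

/-- Young's inequality for products, with constant one instead of the sharp constants. -/
theorem mul_le_rpow_add {p q : ℝ} (hp : 0 < p) (hq : 0 < q) (h : 1 / p + 1 / q = 1)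
    (a b : ℝ≥0∞) : a * b ≤ a ^ p + b ^ q := by
  obtain ⟨m, hm⟩ : ∃ m, m = a ^ p + b ^ q := ⟨_, rfl⟩
  have h1 : a ≤ m ^ (1 / p) := le_rpow_inv hp (hm ▸ le_self_add)
  have h2 : b ≤ m ^ (1 / q) := le_rpow_inv hq (hm ▸ le_add_self)
  rw [← hm]
  refine (mul_le_mul' h1 h2).trans ?_
  rw [← ENNReal.rpow_add_of_nonneg _ _ (by positivity) (by positivity), h, ENNReal.rpow_one]

theorem mul_mul_le_rpow_add {p q r : ℝ} (hp : 0 < p) (hq : 0 < q) (hr : 0 < r)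
    (h : 1 / p + (1 / q + 1 / r) = 1) (a b c : ℝ≥0∞) :
    a * (b * c) ≤ a ^ p + (b ^ q + c ^ r) := by
  obtain ⟨m, hm⟩ : ∃ m, m = a ^ p + (b ^ q + c ^ r) := ⟨_, rfl⟩
  have h1 : a ≤ m ^ (1 / p) := le_rpow_inv hp (hm ▸ le_self_add)
  have h2 : b ≤ m ^ (1 / q) := le_rpow_inv hq (hm ▸ le_self_add.trans le_add_self)
  have h3 : c ≤ m ^ (1 / r) := le_rpow_inv hr (hm ▸ le_add_self.trans le_add_self)
  rw [← hm]
  refine (mul_le_mul' h1 (mul_le_mul' h2 h3)).trans ?_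
  rw [← ENNReal.rpow_add_of_nonneg _ _ (by positivity) (by positivity),
    ← ENNReal.rpow_add_of_nonneg _ _ (by positivity) (by positivity), h, ENNReal.rpow_one]

theorem measurable_heatC (a : Freq → ℂ) : Measurable fun t => heatC t a := by
  refine measurable_pi_iff.2 fun l => ?_
  unfold heatC
  fun_prop

variable {P}

theorem curve_heatC {s σ γ T : ℝ} (hσ : 0 ≤ σ) (hσ2 : σ ≤ 2) (hγ : 0 < γ) (hσγ : σ / 2 * γ < 1)
    (hT0 : 0 < T) (hT : T ≤ 1) {u₀ : Freq → ℂ} (hu : bnorm P s u₀ < ⊤) :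
    Curve P (s + σ) γ T ((Ioc 0 T).indicator fun t => heatC t u₀) where
  meas := (measurable_heatC u₀).indicator measurableSet_Ioc
  zero t ht := indicator_of_notMem ht _
  fin := by
    obtain ⟨C, hC, hb⟩ := exists_bnorm_heatC_smoothing P
    have hc : C * bnorm P s u₀ ≠ ⊤ := ENNReal.mul_ne_top hC hu.ne
    refine ne_top_of_le_ne_top ?_ (lpn_mono_ae (g := fun t => C * bnorm P s u₀ * kern (σ / 2) T t)
      hγ.le (Eventually.of_forall fun t => ?_))
    · rw [lpn_const_mul hγ hc]
      exact ENNReal.mul_ne_top hc ((lpn_ne_top_iff hγ).2 (lintegral_kern_rpow_ne_top hT0 hγ hσγ))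
    · by_cases ht : t ∈ Ioc 0 T
      · rw [indicator_of_mem ht, kern, indicator_of_mem ht]
        exact (hb s σ t hσ hσ2 ht.1 (ht.2.trans hT) u₀).trans (le_of_eq (by ring))
      · rw [indicator_of_notMem ht, bnorm_zero]
        exact zero_le

theorem curve_duh {s σ ϱ γ p q T : ℝ} (hσ : 0 ≤ σ) (hσ2 : σ ≤ 2) (hϱ : 1 ≤ ϱ)
    (hpq : p.HolderConjugate q) (hq : q ≤ γ) (h : ϱ / γ + ϱ / p = 1) (hσq : σ / 2 * q < 1)
    (hT0 : 0 < T) (hT : T ≤ 1) {y : ℝ → Freq → ℂ} (hy : Curve P s ϱ T y) :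
    Curve P (s + σ) γ T ((Ioc 0 T).indicator (duh y)) where
  meas := (measurable_duh (hy.integrable hϱ hT)).indicator measurableSet_Ioc
  zero t ht := indicator_of_notMem ht _
  fin := by
    have hq0 := hpq.symm.pos
    have hγ : 0 < γ := hq0.trans_le hq
    obtain ⟨C, hC, hb⟩ := exists_bnorm_duh_le P hσ hσ2
    refine ne_top_of_le_ne_top ?_ (lpn_mono_ae (g := fun t => C *
      ∫⁻ r, kern (σ / 2) T (t - r) * bnorm P s (y r)) hγ.le (Eventually.of_forall fun t => ?_))
    · rw [lpn_const_mul hγ hC]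
      exact ENNReal.mul_ne_top hC (lpn_conv_ne_top (by linarith) hpq hq h (measurable_kern _ _)
        (measurable_bnorm_comp s hy.meas)
        ((lpn_ne_top_iff hq0).2 (lintegral_kern_rpow_ne_top hT0 hq0 hσq)) hy.fin)
    · by_cases ht : t ∈ Ioc 0 T
      · rw [indicator_of_mem ht]
        exact hb s T hT y (hy.integrable hϱ hT) t (Ioc_subset_Icc_self ht)
      · rw [indicator_of_notMem ht, bnorm_zero]
        exact zero_le

theorem lintegral_sub_left_rpow {k : ℝ → ℝ≥0∞} (r t : ℝ) :
    ∫⁻ s, k (t - s) ^ r = ∫⁻ s, k s ^ r :=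
  lintegral_sub_left_eq_self (fun s => k s ^ r) t

/-- A uniform bound for the Duhamel integral of a curve. -/
theorem exists_bnorm_duh_le_const {s σ ϱ q T : ℝ} (hσ : 0 ≤ σ) (hσ2 : σ ≤ 2) (hϱ : 1 ≤ ϱ)
    (hq : 0 < q) (h : 1 / q + 1 / ϱ = 1) (hσq : σ / 2 * q < 1) (hT0 : 0 < T) (hT : T ≤ 1)
    {y : ℝ → Freq → ℂ} (hy : Curve P s ϱ T y) :
    ∃ M : ℝ≥0∞, M ≠ ⊤ ∧ ∀ t ∈ Icc 0 T, bnorm P (s + σ) (duh y t) ≤ M := by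
  obtain ⟨C, hC, hb⟩ := exists_bnorm_duh_le P hσ hσ2
  have hϱ0 : 0 < ϱ := by linarith
  refine ⟨C * ((∫⁻ r, kern (σ / 2) T r ^ q) + ∫⁻ r, bnorm P s (y r) ^ ϱ),
    ENNReal.mul_ne_top hC (ENNReal.add_ne_top.2 ⟨lintegral_kern_rpow_ne_top hT0 hq hσq,
      (lpn_ne_top_iff hϱ0).1 hy.fin⟩), fun t ht => ?_⟩
  refine (hb s T hT y (hy.integrable hϱ hT) t ht).trans (mul_le_mul' le_rfl ?_)
  refine (lintegral_mono fun r => mul_le_rpow_add hq hϱ0 h _ _).trans (le_of_eq ?_)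
  rw [lintegral_add_right _ ((measurable_bnorm_comp s hy.meas).pow_const ϱ),
    lintegral_sub_left_rpow]

/-- A uniform bound for the Duhamel integral of a product. -/
theorem exists_bnorm_duh_prodC_le_const {ε β γ p q T T₁ s r : ℝ} (h : Admissible ε β γ p q)
    (hs : -ε ≤ s) (hs2 : s + ε ≤ 2) (hr : 0 < r) (hrpq : 1 / r + (1 / γ + 1 / p) = 1)
    (hsr : (s + ε) / 2 * r < 1) (hT0 : 0 < T) (hT : T ≤ 1) {v b : ℝ → Freq → ℂ}
    (hv : Curve P β γ T v) (hb : Curve P (-ε) p T₁ b) :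
    ∃ M : ℝ≥0∞, M ≠ ⊤ ∧ ∀ t ∈ Icc 0 T,
      bnorm P s (duh (fun r => prodC P (v r) (b r)) t) ≤ M := by
  obtain ⟨C, hC, hbd⟩ := exists_bnorm_duh_prodC_le P h.pos h.lt hs hs2
  have hγ : 0 < γ := one_pos.trans_le h.one_le
  have hp := h.conj.pos
  refine ⟨C * ((∫⁻ τ, kern ((s + ε) / 2) T τ ^ r) + ((∫⁻ τ, bnorm P β (v τ) ^ γ) +
    ∫⁻ τ, bnorm P (-ε) (b τ) ^ p)), ENNReal.mul_ne_top hC (ENNReal.add_ne_top.2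
      ⟨lintegral_kern_rpow_ne_top hT0 hr hsr, ENNReal.add_ne_top.2 ⟨(lpn_ne_top_iff hγ).1 hv.fin,
        (lpn_ne_top_iff hp).1 hb.fin⟩⟩), fun t ht => ?_⟩
  refine (hbd T hT v b ((hv.prodC h hT hb).integrable le_rfl hT) t ht).trans ?_
  simp_rw [mul_assoc]
  rw [lintegral_const_mul' _ _ hC]
  refine mul_le_mul' le_rfl ?_
  refine (lintegral_mono fun τ => mul_mul_le_rpow_add hr hγ hp hrpq _ _ _).trans (le_of_eq ?_)
  have m1 := (measurable_bnorm_comp (P := P) β hv.meas).pow_const γ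
  have m2 := (measurable_bnorm_comp (P := P) (-ε) hb.meas).pow_const p
  have m12 : Measurable fun τ => bnorm P β (v τ) ^ γ + bnorm P (-ε) (b τ) ^ p := m1.add m2
  rw [lintegral_add_right _ m12, lintegral_add_right _ m2, lintegral_sub_left_rpow]

variable (P) in
/-- The right hand side of the mild equation, `e^{tΔ} u₀ + ∫₀ᵗ e^{(t-s)Δ} (v (v + x) + y)(s) ds`. -/
def mild (x y : ℝ → Freq → ℂ) (u₀ : Freq → ℂ) (v : ℝ → Freq → ℂ) (t : ℝ) : Freq → ℂ :=
  heatC t u₀ + duh ((fun s => prodC P (v s) ((v + x) s)) + y) t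

theorem indicator_mild {ε β γ p q ϱ T T₁ : ℝ} (h : Admissible ε β γ p q) (hTT : T ≤ T₁)
    (hT₁ : T₁ ≤ 1) {s : ℝ} {x y v : ℝ → Freq → ℂ} (u₀ : Freq → ℂ) (hϱ : 1 ≤ ϱ)
    (hx : Curve P (-ε) p T₁ x) (hy : Curve P s ϱ T₁ y) (hv : Curve P β γ T v) :
    (Ioc 0 T).indicator (mild P x y u₀ v) =
      ((Ioc 0 T).indicator (fun t => heatC t u₀) + (Ioc 0 T).indicator (duh y)) +
        bil P T v (v + x) := by
  have hp := h.conj.lt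
  have hT := hTT.trans hT₁
  have hγ : 0 < γ := one_pos.trans_le h.one_le
  have hvx : Curve P (-ε) p T₁ (v + x) :=
    (((hv.mono_index hγ (by linarith [h.pos, h.lt])).mono_exponent (by linarith) h.p_le
      hT).mono_time hTT).add hp.le hx
  ext1 t
  simp only [Pi.add_apply, bil]
  by_cases ht : t ∈ Ioc 0 T
  · simp only [indicator_of_mem ht, mild]
    rw [duh_add ((hv.prodC h hT hvx).integrable le_rfl hT) (hy.integrable hϱ hT₁),
      add_assoc, add_comm (duh y t)]
    rfl
  · simp only [indicator_of_notMem ht, add_zero]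

end

section

variable (P : DyadicPartition)

/-- The exponents `p = 2/(1-ε)` and `q = 2/(1+ε)` are admissible as soon as `ε < β < 1`. -/
theorem admissible {ε β γ : ℝ} (hε : 0 < ε) (hβ : ε < β) (hβ1 : β < 1)
    (hγ : 2 / (1 - ε) < γ) : Admissible ε β γ (2 / (1 - ε)) (2 / (1 + ε)) where
  pos := hε
  lt := hβ
  conj := by
    rw [Real.holderConjugate_iff]
    refine ⟨(one_lt_div (by linarith)).2 (by linarith), ?_⟩
    rw [inv_div, inv_div]
    ring
  q_le := le_trans (div_le_div_of_nonneg_left (by norm_num) (by linarith) (by linarith)) hγ.le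
  p_le := hγ.le
  sing := by
    rw [div_mul_div_cancel₀ two_ne_zero, div_lt_one (by linarith)]
    linarith

variable {P} {ε γ δ T₁ : ℝ} {x y : ℝ → Freq → ℂ} {u₀ : Freq → ℂ}

variable (P) in
/-- Existence for the mild equation on the level of Fourier coefficients. The solution is
slightly more regular than required in space, which makes it strongly measurable and continuous
with values in the (inseparable) spaces in question. -/
theorem exists_mild_solution (hε : 0 < ε) (hε' : ε < 1 / 2) (hγ : 2 / (1 - ε) < γ)
    (hδ : 0 < δ) (hδ' : δ < 2 / γ - ε) (hT₁0 : 0 < T₁) (hT₁ : T₁ ≤ 1)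
    (hx : Curve P (-ε) (2 / (1 - ε)) T₁ x) (hy : Curve P (-(2 * ε)) (1 / (1 - ε)) T₁ y)
    (hu : bnorm P (2 / γ - δ) u₀ < ⊤) :
    ∃ T₀, 0 < T₀ ∧ T₀ ≤ T₁ ∧ ∀ T, 0 < T → T ≤ T₀ → ∃ v, Curve P (2 / γ - δ / 2) γ T v ∧
      (∀ᵐ t, t ∈ Ioc 0 T → v t = mild P x y u₀ v t) ∧
      ∃ (s : ℝ) (M : ℝ≥0∞), -δ < s ∧ M ≠ ⊤ ∧ ∀ t ∈ Icc 0 T, bnorm P s (mild P x y u₀ v t) ≤ M := by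
  have h1ε : 0 < 1 - ε := by linarith
  have hγ0 : 0 < γ := lt_trans (by positivity) hγ
  have hγinv : 2 / γ < 1 - ε := by rwa [div_lt_comm₀ hγ0 h1ε]
  -- in terms of `g = 1 / γ` all conditions on the exponents are linear
  obtain ⟨g, hg⟩ : ∃ g, g = 1 / γ := ⟨_, rfl⟩
  have hg0 : 0 < g := hg ▸ by positivity
  have h2g : 2 / γ = 2 * g := by rw [hg]; ring
  have hgγ : g * γ = 1 := by rw [hg]; field_simp
  rw [h2g] at hδ' hu hγinv ⊢
  have hadm : Admissible ε (2 * g - δ / 2) γ (2 / (1 - ε)) (2 / (1 + ε)) :=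
    admissible hε (by linarith) (by linarith) hγ
  have hϱ : 1 ≤ 1 / (1 - ε) := by rw [le_div_iff₀ h1ε]; linarith
  -- the exponents in Young's inequality `L^{1/(ε+g)} * L^{1/(1-ε)} ⊆ L^γ` for the source term `y`
  have hconj : (1 / (1 - ε - g)).HolderConjugate (1 / (ε + g)) := by
    rw [Real.holderConjugate_iff]
    refine ⟨by rw [lt_div_iff₀] <;> linarith, ?_⟩
    rw [one_div, one_div, inv_inv, inv_inv]
    ring
  obtain ⟨U, hU⟩ : ∃ U : ℝ → ℝ → Freq → ℂ, U = fun T => (Ioc 0 T).indicator (fun t => heatC t u₀) +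
    (Ioc 0 T).indicator (duh y) := ⟨_, rfl⟩
  have hUc : Curve P (2 * g - δ / 2) γ T₁ (U T₁) := by
    rw [hU]
    refine Curve.add hadm.one_le ?_ ?_
    · have e : 2 * g - δ / 2 = (2 * g - δ) + δ / 2 := by ring
      rw [e]
      refine curve_heatC (by linarith) (by linarith) hγ0 ?_ hT₁0 hT₁ hu
      nlinarith
    · have e : 2 * g - δ / 2 = -(2 * ε) + (2 * g - δ / 2 + 2 * ε) := by ring
      rw [e]
      refine curve_duh (p := 1 / (1 - ε - g)) (q := 1 / (ε + g)) (by linarith) (by linarith) hϱ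
        hconj ?_ ?_ ?_ hT₁0 hT₁ hy
      · rw [div_le_iff₀ (by linarith)]
        nlinarith
      · have : 1 / (1 - ε) / γ = g / (1 - ε) := by rw [hg]; ring
        rw [this, div_div_eq_mul_div, div_one, one_div_mul_eq_div, ← add_div,
          div_eq_one_iff_eq h1ε.ne']
        ring
      · rw [mul_one_div, div_lt_one (by linarith)]
        linarith
  obtain ⟨A, hA, hfix⟩ := exists_fixed_point P hadm
  obtain ⟨T₀, hT₀, hT₀₁, hsmall⟩ := exists_time_small hadm.conj.symm.pos hadm.sing
    (ENNReal.mul_ne_top hA (ENNReal.add_ne_top.2 ⟨hUc.fin, hx.fin⟩)) hT₁0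
  refine ⟨T₀, hT₀, hT₀₁, fun T hT0 hTT => ?_⟩
  have hT₁' : T ≤ T₁ := hTT.trans hT₀₁
  have hT := hT₁'.trans hT₁
  have hUT : U T = (Ioc 0 T).indicator (U T₁) := by
    rw [hU]
    ext1 t
    by_cases ht : t ∈ Ioc 0 T
    · have ht' : t ∈ Ioc 0 T₁ := ⟨ht.1, ht.2.trans hT₁'⟩
      simp only [Pi.add_apply, indicator_of_mem ht, indicator_of_mem ht']
    · simp only [Pi.add_apply, indicator_of_notMem ht, add_zero]
  have hUTc : Curve P (2 * g - δ / 2) γ T (U T) := hUT ▸ hUc.indicator T hγ0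
  obtain ⟨v, hv, hveq⟩ := hfix T T₁ hT0 hT₁' hT₁ (U T) x hUTc hx (by
    refine le_trans ?_ (hsmall T hT0 hTT)
    rw [mul_assoc, mul_assoc, mul_comm (lpn _ _)]
    refine mul_le_mul' le_rfl (mul_le_mul' (add_le_add ?_ le_rfl) le_rfl)
    rw [hUT]
    refine lpn_mono_ae hγ0.le (Eventually.of_forall fun t => ?_)
    by_cases ht : t ∈ Ioc 0 T
    · rw [indicator_of_mem ht]
    · rw [indicator_of_notMem ht, bnorm_zero]
      exact zero_le)
  have hϱy := hy.integrable hϱ hT₁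
  have hvx : Curve P (-ε) (2 / (1 - ε)) T₁ (v + x) :=
    (((hv.mono_index hγ0 (by linarith)).mono_exponent hadm.conj.pos hadm.p_le hT).mono_time
      hT₁').add hadm.conj.lt.le hx
  refine ⟨v, hv, ?_, ?_⟩
  · rw [hU] at hveq
    have := indicator_mild hadm hT₁' hT₁ u₀ hϱ hx hy hv
    rw [← this] at hveq
    filter_upwards [hveq] with t ht htm
    rw [ht, indicator_of_mem htm]
  -- the bound in `B^{-d}`: any `0 < d < δ` keeps the powers of the kernels integrable, and `d ≤ ε`
  -- makes the regularity at least that of the product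
  · obtain ⟨d, hd⟩ : ∃ d, d = min (δ / 2) ε := ⟨_, rfl⟩
    have hd0 : 0 < d := hd ▸ lt_min (by linarith) hε
    have hdδ : d ≤ δ / 2 := hd ▸ min_le_left _ _
    have hdε : d ≤ ε := hd ▸ min_le_right _ _
    obtain ⟨M₁, hM₁, hb₁⟩ := exists_bnorm_duh_prodC_le_const hadm (s := -d)
      (r := 1 / ((1 + ε) / 2 - g)) (by linarith) (by linarith)
      (one_div_pos.2 (by linarith)) (by rw [one_div_one_div, ← hg, one_div_div]; ring)
      (by rw [mul_one_div, div_lt_one (by linarith)]; linarith) hT0 hT hv hvx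
    obtain ⟨M₂, hM₂, hb₂⟩ := exists_bnorm_duh_le_const (s := -(2 * ε)) (σ := 2 * ε - d)
      (q := 1 / ε) (by linarith) (by linarith) hϱ (by positivity)
      (by rw [one_div_one_div, one_div_one_div]; ring)
      (by rw [mul_one_div, div_lt_one hε]; linarith) hT₁0 hT₁ hy
    obtain ⟨C, hC, hheat⟩ := exists_bnorm_heatC_le P
    have hud : bnorm P (-d) u₀ ≠ ⊤ := ((bnorm_mono P (by linarith : -d ≤ 2 * g - δ) u₀).trans_lt
      (ENNReal.mul_lt_top ENNReal.ofReal_lt_top hu)).ne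
    refine ⟨-d, C * bnorm P (-d) u₀ + (M₁ + M₂), by linarith, by finiteness, fun t ht => ?_⟩
    rw [mild, duh_add ((hv.prodC hadm hT hvx).integrable le_rfl hT) hϱy]
    refine (bnorm_add_le P _ _ _).trans (add_le_add (hheat _ _ ht.1 _) ?_)
    refine (bnorm_add_le P _ _ _).trans (add_le_add (hb₁ t ht) ?_)
    have := hb₂ t ⟨ht.1, ht.2.trans hT₁'⟩
    rwa [show -(2 * ε) + (2 * ε - d) = -d by ring] at this

/-- Uniqueness for the mild equation on the level of Fourier coefficients. -/
theorem ae_eq_of_mild (hε : 0 < ε) (hε' : ε < 1 / 2) (hγ : 2 / (1 - ε) < γ)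
    (hδ : 0 < δ) (hδ' : δ < 2 / γ - ε) (hT₁ : T₁ ≤ 1)
    (hx : Curve P (-ε) (2 / (1 - ε)) T₁ x) (hy : Curve P (-(2 * ε)) (1 / (1 - ε)) T₁ y)
    {T : ℝ} (hT0 : 0 < T) (hTT : T ≤ T₁) {v w : ℝ → Freq → ℂ}
    (hv : Curve P (2 / γ - δ) γ T v) (hw : Curve P (2 / γ - δ) γ T w)
    (hv' : ∀ᵐ t, t ∈ Ioc 0 T → v t = mild P x y u₀ v t)
    (hw' : ∀ᵐ t, t ∈ Ioc 0 T → w t = mild P x y u₀ w t) : v =ᵐ[volume] w := by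
  have h1ε : 0 < 1 - ε := by linarith
  have hγ0 : 0 < γ := lt_trans (by positivity) hγ
  have hγinv : 2 / γ < 1 - ε := by rwa [div_lt_comm₀ hγ0 h1ε]
  have hadm : Admissible ε (2 / γ - δ) γ (2 / (1 - ε)) (2 / (1 + ε)) :=
    admissible hε (by linarith) (by linarith) hγ
  have hϱ : 1 ≤ 1 / (1 - ε) := by rw [le_div_iff₀ h1ε]; linarith
  have key : ∀ {u}, Curve P (2 / γ - δ) γ T u →
      (∀ᵐ t, t ∈ Ioc 0 T → u t = mild P x y u₀ u t) → u =ᵐ[volume]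
        ((Ioc 0 T).indicator (fun t => heatC t u₀) + (Ioc 0 T).indicator (duh y)) +
        bil P T u (u + x) := by
    intro u hu hu'
    rw [← indicator_mild hadm hTT hT₁ u₀ hϱ hx hy hu]
    filter_upwards [hu'] with t ht
    by_cases htm : t ∈ Ioc 0 T
    · rw [indicator_of_mem htm, ht htm]
    · rw [indicator_of_notMem htm, hu.zero t htm]
  exact ae_eq_of_fixed_point hadm hT0 hTT hT₁ hx hv hw (key hv hv') (key hw hw')

end

section

variable (P : DyadicPartition)

/-! ### Curves of coefficients and curves of distributions -/

variable {P} in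
theorem enorm_besov {s : ℝ} (f : Besov P s) : ‖f‖ₑ = bnorm P s (fourierCoef f.toDist) := by
  rw [← ofReal_norm]
  exact ENNReal.ofReal_toReal (show besovENorm P s f.toDist < ⊤ from f.2).ne

/-- The element of the Besov space with given Fourier coefficients of finite norm. -/
def mkBesov (s : ℝ) (a : Freq → ℂ) (h : bnorm P s a < ⊤) : Besov P s :=
  ⟨(polyBdd_of_bnorm_lt_top P h).toDist,
    lt_of_eq_of_lt (congrArg (bnorm P s) (fourierCoef_toDist (polyBdd_of_bnorm_lt_top P h))) h⟩

@[simp] theorem fourierCoef_mkBesov {s : ℝ} {a : Freq → ℂ} (h : bnorm P s a < ⊤) :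
    fourierCoef (mkBesov P s a h).toDist = a :=
  fourierCoef_toDist (polyBdd_of_bnorm_lt_top P h)

theorem edist_besov {s : ℝ} (f g : Besov P s) :
    edist f g = bnorm P s (fourierCoef f.toDist - fourierCoef g.toDist) := by
  rw [edist_eq_enorm_sub, enorm_besov]
  rfl

theorem continuous_coef (s : ℝ) (l : Freq) :
    Continuous fun f : Besov P s => fourierCoef f.toDist l := by
  obtain ⟨C, K, hC, hb⟩ := exists_enorm_coef_le P s
  rw [continuous_iff_continuousAt]
  intro f
  rw [ContinuousAt, tendsto_iff_edist_tendsto_0]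
  have h1 : Tendsto (fun g : Besov P s => ENNReal.ofReal (C * (1 + ‖latticePoint l‖) ^ K) *
      edist g f) (𝓝 f) (𝓝 0) := by
    have h2 := ENNReal.Tendsto.const_mul (a := ENNReal.ofReal (C * (1 + ‖latticePoint l‖) ^ K))
      (tendsto_iff_edist_tendsto_0.1 (tendsto_id (x := 𝓝 f))) (Or.inr ENNReal.ofReal_ne_top)
    rwa [mul_zero] at h2
  refine tendsto_of_tendsto_of_tendsto_of_le_of_le tendsto_const_nhds h1 (fun _ => zero_le)
    fun g => ?_
  dsimp only
  rw [edist_besov, edist_eq_enorm_sub]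
  exact hb _ l

theorem bnorm_single_lt_top (s : ℝ) (l : Freq) : bnorm P s (Pi.single l 1) < ⊤ := by
  obtain ⟨m, hm⟩ : ∃ m : ℕ, ‖latticePoint l‖ < 2 ^ m := pow_unbounded_of_one_lt _ one_lt_two
  have h1 : bnorm P s (Pi.single l 1) ≤ ∑ j ∈ Finset.range (m + 1),
      ENNReal.ofReal ((2 : ℝ) ^ (((j : ℝ) - 1) * s)) * bsup P j (Pi.single l 1) := by
    rw [bnorm_le_iff]
    intro j
    by_cases hj : j ∈ Finset.range (m + 1)
    · exact Finset.single_le_sum (f := fun j : ℕ => ENNReal.ofReal ((2 : ℝ) ^ (((j : ℝ) - 1) * s)) *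
        bsup P j (Pi.single l 1)) (fun _ _ => zero_le) hj
    · have h2 : blkC P j (Pi.single l 1) = 0 := by
        ext l'
        by_cases hl : l' = l
        · subst hl
          rw [blkC, symbol_eq_zero_of_lt P hm j (by simpa using hj)]
          simp
        · simp [blkC, hl]
      have h3 : bsup P j (Pi.single l 1) = 0 := by
        rw [bsup, h2]
        simp [synth]
      rw [h3, mul_zero]
      exact zero_le
  exact h1.trans_lt (ENNReal.sum_lt_top.2 fun j _ =>
    ENNReal.mul_lt_top ENNReal.ofReal_lt_top (bsup_lt_top P j _))

theorem bnorm_le_sum_single (s : ℝ) {c : Freq → ℂ} {S : Finset Freq} (h : ∀ l ∉ S, c l = 0) :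
    bnorm P s c ≤ ∑ l ∈ S, ‖c l‖ₑ * bnorm P s (Pi.single l 1) := by
  have h1 : c = ∑ l ∈ S, c l • Pi.single l (1 : ℂ) := by
    ext l'
    simp only [Finset.sum_apply, Pi.smul_apply, smul_eq_mul, Pi.single_apply, mul_ite, mul_one,
      mul_zero]
    rw [Finset.sum_ite_eq]
    split_ifs with hl
    · rfl
    · exact h l' hl
  have h2 : ∀ S' : Finset Freq, bnorm P s (∑ l ∈ S', c l • Pi.single l (1 : ℂ)) ≤
      ∑ l ∈ S', ‖c l‖ₑ * bnorm P s (Pi.single l 1) := by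
    intro S'
    induction S' using Finset.induction_on with
    | empty => simp
    | insert l S' hl ih =>
      rw [Finset.sum_insert hl, Finset.sum_insert hl]
      refine (bnorm_add_le P s _ _).trans (add_le_add (le_of_eq (bnorm_smul P s _ _)) ih)
  conv_lhs => rw [h1]
  exact h2 S

/-- The frequencies that are kept by `lowC N`. -/
def lowFreq (N : ℕ) : Finset Freq :=
  (Finset.range N).biUnion fun m => (symbol_finite P m).toFinset

theorem lowC_eq_zero {N : ℕ} {l : Freq} (h : l ∉ lowFreq P N) (a : Freq → ℂ) : lowC P N a l = 0 := by
  refine Finset.sum_eq_zero fun m hm => blkC_eq_zero_of_notMem P (fun hl => h ?_) a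
  exact Finset.mem_biUnion.2 ⟨m, hm, hl⟩

theorem bnorm_lowC_lt_top (s : ℝ) (N : ℕ) (a : Freq → ℂ) : bnorm P s (lowC P N a) < ⊤ :=
  (bnorm_le_sum_single P s fun _ hl => lowC_eq_zero P hl a).trans_lt
    (ENNReal.sum_lt_top.2 fun l _ => ENNReal.mul_lt_top enorm_lt_top (bnorm_single_lt_top P s l))

theorem lowC_sub (N : ℕ) (a b : Freq → ℂ) : lowC P N (a - b) = lowC P N a - lowC P N b := by
  ext l
  simp [lowC, blkC, mul_sub, Finset.sum_sub_distrib]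

theorem continuous_lowC_besov (s : ℝ) (N : ℕ) :
    Continuous fun a : Freq → ℂ => mkBesov P s (lowC P N a) (bnorm_lowC_lt_top P s N a) := by
  rw [continuous_iff_continuousAt]
  intro b
  rw [ContinuousAt, tendsto_iff_edist_tendsto_0]
  have h1 : Tendsto (fun a : Freq → ℂ => ∑ l ∈ lowFreq P N,
      ‖lowC P N (a - b) l‖ₑ * bnorm P s (Pi.single l 1)) (𝓝 b) (𝓝 0) := by
    rw [← Finset.sum_const_zero (s := lowFreq P N)]
    refine tendsto_finsetSum _ fun l _ => ?_
    have h2 : Continuous fun a : Freq → ℂ => ‖lowC P N (a - b) l‖ₑ := by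
      simp only [lowC, blkC, Pi.sub_apply]
      fun_prop
    have h3 := ENNReal.Tendsto.mul_const (b := bnorm P s (Pi.single l 1)) (h2.tendsto b)
      (Or.inr (bnorm_single_lt_top P s l).ne)
    simpa [lowC, blkC] using h3
  refine tendsto_of_tendsto_of_tendsto_of_le_of_le tendsto_const_nhds h1 (fun _ => zero_le)
    fun a => ?_
  dsimp only
  rw [edist_besov, fourierCoef_mkBesov, fourierCoef_mkBesov, ← lowC_sub]
  exact bnorm_le_sum_single P s fun l hl => lowC_eq_zero P hl _

theorem ae_restrict_Icc_iff {T : ℝ} {p : ℝ → Prop} :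
    (∀ᵐ t ∂(volume.restrict (Icc 0 T)), p t) ↔ ∀ᵐ t : ℝ, t ∈ Ioc 0 T → p t := by
  rw [← restrict_Ioc_eq_restrict_Icc, ae_restrict_iff' measurableSet_Ioc]

/-- The Fourier coefficients of a strongly measurable Besov valued function have a representative
that is measurable everywhere and vanishes outside `(0, T₁]`. -/
theorem exists_curve_of_memLpBesov {s p T T₁ : ℝ} (hp : 0 < p) (hT : T₁ ≤ T) {f : ℝ → Dist}
    (h : MemLpBesov P s (ENNReal.ofReal p) T f) :
    ∃ a, Curve P s p T₁ a ∧ ∀ᵐ t, t ∈ Ioc 0 T₁ → fourierCoef (f t) = a t := by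
  obtain ⟨w, hw, hfw⟩ := h
  obtain ⟨w', hw', hww'⟩ := hw.1
  have hmeas : Measurable fun t => fourierCoef (w' t).toDist := measurable_pi_iff.2 fun l =>
    ((continuous_coef P s l).comp_stronglyMeasurable hw').measurable
  refine ⟨(Ioc 0 T₁).indicator fun t => fourierCoef (w' t).toDist,
    ⟨hmeas.indicator measurableSet_Ioc, fun t ht => indicator_of_notMem ht _, ?_⟩, ?_⟩
  · rw [lpn_ne_top_iff hp]
    have h1 : MemLp w' (ENNReal.ofReal p) (volume.restrict (Icc 0 T)) := hw.ae_eq hww'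
    have h2 := lintegral_rpow_enorm_lt_top_of_eLpNorm_lt_top
      (by simpa using hp) ENNReal.ofReal_ne_top h1.2
    rw [ENNReal.toReal_ofReal hp.le, ← restrict_Ioc_eq_restrict_Icc,
      ← lintegral_indicator measurableSet_Ioc] at h2
    refine ne_top_of_le_ne_top h2.ne (lintegral_mono fun t => ?_)
    by_cases ht : t ∈ Ioc 0 T₁
    · have ht' : t ∈ Ioc 0 T := ⟨ht.1, ht.2.trans hT⟩
      rw [indicator_of_mem ht, indicator_of_mem ht', enorm_besov]
    · rw [indicator_of_notMem ht, bnorm_zero, ENNReal.zero_rpow_of_pos hp]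
      exact zero_le
  · have h1 := ae_restrict_Icc_iff.1 hfw
    have h2 := ae_restrict_Icc_iff.1 hww'
    filter_upwards [h1, h2] with t h1 h2 ht
    have ht' : t ∈ Ioc 0 T := ⟨ht.1, ht.2.trans hT⟩
    rw [indicator_of_mem ht, h1 ht', h2 ht']

/-- A measurable curve is strongly measurable in every Besov space of lower regularity, as a limit
of its low frequency truncations. -/
theorem memLpBesov_of_curve {s η r T : ℝ} (hη : 0 < η) (hr : 0 < r) {a : ℝ → Freq → ℂ}
    (ha : Curve P (s + η) r T a) {f : ℝ → Dist}
    (hf : ∀ᵐ t, t ∈ Ioc 0 T → fourierCoef (f t) = a t) :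
    MemLpBesov P s (ENNReal.ofReal r) T f := by
  classical
  have has := ha.mono_index hr (by linarith : s ≤ s + η)
  let w : ℝ → Besov P s := fun t =>
    if h : bnorm P s (a t) < ⊤ then mkBesov P s (a t) h else 0
  have hw : ∀ᵐ t, fourierCoef (w t).toDist = a t := by
    filter_upwards [has.ae_lt_top hr] with t ht
    simp only [w, dif_pos ht, fourierCoef_mkBesov]
  refine ⟨w, ⟨?_, ?_⟩, ?_⟩
  · refine aestronglyMeasurable_of_tendsto_ae atTop (f := fun N t =>
      mkBesov P s (lowC P (N + 1) (a t)) (bnorm_lowC_lt_top P s (N + 1) (a t))) (fun N =>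
        ((continuous_lowC_besov P s (N + 1)).comp_stronglyMeasurable
          ha.meas.stronglyMeasurable).aestronglyMeasurable) (ae_restrict_of_ae ?_)
    filter_upwards [hw, ha.ae_lt_top hr] with t h1 h2
    rw [tendsto_iff_edist_tendsto_0]
    simp_rw [edist_comm _ (w t), edist_besov, h1, fourierCoef_mkBesov]
    exact tendsto_bnorm_sub_lowC P s hη h2
  · rw [eLpNorm_lt_top_iff_lintegral_rpow_enorm_lt_top (by simpa using hr) ENNReal.ofReal_ne_top,
      ENNReal.toReal_ofReal hr.le]
    refine lt_of_le_of_lt (setLIntegral_le_lintegral _ _) ?_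
    refine lt_of_le_of_lt (le_of_eq ?_) ((lpn_ne_top_iff hr).1 has.fin).lt_top
    refine lintegral_congr_ae ?_
    filter_upwards [hw] with t ht
    rw [enorm_besov, ht]
  · rw [ae_restrict_Icc_iff]
    filter_upwards [hf, hw] with t h1 h2 ht
    exact dist_ext fun l => by rw [h1 ht, h2]

/-- Continuity of each Fourier coefficient and boundedness in `B^s` imply continuity in every `B^{s'}`
with `s' < s`. -/
theorem continuousBesov_of_bounded {s s' T : ℝ} (hs : s' < s) {M : ℝ≥0∞} (hM : M ≠ ⊤)
    {f : ℝ → Dist} (hb : ∀ t ∈ Icc 0 T, bnorm P s (fourierCoef (f t)) ≤ M)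
    (hc : ∀ l, ContinuousOn (fun t => fourierCoef (f t) l) (Icc 0 T)) :
    ContinuousBesov P s' T f := by
  classical
  have hfin : ∀ t ∈ Icc 0 T, bnorm P s' (fourierCoef (f t)) < ⊤ := fun t ht =>
    (bnorm_mono P hs.le _).trans_lt
      (ENNReal.mul_lt_top ENNReal.ofReal_lt_top ((hb t ht).trans_lt hM.lt_top))
  let w : ℝ → Besov P s' := fun t =>
    if h : bnorm P s' (fourierCoef (f t)) < ⊤ then mkBesov P s' (fourierCoef (f t)) h else 0
  have hw : ∀ t ∈ Icc 0 T, fourierCoef (w t).toDist = fourierCoef (f t) := fun t ht => by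
    simp only [w, dif_pos (hfin t ht), fourierCoef_mkBesov]
  refine ⟨w, fun t ht => ?_, fun t ht => dist_ext fun l => by rw [hw t ht]⟩
  rw [ContinuousWithinAt, tendsto_iff_edist_tendsto_0]
  have h1 : Tendsto (fun r => bnorm P s' (fourierCoef (f r) - fourierCoef (f t)))
      (𝓝[Icc 0 T] t) (𝓝 0) := by
    refine tendsto_bnorm_zero P s' (sub_pos.2 hs) (M := M + M) (ENNReal.add_ne_top.2 ⟨hM, hM⟩) ?_ ?_
    · filter_upwards [self_mem_nhdsWithin] with r hr
      rw [add_sub_cancel]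
      exact (bnorm_sub_le P s _ _).trans (add_le_add (hb r hr) (hb t ht))
    · intro l
      have h2 := (hc l t ht).tendsto.sub_const (fourierCoef (f t) l)
      rwa [sub_self] at h2
  refine h1.congr' ?_
  filter_upwards [self_mem_nhdsWithin] with r hr
  rw [edist_besov, hw r hr, hw t ht]

theorem heatPair_expTest (t : ℝ) (f : Dist) (l : Freq) :
    heatPair t f (expTest (-l)) = heatC t (fourierCoef f) l := by
  have h1 : ∀ l' : Freq, fnPair (expFn l') (expTest (-l) : Plane → ℂ) =
      if l' = l then (2 * Real.pi : ℂ) else 0 := fun l' => fnPair_expFn_expFn l' l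
  unfold heatPair
  rw [tsum_eq_single l fun l' hl => by rw [h1, if_neg hl, mul_zero], h1, if_pos rfl, heatC,
    mul_comm _ (2 * Real.pi : ℂ), inv_mul_cancel_left₀ (by simp)]

/-- Testing the Duhamel integral: the series over the frequencies and the time integral may be
interchanged. -/
theorem integral_tsum_heatC {s : ℝ} {G : ℝ → Freq → ℂ} (hG : Measurable G)
    (hfin : ∫⁻ t, bnorm P s (G t) ≠ ⊤) {t : ℝ} (ht : 0 ≤ t) (φ : TestFn) :
    IntervalIntegrable (fun r => ∑' l, heatC (t - r) (G r) l * fnPair (expFn l) (φ : Plane → ℂ))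
        volume 0 t ∧
      ∫ r in (0 : ℝ)..t, ∑' l, heatC (t - r) (G r) l * fnPair (expFn l) (φ : Plane → ℂ) =
        ∑' l, duh G t l * fnPair (expFn l) (φ : Plane → ℂ) := by
  obtain ⟨C, K, hC, hb⟩ := exists_enorm_coef_le P s
  have hGl : ∀ l, Measurable fun r => G r l := fun l => (measurable_pi_apply l).comp hG
  have hmeas : ∀ l, Measurable fun r => heatC (t - r) (G r) l * fnPair (expFn l) (φ : Plane → ℂ) := by
    intro l
    have := hGl l
    unfold heatC
    fun_prop
  have hbound : ∀ l, ∫⁻ r in Ioc 0 t, ‖heatC (t - r) (G r) l * fnPair (expFn l) (φ : Plane → ℂ)‖ₑ ≤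
      ENNReal.ofReal (C * ((1 + ‖latticePoint l‖) ^ K * ‖fnPair (expFn l) (φ : Plane → ℂ)‖)) *
        ∫⁻ r, bnorm P s (G r) := by
    intro l
    rw [← lintegral_const_mul' _ _ ENNReal.ofReal_ne_top]
    refine le_trans (setLIntegral_mono' measurableSet_Ioc fun r hr => ?_)
      (setLIntegral_le_lintegral _ _)
    have h1 : ‖heatC (t - r) (G r) l‖ₑ ≤ ‖G r l‖ₑ := by
      rw [heatC, enorm_mul]
      refine mul_le_of_le_one_left' ?_
      rw [← ofReal_norm, Complex.norm_real, Real.norm_eq_abs, abs_of_pos (Real.exp_pos _)]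
      refine ENNReal.ofReal_le_one.2 (Real.exp_le_one_iff.2 ?_)
      rw [neg_mul]
      exact neg_nonpos.2 (mul_nonneg (sub_nonneg.2 hr.2) (by positivity))
    calc _ = ‖heatC (t - r) (G r) l‖ₑ * ‖fnPair (expFn l) (φ : Plane → ℂ)‖ₑ := enorm_mul _ _
      _ ≤ ENNReal.ofReal (C * (1 + ‖latticePoint l‖) ^ K) * bnorm P s (G r) *
          ‖fnPair (expFn l) (φ : Plane → ℂ)‖ₑ := by gcongr; exact h1.trans (hb _ l)
      _ = _ := by
          rw [← mul_assoc C, ENNReal.ofReal_mul (p := C * _) (by positivity), ofReal_norm]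
          ring
  have hsum : ∑' l, ∫⁻ r in Ioc 0 t,
      ‖heatC (t - r) (G r) l * fnPair (expFn l) (φ : Plane → ℂ)‖ₑ ≠ ⊤ := by
    refine ne_top_of_le_ne_top ?_ (ENNReal.tsum_le_tsum hbound)
    rw [ENNReal.tsum_mul_right]
    exact ENNReal.mul_ne_top ((summable_pow_mul_fnPair K φ).mul_left C).tsum_ofReal_ne_top hfin
  constructor
  · rw [intervalIntegrable_iff_integrableOn_Ioc_of_le ht]
    refine ⟨(Measurable.tsum hmeas).aestronglyMeasurable, ?_⟩
    refine lt_of_le_of_lt (lintegral_mono fun r => enorm_tsum_le_tsum_enorm) ?_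
    rw [lintegral_tsum fun l => (hmeas l).enorm.aemeasurable]
    exact hsum.lt_top
  · rw [intervalIntegral.integral_of_le ht,
      integral_tsum (fun l => (hmeas l).aestronglyMeasurable) hsum]
    refine tsum_congr fun l => ?_
    rw [integral_mul_const, duh, intervalIntegral.integral_of_le ht]

end

section

variable (P : DyadicPartition)

/-! ### The mild equation in terms of Fourier coefficients -/

/-- The nonlinearity in the form `v (v + 2 Ξ₁) + Ξ₂`, on the level of Fourier coefficients. -/
theorem exists_isProduct_iff {β ε : ℝ} (hε : 0 < ε) (hε1 : ε ≤ 1) (hβ : ε < β) {f g k F : Dist}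
    (hf : bnorm P β (fourierCoef f) < ⊤) (hg : bnorm P (-ε) (fourierCoef g) < ⊤) :
    (∃ q r : Dist, IsProduct P f f q ∧ IsProduct P f g r ∧ F = q + (2 : ℂ) • r + k) ↔
      fourierCoef F = prodC P (fourierCoef f) (fourierCoef f + (2 : ℂ) • fourierCoef g) +
        fourierCoef k := by
  have hf' : bnorm P (-ε) (fourierCoef f) < ⊤ := (bnorm_mono P (by linarith) _).trans_lt
    (ENNReal.mul_lt_top ENNReal.ofReal_lt_top hf)
  have hg2 : bnorm P (-ε) ((2 : ℂ) • fourierCoef g) < ⊤ := by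
    rw [bnorm_smul]
    exact ENNReal.mul_lt_top enorm_lt_top hg
  rw [prodC_add_right P hε hβ hf hf' hg2, prodC_smul_right]
  constructor
  · rintro ⟨q, r, hq, hr, rfl⟩
    rw [isProduct_iff P hε hε1 hβ hf hf'] at hq
    rw [isProduct_iff P hε hε1 hβ hf hg] at hr
    rw [← hq, ← hr]
    rfl
  · intro h
    obtain ⟨C, hC, hb⟩ := exists_bnorm_prodC_le_mul P hε hβ
    have hq : PolyBdd (prodC P (fourierCoef f) (fourierCoef f)) := polyBdd_of_bnorm_lt_top P
      ((hb _ _).trans_lt (ENNReal.mul_lt_top hC.lt_top (ENNReal.mul_lt_top hf hf')))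
    have hr : PolyBdd (prodC P (fourierCoef f) (fourierCoef g)) := polyBdd_of_bnorm_lt_top P
      ((hb _ _).trans_lt (ENNReal.mul_lt_top hC.lt_top (ENNReal.mul_lt_top hf hg)))
    refine ⟨hq.toDist, hr.toDist, (isProduct_iff P hε hε1 hβ hf hf').2 (fourierCoef_toDist hq),
      (isProduct_iff P hε hε1 hβ hf hg).2 (fourierCoef_toDist hr), dist_ext fun l => ?_⟩
    have e : fourierCoef (hq.toDist + (2 : ℂ) • hr.toDist + k) =
      fourierCoef hq.toDist + (2 : ℂ) • fourierCoef hr.toDist + fourierCoef k := rfl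
    rw [h, e, fourierCoef_toDist, fourierCoef_toDist]

theorem PolyBdd.heatC {a : Freq → ℂ} (h : PolyBdd a) {t : ℝ} (ht : 0 ≤ t) :
    PolyBdd (heatC t a) := by
  obtain ⟨C, K, hb⟩ := h
  refine ⟨C, K, fun l => le_trans ?_ (hb l)⟩
  rw [TorusHeat.heatC, norm_mul, Complex.norm_real, Real.norm_eq_abs, abs_of_pos (Real.exp_pos _)]
  refine mul_le_of_le_one_left (norm_nonneg _) (Real.exp_le_one_iff.2 ?_)
  rw [neg_mul]
  exact neg_nonpos.2 (by positivity)

variable {P}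

/-- The mild equation holds if and only if it holds for all Fourier coefficients. -/
theorem isMildSolution_iff {ε β γ p q ϱ s T T₁ : ℝ} (h : Admissible ε β γ p q) (hε1 : ε ≤ 1)
    (hs : s ≤ -ε) (hϱ : 1 ≤ ϱ) (hTT : T ≤ T₁) (hT₁ : T₁ ≤ 1)
    {Ξ₁ Ξ₂ f : ℝ → Dist} {u₀ : Dist} {x y a : ℝ → Freq → ℂ}
    (hx : Curve P (-ε) p T₁ x) (hxΞ : ∀ᵐ t, t ∈ Ioc 0 T₁ → fourierCoef (Ξ₁ t) = x t)
    (hy : Curve P s ϱ T₁ y) (hyΞ : ∀ᵐ t, t ∈ Ioc 0 T₁ → fourierCoef (Ξ₂ t) = y t)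
    (ha : Curve P β γ T a) (hfa : ∀ᵐ t, t ∈ Ioc 0 T → fourierCoef (f t) = a t) :
    IsMildSolution P T Ξ₁ Ξ₂ u₀ f ↔
      ∀ t ∈ Icc 0 T, fourierCoef (f t) = mild P ((2 : ℂ) • x) y (fourierCoef u₀) a t := by
  have hT := hTT.trans hT₁
  have hp := h.conj.lt
  have hγ : 0 < γ := one_pos.trans_le h.one_le
  have hx2 := hx.smul (by linarith) (2 : ℂ)
  have hax : Curve P (-ε) p T₁ (a + (2 : ℂ) • x) :=
    (((ha.mono_index hγ (by linarith [h.pos, h.lt])).mono_exponent (by linarith) h.p_le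
      hT).mono_time hTT).add hp.le hx2
  obtain ⟨G, hG⟩ : ∃ G, G = (fun s => prodC P (a s) ((a + (2 : ℂ) • x) s)) + y := ⟨_, rfl⟩
  have hGc : Curve P s 1 T₁ G := by
    rw [hG]
    exact (((ha.prodC h hT hax).mono_index one_pos hs).mono_time hTT).add le_rfl
      (hy.mono_exponent one_pos hϱ hT₁)
  have hmild : ∀ t, mild P ((2 : ℂ) • x) y (fourierCoef u₀) a t =
      heatC t (fourierCoef u₀) + duh G t := fun t => by rw [hG]; rfl
  have hprod : ∀ᵐ t, t ∈ Ioc 0 T → ∀ F : Dist,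
      (∃ q r : Dist, IsProduct P (f t) (f t) q ∧ IsProduct P (f t) (Ξ₁ t) r ∧
        F = q + (2 : ℂ) • r + Ξ₂ t) ↔ fourierCoef F = G t := by
    filter_upwards [hxΞ, hyΞ, hfa, ha.ae_lt_top hγ, hx.ae_lt_top (by linarith)] with
      t h1 h2 h3 h4 h5 ht F
    have ht₁ : t ∈ Ioc 0 T₁ := ⟨ht.1, ht.2.trans hTT⟩
    rw [exists_isProduct_iff P h.pos hε1 h.lt (by rwa [h3 ht]) (by rwa [h1 ht₁]), h1 ht₁, h2 ht₁,
      h3 ht, hG]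
    rfl
  constructor
  · rintro ⟨F, hF, heq⟩ t ht
    have hFG : ∀ᵐ r ∂(volume.restrict (Ioc 0 t)), fourierCoef (F r) = G r := by
      rw [ae_restrict_iff' measurableSet_Ioc]
      filter_upwards [hprod, ae_restrict_Icc_iff.1 hF] with r h1 h2 hr
      have hr' : r ∈ Ioc 0 T := ⟨hr.1, hr.2.trans ht.2⟩
      exact (h1 hr' (F r)).1 (h2 hr')
    ext l
    have h1 := (heq t ht (expTest (-l))).2
    simp_rw [heatPair_expTest] at h1
    rw [hmild, ← duh_congr ht.1 hFG]
    exact h1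
  · intro hf
    classical
    let F : ℝ → Dist := fun r => if hr : PolyBdd (G r) then hr.toDist else 0
    have hFG : ∀ᵐ r, fourierCoef (F r) = G r := by
      filter_upwards [hGc.ae_lt_top one_pos] with r hr
      simp only [F, dif_pos (polyBdd_of_bnorm_lt_top P hr), fourierCoef_toDist]
    refine ⟨F, ?_, fun t ht φ => ?_⟩
    · rw [ae_restrict_Icc_iff]
      filter_upwards [hprod, hFG] with r h1 h2 hr
      exact (h1 hr (F r)).2 h2
    · obtain ⟨hint, hval⟩ := integral_tsum_heatC P hGc.meas (hGc.lintegral_ne_top le_rfl hT₁) ht.1 φ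
      have hae : ∀ᵐ r, heatPair (t - r) (F r) φ = (2 * Real.pi : ℂ)⁻¹ *
          ∑' l, heatC (t - r) (G r) l * fnPair (expFn l) (φ : Plane → ℂ) := by
        filter_upwards [hFG] with r hr
        rw [heatPair, hr]
        rfl
      constructor
      · refine (hint.const_mul (2 * Real.pi : ℂ)⁻¹).congr_ae (ae_restrict_of_ae ?_)
        filter_upwards [hae] with r hr
        exact hr.symm
      · have h1 : ∫ r in (0 : ℝ)..t, heatPair (t - r) (F r) φ = (2 * Real.pi : ℂ)⁻¹ *
            ∑' l, duh G t l * fnPair (expFn l) (φ : Plane → ℂ) := by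
          rw [← hval, ← intervalIntegral.integral_const_mul]
          exact intervalIntegral.integral_congr_ae (hae.mono fun r hr _ => hr)
        have hs1 := ((polyBdd_fourierCoef u₀).heatC ht.1).summable φ
        have hs2 := (polyBdd_fourierCoef (f t)).summable φ
        have hs3 : Summable fun l => duh G t l * fnPair (expFn l) (φ : Plane → ℂ) := by
          refine (hs2.sub hs1).congr fun l => ?_
          rw [hf t ht, hmild, Pi.add_apply]
          ring
        rw [h1, pair_eq_tsum, hf t ht, hmild, heatPair, ← mul_add]
        congr 1
        refine (tsum_congr fun l => ?_).trans (hs1.tsum_add hs3)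
        rw [Pi.add_apply, add_mul]

end

end TorusHeat

end

theorem proposition5p2 (P : TorusHeat.DyadicPartition) (ε T : ℝ)
    (hε : 0 < ε) (hε' : ε < 1 / 2) (hT : 0 < T)
    (Ξ₁ Ξ₂ : ℝ → TorusHeat.Dist)
    (hΞ₁ : TorusHeat.MemLpBesov P (-ε) (ENNReal.ofReal (2 / (1 - ε))) T Ξ₁)
    (hΞ₂ : TorusHeat.MemLpBesov P (-(2 * ε)) (ENNReal.ofReal (1 / (1 - ε))) T Ξ₂)
    (γ δ : ℝ) (hγ : 2 / (1 - ε) < γ) (hγ' : γ < 2 / ε) (hδ : 0 < δ) (hδ' : δ < 2 / γ - ε)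
    (u₀ : TorusHeat.Dist) (hu₀ : u₀ ∈ TorusHeat.besovSpace P (2 / γ - δ)) :
    ∃ T₀ : ℝ, 0 < T₀ ∧ T₀ ≤ T ∧ ∀ T' : ℝ, 0 < T' → T' ≤ T₀ →
      ∃ v : ℝ → TorusHeat.Dist, TorusHeat.IsSolutionIn P γ δ T' Ξ₁ Ξ₂ u₀ v ∧
        ∀ w : ℝ → TorusHeat.Dist, TorusHeat.IsSolutionIn P γ δ T' Ξ₁ Ξ₂ u₀ w →
          Set.EqOn w v (Set.Icc 0 T') := by
  open TorusHeat MeasureTheory Filter Topology Set in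
  have h1ε : 0 < 1 - ε := by linarith
  have hγ0 : 0 < γ := lt_trans (by positivity) hγ
  have hγinv : 2 / γ < 1 - ε := by rwa [div_lt_comm₀ hγ0 h1ε]
  have hp : 0 < 2 / (1 - ε) := by positivity
  have hϱ : 1 ≤ 1 / (1 - ε) := by rw [le_div_iff₀ h1ε]; linarith
  have hadm : Admissible ε (2 / γ - δ) γ (2 / (1 - ε)) (2 / (1 + ε)) :=
    admissible hε (by linarith) (by linarith) hγ
  -- times up to one: there `L^γ` embeds into `L^p` with norm one, and the smoothing estimate holds
  obtain ⟨T₁, hT₁⟩ : ∃ T₁, T₁ = min 1 T := ⟨_, rfl⟩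
  have hT₁0 : 0 < T₁ := hT₁ ▸ lt_min one_pos hT
  have hT₁1 : T₁ ≤ 1 := hT₁ ▸ min_le_left _ _
  have hT₁T : T₁ ≤ T := hT₁ ▸ min_le_right _ _
  obtain ⟨x, hx, hxΞ⟩ := exists_curve_of_memLpBesov P hp hT₁T hΞ₁
  obtain ⟨y, hy, hyΞ⟩ := exists_curve_of_memLpBesov P (by positivity) hT₁T hΞ₂
  have hx2 := hx.smul hp (2 : ℂ)
  have hu : bnorm P (2 / γ - δ) (fourierCoef u₀) < ⊤ := hu₀
  obtain ⟨T₀, hT₀, hT₀₁, hsol⟩ := exists_mild_solution P hε hε' hγ hδ hδ' hT₁0 hT₁1 hx2 hy hu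
  refine ⟨T₀, hT₀, hT₀₁.trans hT₁T, fun T' hT' hTT' => ?_⟩
  have hTT₁ : T' ≤ T₁ := hTT'.trans hT₀₁
  obtain ⟨a, ha, haV, s, M, hs, hM, hb⟩ := hsol T' hT' hTT'
  have haβ : Curve P (2 / γ - δ) γ T' a := ha.mono_index hγ0 (by linarith)
  -- `a` solves the equation almost everywhere; its right hand side `V` solves it for all times
  obtain ⟨V, hV⟩ : ∃ V, V = mild P ((2 : ℂ) • x) y (fourierCoef u₀) a := ⟨_, rfl⟩
  rw [← hV] at haV hb
  classical
  let v : ℝ → Dist := fun t => if h : PolyBdd (V t) then h.toDist else 0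
  have hv : ∀ t ∈ Icc 0 T', fourierCoef (v t) = V t := fun t ht => by
    have h : PolyBdd (V t) := polyBdd_of_bnorm_lt_top P ((hb t ht).trans_lt hM.lt_top)
    simp only [v, dif_pos h, fourierCoef_toDist]
  have hva : ∀ᵐ t, t ∈ Ioc 0 T' → fourierCoef (v t) = a t := by
    filter_upwards [haV] with t h1 ht
    rw [hv t (Ioc_subset_Icc_self ht), h1 ht]
  have hiff : ∀ {w : ℝ → Dist} {b : ℝ → Freq → ℂ}, Curve P (2 / γ - δ) γ T' b →
      (∀ᵐ t, t ∈ Ioc 0 T' → fourierCoef (w t) = b t) →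
      (IsMildSolution P T' Ξ₁ Ξ₂ u₀ w ↔ ∀ t ∈ Icc 0 T', fourierCoef (w t) =
        mild P ((2 : ℂ) • x) y (fourierCoef u₀) b t) := fun hb hwb =>
    isMildSolution_iff hadm (by linarith) (by linarith) hϱ hTT₁ hT₁1 hx hxΞ hy hyΞ hb hwb
  refine ⟨v, ⟨?_, ?_, ?_⟩, ?_⟩
  · refine memLpBesov_of_curve P (η := δ / 2) (by linarith) hγ0 ?_ hva
    rwa [show 2 / γ - δ + δ / 2 = 2 / γ - δ / 2 by ring]
  · refine continuousBesov_of_bounded P hs hM (fun t ht => by rw [hv t ht]; exact hb t ht)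
      fun l => ?_
    have hax := (((haβ.mono_index hγ0 (by linarith)).mono_exponent hp hadm.p_le
      (hTT₁.trans hT₁1)).mono_time hTT₁).add hadm.conj.lt.le hx2
    have hc : Continuous fun t => V t l := by
      have h1 := continuous_duh (l := l) (F := (fun s => prodC P (a s) ((a + (2 : ℂ) • x) s)) + y)
        (((haβ.prodC hadm (hTT₁.trans hT₁1) hax).integrable le_rfl (hTT₁.trans hT₁1) l).add
          (hy.integrable hϱ hT₁1 l))
      have h2 : Continuous fun t : ℝ => heatC t (fourierCoef u₀) l := by
        unfold heatC
        fun_prop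
      rw [hV]
      exact h2.add h1
    exact hc.continuousOn.congr fun t ht => by rw [hv t ht]
  · rw [hiff haβ hva]
    intro t ht
    rw [hv t ht, hV]
  · rintro w ⟨hw, -, hwm⟩ t ht
    obtain ⟨b, hbc, hwb⟩ := exists_curve_of_memLpBesov P hγ0 le_rfl hw
    rw [hiff hbc hwb] at hwm
    have hbm : ∀ᵐ r, r ∈ Ioc 0 T' → b r = mild P ((2 : ℂ) • x) y (fourierCoef u₀) b r := by
      filter_upwards [hwb] with r h1 hr
      rw [← h1 hr, hwm r (Ioc_subset_Icc_self hr)]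
    have hab : b =ᵐ[volume] a :=
      ae_eq_of_mild hε hε' hγ hδ hδ' hT₁1 hx2 hy hT' hTT₁ hbc haβ hbm (hV ▸ haV)
    have e : duh ((fun r => prodC P (b r) ((b + (2 : ℂ) • x) r)) + y) t =
        duh ((fun r => prodC P (a r) ((a + (2 : ℂ) • x) r)) + y) t := by
      refine duh_congr ht.1 (ae_restrict_of_ae ?_)
      filter_upwards [hab] with r hr
      simp only [Pi.add_apply, hr]
    refine dist_ext fun l => ?_
    rw [hwm t ht, hv t ht, hV, mild, mild, e]
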